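/- **Setting.** A *box space of graphs* is a disjoint union $X=\bigsqcup_i X_i$ of a sequence $(X_i)_{i\in\mathbb N}$ of finite graphs, not necessarily connected, of uniformly bounded degree and with $|X_i|\to\infty$; its metric $d$ is the graph metric on each connected component and $\infty$ between different components. The Laplace operator is $(\Delta f)(x)=\sum_{y\sim x}(f(x)-f(y))$. An operator is said to have spectral gap $c>0$ if its spectrum is contained in $\{0\}\cup[c,\infty)$. * $X$ is an *expander* if $\Delta$ has spectral gap $c$ on $\ell^2(X)$ for some $c>0$. * Let $\mathfrak u$ be a non-principal ultrafilter on $\mathbb N$ and $\mu_i$ the normalized counting measure on $X_i$. Let $\mathcal H_{\mathfrak u}$ be the Hilbert space of bounded sequences $(f_i)$, $f_i\in L^2(X_i,\mu_i)$, for which $(|f_i|^2)$ is uniformly integrable, with inner product $\lim_{i\to\mathfrak u}\langle f_i,g_i\rangle$, modulo sequences of norm $0$. $X$ has *spectral gap $c$ in the ultraproduct along $\mathfrak u$* if $\Delta$, acting termwise, has spectral gap $c$ on $\mathcal H_{\mathfrak u}$. * $X$ and $X'$ are *approximately isomorphic* if there are subgraphs $Y_i\subseteq X_i$ and $Y_i'\subseteq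 X_i'$ with $Y_i\cong Y_i'$ such that $|Y_i|/|X_i|$, $|Y'_i|/|X'_i|$, $|E(Y_i)|/|E(X_i)|$ and $|E(Y_i')|/|E(X_i')|$ all tend to $1$. * Let $G(X)=\bigcup_{R>0}\overline{E_R}\subseteq\beta X\times\beta X$, where $E_R=\{(x,y)\in X\times X: d(x,y)\le R\}$, be the coarse groupoid. $X$ has *almost boundary (T)* if there are $Y_i\subseteq X_i$ with $|Y_i|/|X_i|\to1$ and $c>0$ such that $\Delta$ has spectral gap $c$ in the maximal groupoid $C^*$-algebra $C^*_{\max}(G(X)|_Z)$, where $Y=\bigcup_iY_i$ and $Z\subseteq\partial\beta X$ is the complement in $\partial\beta X=\beta X\setminus X$ of the $G(X)$-saturation of $\overline{X\setminus Y}\cap\partial\beta X$. **Theorem.** Let $X=\bigsqcup_i X_i$ be a box space of graphs. 1. If $X$ is approximately isomorphic to an expander, then there is $c>0$ such that $X$ has spectral gap $c$ in the ultraproduct along every non-principal ultrafilter $\mathfrak u$ on $\mathbb N$. 2. Assume that $\liminf_i |E(X_i)|/|X_i|>0$. Then there is $c>0$ such that $X$ has spectral gap $c$ in the ultraproduct along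 every non-principal ultrafilter $\mathfrak u$ on $\mathbb N$ if and only if $X$ is approximately isomorphic to an expander. In particular, if $X$ has almost boundary (T), then $X$ is approximately isomorphic to an expander. -/

import Mathlib

open Filter Topology

/-- A box space of graphs: a sequence of finite graphs (not necessarily connected) of uniformly
bounded degree whose numbers of vertices tend to infinity. -/
structure BoxSpace where
  V : ℕ → Type
  fintype : ∀ i, Fintype (V i)
  graph : ∀ i, SimpleGraph (V i)
  exists_degree_le : ∃ d : ℕ, ∀ i v, ((graph i).neighborSet v).ncard ≤ d
  tendsto_card : Tendsto (fun i => Nat.card (V i)) atTop atTop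

attribute [instance] BoxSpace.fintype

noncomputable section

open Classical in
/-- The set of neighbours of a vertex. -/
def nbrs {V : Type} [Fintype V] (G : SimpleGraph V) (v : V) : Finset V :=
  Finset.univ.filter (G.Adj v)

theorem mem_nbrs {V : Type} [Fintype V] {G : SimpleGraph V} {v w : V} :
    w ∈ nbrs G v ↔ G.Adj v w := by
  simp [nbrs]

theorem card_nbrs {V : Type} [Fintype V] (G : SimpleGraph V) (v : V) :
    (nbrs G v).card = (G.neighborSet v).ncard := by
  rw [← Set.ncard_coe_finset]
  congr 1
  ext w
  simp [mem_nbrs]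

/-- The Laplace operator of a finite graph, `(Δ f)(v) = ∑_{w ∼ v} (f v - f w)`. -/
def graphLaplacian {V : Type} [Fintype V] (G : SimpleGraph V) : (V → ℂ) →ₗ[ℂ] (V → ℂ) where
  toFun f v := ∑ w ∈ nbrs G v, (f v - f w)
  map_add' f g := by
    funext v
    simp only [Pi.add_apply, ← Finset.sum_add_distrib]
    exact Finset.sum_congr rfl fun _ _ => by ring
  map_smul' c f := by
    funext v
    simp only [Pi.smul_apply, smul_eq_mul, RingHom.id_apply, Finset.mul_sum]
    exact Finset.sum_congr rfl fun _ _ => by ring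

open Classical in
theorem sum_sq_graphLaplacian_le {V : Type} [Fintype V] (G : SimpleGraph V) {d : ℕ}
    (hd : ∀ v, (nbrs G v).card ≤ d) (f : V → ℂ) (T : Finset V) :
    ∑ v ∈ T, ‖graphLaplacian G f v‖ ^ 2 ≤
      2 * (d : ℝ) ^ 2 * ∑ v ∈ T, ‖f v‖ ^ 2 +
        2 * (d : ℝ) ^ 2 * ∑ v ∈ T.biUnion (nbrs G), ‖f v‖ ^ 2 := by
  have h1 : ∀ v, ‖graphLaplacian G f v‖ ^ 2 ≤
      2 * (d : ℝ) ^ 2 * ‖f v‖ ^ 2 + 2 * d * ∑ w ∈ nbrs G v, ‖f w‖ ^ 2 := by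
    intro v
    have hc : ((nbrs G v).card : ℝ) ≤ d := by exact_mod_cast hd v
    have hS : 0 ≤ ∑ w ∈ nbrs G v, ‖f w‖ ^ 2 := Finset.sum_nonneg fun _ _ => by positivity
    calc ‖graphLaplacian G f v‖ ^ 2 ≤ (∑ w ∈ nbrs G v, ‖f v - f w‖) ^ 2 := by
          gcongr
          exact norm_sum_le _ _
      _ ≤ (nbrs G v).card * ∑ w ∈ nbrs G v, ‖f v - f w‖ ^ 2 := sq_sum_le_card_mul_sum_sq
      _ ≤ (nbrs G v).card * ∑ w ∈ nbrs G v, (2 * ‖f v‖ ^ 2 + 2 * ‖f w‖ ^ 2) := by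
          gcongr with w _
          have := norm_sub_le (f v) (f w)
          nlinarith [sq_nonneg (‖f v‖ - ‖f w‖), norm_nonneg (f v - f w)]
      _ = 2 * ((nbrs G v).card : ℝ) ^ 2 * ‖f v‖ ^ 2 +
            2 * (nbrs G v).card * ∑ w ∈ nbrs G v, ‖f w‖ ^ 2 := by
          rw [Finset.sum_add_distrib, Finset.sum_const, nsmul_eq_mul, ← Finset.mul_sum]
          ring
      _ ≤ _ := by gcongr
  have h2 : ∑ v ∈ T, ∑ w ∈ nbrs G v, ‖f w‖ ^ 2 ≤
      d * ∑ w ∈ T.biUnion (nbrs G), ‖f w‖ ^ 2 := by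
    have h3 : ∀ v ∈ T, ∑ w ∈ nbrs G v, ‖f w‖ ^ 2 =
        ∑ w ∈ T.biUnion (nbrs G), if G.Adj v w then ‖f w‖ ^ 2 else 0 := by
      intro v hv
      rw [← Finset.sum_filter]
      refine Finset.sum_congr ?_ fun _ _ => rfl
      ext w
      simp only [mem_nbrs, Finset.mem_filter, Finset.mem_biUnion]
      exact ⟨fun h => ⟨⟨v, hv, h⟩, h⟩, fun h => h.2⟩
    rw [Finset.sum_congr rfl h3, Finset.sum_comm, Finset.mul_sum]
    refine Finset.sum_le_sum fun w _ => ?_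
    rw [← Finset.sum_filter, Finset.sum_const, nsmul_eq_mul]
    have : (T.filter fun v => G.Adj v w).card ≤ d := by
      refine (Finset.card_le_card fun v hv => ?_).trans (hd w)
      rw [mem_nbrs]
      exact (Finset.mem_filter.1 hv).2.symm
    gcongr
  calc ∑ v ∈ T, ‖graphLaplacian G f v‖ ^ 2
      ≤ ∑ v ∈ T, (2 * (d : ℝ) ^ 2 * ‖f v‖ ^ 2 + 2 * d * ∑ w ∈ nbrs G v, ‖f w‖ ^ 2) :=
        Finset.sum_le_sum fun v _ => h1 v
    _ = 2 * (d : ℝ) ^ 2 * ∑ v ∈ T, ‖f v‖ ^ 2 +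
          2 * d * ∑ v ∈ T, ∑ w ∈ nbrs G v, ‖f w‖ ^ 2 := by
        rw [Finset.sum_add_distrib, ← Finset.mul_sum, ← Finset.mul_sum]
    _ ≤ 2 * (d : ℝ) ^ 2 * ∑ v ∈ T, ‖f v‖ ^ 2 +
          2 * d * (d * ∑ w ∈ T.biUnion (nbrs G), ‖f w‖ ^ 2) := by gcongr
    _ = _ := by ring

theorem sum_sq_graphLaplacian_le_univ {V : Type} [Fintype V] (G : SimpleGraph V) {d : ℕ}
    (hd : ∀ v, (nbrs G v).card ≤ d) (f : V → ℂ) :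
    ∑ v, ‖graphLaplacian G f v‖ ^ 2 ≤ (2 * (d : ℝ)) ^ 2 * ∑ v, ‖f v‖ ^ 2 := by
  classical
  refine (sum_sq_graphLaplacian_le G hd f Finset.univ).trans ?_
  have : ∑ v ∈ Finset.univ.biUnion (nbrs G), ‖f v‖ ^ 2 ≤ ∑ v, ‖f v‖ ^ 2 :=
    Finset.sum_le_sum_of_subset_of_nonneg (Finset.subset_univ _) fun _ _ _ => by positivity
  nlinarith [sq_nonneg (d : ℝ)]

namespace BoxSpace

variable (X : BoxSpace)

/-- The vertex set of the disjoint union of the graphs. -/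
abbrev Pt : Type := Σ i, X.V i

/-- The Hilbert space `ℓ²(X)` of the disjoint union. -/
abbrev L2 : Type := lp (fun _ : X.Pt => ℂ) 2

theorem exists_card_nbrs_le : ∃ d : ℕ, ∀ i v, (nbrs (X.graph i) v).card ≤ d := by
  obtain ⟨d, hd⟩ := X.exists_degree_le
  exact ⟨d, fun i v => by rw [card_nbrs]; exact hd i v⟩

/-- Some uniform bound for the degrees. -/
def degBound : ℕ := X.exists_card_nbrs_le.choose

theorem card_nbrs_le (i : ℕ) (v : X.V i) : (nbrs (X.graph i) v).card ≤ X.degBound :=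
  X.exists_card_nbrs_le.choose_spec i v

/-- The Laplace operator on functions on the disjoint union; see `laplacian_apply`. -/
def lapFun (f : X.Pt → ℂ) : X.Pt → ℂ :=
  fun x => graphLaplacian (X.graph x.1) (fun w => f ⟨x.1, w⟩) x.2

theorem sum_sq_lapFun_le (f : X.L2) (s : Finset X.Pt) :
    ∑ x ∈ s, ‖X.lapFun f x‖ ^ 2 ≤ (2 * (X.degBound : ℝ) * ‖f‖) ^ 2 := by
  classical
  have hsub : s ⊆ (s.image Sigma.fst).sigma fun i => (Finset.univ : Finset (X.V i)) := by
    intro x hx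
    simp only [Finset.mem_sigma, Finset.mem_univ, and_true]
    exact Finset.mem_image_of_mem _ hx
  have hn : ∀ t : Finset X.Pt, ∑ x ∈ t, ‖f x‖ ^ 2 ≤ ‖f‖ ^ 2 := by
    intro t
    have := lp.sum_rpow_le_norm_rpow (p := 2) (by norm_num) f t
    simpa using this
  calc ∑ x ∈ s, ‖X.lapFun f x‖ ^ 2
      ≤ ∑ x ∈ (s.image Sigma.fst).sigma fun i => (Finset.univ : Finset (X.V i)),
          ‖X.lapFun f x‖ ^ 2 :=
        Finset.sum_le_sum_of_subset_of_nonneg hsub fun _ _ _ => by positivity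
    _ = ∑ i ∈ s.image Sigma.fst, ∑ v, ‖graphLaplacian (X.graph i) (fun w => f ⟨i, w⟩) v‖ ^ 2 := by
        rw [Finset.sum_sigma]
        rfl
    _ ≤ ∑ i ∈ s.image Sigma.fst, (2 * (X.degBound : ℝ)) ^ 2 * ∑ v : X.V i, ‖f ⟨i, v⟩‖ ^ 2 :=
        Finset.sum_le_sum fun i _ => sum_sq_graphLaplacian_le_univ _ (X.card_nbrs_le i) _
    _ = (2 * (X.degBound : ℝ)) ^ 2 *
          ∑ x ∈ (s.image Sigma.fst).sigma fun i => (Finset.univ : Finset (X.V i)), ‖f x‖ ^ 2 := by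
        rw [Finset.sum_sigma, Finset.mul_sum]
    _ ≤ (2 * (X.degBound : ℝ)) ^ 2 * ‖f‖ ^ 2 := by gcongr; exact hn _
    _ = _ := by ring

/-- The Laplace operator `Δ` as a bounded operator on `ℓ²(X)`. -/
def laplacian : X.L2 →L[ℂ] X.L2 :=
  LinearMap.mkContinuous
    { toFun := fun f => ⟨X.lapFun f, memℓp_gen' (C := (2 * (X.degBound : ℝ) * ‖f‖) ^ 2)
        fun s => by simpa using X.sum_sq_lapFun_le f s⟩
      map_add' := fun f g => by
        ext x
        exact congrFun ((graphLaplacian (X.graph x.1)).map_add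
          (fun w => f ⟨x.1, w⟩) (fun w => g ⟨x.1, w⟩)) x.2
      map_smul' := fun c f => by
        ext x
        exact congrFun ((graphLaplacian (X.graph x.1)).map_smul c (fun w => f ⟨x.1, w⟩)) x.2 }
    (2 * X.degBound)
    (fun f => lp.norm_le_of_forall_sum_le (by norm_num) (by positivity)
      fun s => by simpa using X.sum_sq_lapFun_le f s)

theorem laplacian_apply (f : X.L2) (i : ℕ) (v : X.V i) :
    X.laplacian f ⟨i, v⟩ = ∑ w ∈ nbrs (X.graph i) v, (f ⟨i, v⟩ - f ⟨i, w⟩) := rfl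


section Roe

/-- The disjoint union of the graphs, as one graph. -/
def disjointUnion : SimpleGraph X.Pt where
  Adj x y := ∃ (i : ℕ) (v w : X.V i), (X.graph i).Adj v w ∧ x = ⟨i, v⟩ ∧ y = ⟨i, w⟩
  symm := ⟨by
    rintro x y ⟨i, v, w, h, rfl, rfl⟩
    exact ⟨i, w, v, h.symm, rfl, rfl⟩⟩
  loopless := ⟨by
    rintro x ⟨i, v, w, h, rfl, h2⟩
    obtain rfl : v = w := by simpa using h2
    exact (X.graph i).loopless.irrefl v h⟩

/-- The metric of the disjoint union: the graph distance on each connected component, and infinity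
between different connected components. -/
def dist (x y : X.Pt) : ℕ∞ := X.disjointUnion.edist x y

theorem dist_comm (x y : X.Pt) : X.dist x y = X.dist y x := SimpleGraph.edist_comm

open Classical in
/-- The standard basis vector `δ_x` of `ℓ²(X)`. -/
def delta (x : X.Pt) : X.L2 := lp.single 2 x 1

variable {X}

/-- The matrix coefficient `T_{xy} = ⟨T δ_x, δ_y⟩` (the inner product of Mathlib is linear in its second
argument). -/
def entry (T : X.L2 →L[ℂ] X.L2) (x y : X.Pt) : ℂ := inner ℂ (X.delta y) (T (X.delta x))

theorem inner_delta (x : X.Pt) (f : X.L2) : inner ℂ (X.delta x) f = f x := by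
  classical
  rw [delta, lp.inner_single_left]
  simp

theorem entry_eq (T : X.L2 →L[ℂ] X.L2) (x y : X.Pt) : entry T x y = T (X.delta x) y :=
  inner_delta _ _

theorem delta_self (x : X.Pt) : X.delta x x = 1 := by
  classical
  simp [delta]

theorem delta_ne {x y : X.Pt} (h : y ≠ x) : X.delta x y = 0 := by
  classical
  rw [delta, lp.single_apply_ne]
  exact h

theorem entry_star (T : X.L2 →L[ℂ] X.L2) (x y : X.Pt) :
    entry (star T) x y = starRingEnd ℂ (entry T y x) := by
  rw [entry, entry, ContinuousLinearMap.star_eq_adjoint, ContinuousLinearMap.adjoint_inner_right,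
    inner_conj_symm]

theorem hasSum_apply (T : X.L2 →L[ℂ] X.L2) (f : X.L2) (y : X.Pt) :
    HasSum (fun z => entry T z y * f z) (T f y) := by
  have h := lp.hasSum_inner (𝕜 := ℂ) (star T (X.delta y)) f
  rw [ContinuousLinearMap.star_eq_adjoint, ContinuousLinearMap.adjoint_inner_left,
    inner_delta] at h
  have hz : (fun z => entry T z y * f z) =
      fun z => inner ℂ ((ContinuousLinearMap.adjoint T) (X.delta y) z) (f z) := by
    funext z
    rw [RCLike.inner_apply, ← ContinuousLinearMap.star_eq_adjoint, ← entry_eq, entry_star,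
      Complex.conj_conj, mul_comm]
  rw [hz]
  exact h

theorem entry_ext {S T : X.L2 →L[ℂ] X.L2} (h : ∀ x y, entry S x y = entry T x y) : S = T := by
  ext f y
  refine (hasSum_apply S f y).unique ?_
  simpa only [h] using hasSum_apply T f y

theorem entry_add (S T : X.L2 →L[ℂ] X.L2) (x y : X.Pt) :
    entry (S + T) x y = entry S x y + entry T x y := by
  simp [entry]

theorem entry_sub (S T : X.L2 →L[ℂ] X.L2) (x y : X.Pt) :
    entry (S - T) x y = entry S x y - entry T x y := by
  simp [entry]

theorem entry_zero (x y : X.Pt) : entry (0 : X.L2 →L[ℂ] X.L2) x y = 0 := by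
  simp [entry]

theorem entry_smul (c : ℂ) (T : X.L2 →L[ℂ] X.L2) (x y : X.Pt) :
    entry (c • T) x y = c * entry T x y := by
  simp [entry]

theorem entry_sum {ι : Type*} (s : Finset ι) (T : ι → X.L2 →L[ℂ] X.L2) (x y : X.Pt) :
    entry (∑ i ∈ s, T i) x y = ∑ i ∈ s, entry (T i) x y := by
  classical
  induction s using Finset.induction_on with
  | empty => simp [entry_zero]
  | insert a s ha ih => rw [Finset.sum_insert ha, Finset.sum_insert ha, entry_add, ih]

theorem entry_algebraMap_ne (c : ℂ) {x y : X.Pt} (h : x ≠ y) :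
    entry (algebraMap ℂ (X.L2 →L[ℂ] X.L2) c) x y = 0 := by
  rw [entry_eq, Algebra.algebraMap_eq_smul_one]
  simp [delta_ne h.symm]

theorem entry_algebraMap_self (c : ℂ) (x : X.Pt) :
    entry (algebraMap ℂ (X.L2 →L[ℂ] X.L2) c) x x = c := by
  rw [entry_eq, Algebra.algebraMap_eq_smul_one]
  simp [delta_self]

theorem norm_delta (x : X.Pt) : ‖X.delta x‖ = 1 := by
  classical
  rw [delta, lp.norm_single (by norm_num)]
  simp

theorem norm_entry_le (T : X.L2 →L[ℂ] X.L2) (x y : X.Pt) : ‖entry T x y‖ ≤ ‖T‖ := by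
  refine (norm_inner_le_norm _ _).trans ?_
  rw [norm_delta, one_mul]
  simpa [norm_delta] using T.le_opNorm (X.delta x)

variable (X)

/-- The algebraic Roe algebra `ℂ[X]`: the operators on `ℓ²(X)` of finite propagation. -/
def roe : StarSubalgebra ℂ (X.L2 →L[ℂ] X.L2) where
  carrier := {T | ∃ R : ℕ, ∀ x y, (R : ℕ∞) ≤ X.dist x y → entry T x y = 0}
  mul_mem' := by
    rintro S T ⟨R, hS⟩ ⟨R', hT⟩
    refine ⟨R + R', fun x y hxy => ?_⟩
    rw [entry_eq]
    refine (hasSum_apply S (T (X.delta x)) y).unique ?_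
    convert hasSum_zero using 2 with z
    rw [← entry_eq]
    rcases le_total (R' : ℕ∞) (X.dist x z) with h | h
    · rw [hT x z h, mul_zero]
    · rw [hS z y, zero_mul]
      by_contra! h2
      have h3 : X.dist x y ≤ X.dist x z + X.dist z y := SimpleGraph.edist_triangle
      have h4 : X.dist x z + X.dist z y < R' + R :=
        WithTop.add_lt_add_of_le_of_lt
          (ne_top_of_le_ne_top (ENat.natCast_ne_top R') h) h h2
      refine absurd (hxy.trans h3) (not_le.2 ?_)
      push_cast
      rwa [add_comm (R : ℕ∞)]
  add_mem' := by
    rintro S T ⟨R, hS⟩ ⟨R', hT⟩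
    refine ⟨max R R', fun x y hxy => ?_⟩
    have h1 : (R : ℕ∞) ≤ X.dist x y := le_trans (by exact_mod_cast le_max_left R R') hxy
    have h2 : (R' : ℕ∞) ≤ X.dist x y := le_trans (by exact_mod_cast le_max_right R R') hxy
    rw [entry_add, hS x y h1, hT x y h2, add_zero]
  algebraMap_mem' c := by
    refine ⟨1, fun x y hxy => entry_algebraMap_ne c ?_⟩
    rintro rfl
    simp [dist] at hxy
  star_mem' := by
    rintro T ⟨R, hT⟩
    refine ⟨R, fun x y hxy => ?_⟩
    rw [entry_star, hT y x (by rwa [dist_comm]), map_zero]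

theorem laplacian_mem_roe : X.laplacian ∈ X.roe := by
  refine ⟨2, fun x y hxy => ?_⟩
  rw [entry_eq]
  obtain ⟨i, v⟩ := y
  have hne : ∀ w, x = ⟨i, w⟩ → X.dist x ⟨i, v⟩ ≤ 1 → False := by
    rintro w rfl h
    exact absurd (hxy.trans h) (by norm_num)
  have h0 : X.delta x ⟨i, v⟩ = 0 := by
    refine delta_ne fun h => hne v h.symm ?_
    rw [← h]
    simp [dist]
  rw [laplacian_apply]
  refine Finset.sum_eq_zero fun w hw => ?_
  rw [h0, delta_ne, sub_zero]
  intro h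
  refine hne w h.symm ?_
  rw [← h]
  refine SimpleGraph.edist_le_one_iff_adj_or_eq.2 (Or.inl ?_)
  exact ⟨i, w, v, (mem_nbrs.1 hw).symm, rfl, rfl⟩

/-- The Laplace operator as an element of the algebraic Roe algebra. -/
def roeLaplacian : X.roe := ⟨X.laplacian, X.laplacian_mem_roe⟩

section Bounded

theorem exists_ball (R : ℕ) : ∃ N : ℕ, ∀ x : X.Pt, ∃ s : Finset X.Pt, s.card ≤ N ∧
    ∀ y, X.dist x y ≤ R → y ∈ s := by
  classical
  induction R with
  | zero =>
    refine ⟨1, fun x => ⟨{x}, by simp, fun y hy => ?_⟩⟩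
    have : X.dist x y = 0 := by simpa using hy
    rw [Finset.mem_singleton]
    exact (SimpleGraph.edist_eq_zero_iff.1 this).symm
  | succ R ih =>
    obtain ⟨N, hN⟩ := ih
    choose s hs hmem using hN
    refine ⟨1 + X.degBound * N, fun x => ⟨{x} ∪
      (nbrs (X.graph x.1) x.2).biUnion fun w => s ⟨x.1, w⟩, ?_, fun y hy => ?_⟩⟩
    · refine (Finset.card_union_le _ _).trans ?_
      gcongr
      · simp
      · refine (Finset.card_biUnion_le_card_mul _ _ N fun w _ => hs _).trans ?_
        gcongr
        exact X.card_nbrs_le _ _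
    · rw [Finset.mem_union, Finset.mem_singleton]
      have htop : X.disjointUnion.edist x y ≠ ⊤ := ne_top_of_le_ne_top (ENat.natCast_ne_top _) hy
      obtain ⟨p, hp⟩ := SimpleGraph.exists_walk_of_edist_ne_top htop
      cases p with
      | nil => exact Or.inl rfl
      | @cons _ z _ h p =>
        right
        obtain ⟨i, v, w, hvw, rfl, rfl⟩ := h
        rw [Finset.mem_biUnion]
        refine ⟨w, mem_nbrs.2 hvw, hmem _ _ ?_⟩
        refine (SimpleGraph.edist_le p).trans ?_
        have h1 : ((p.length + 1 : ℕ) : ℕ∞) ≤ ((R + 1 : ℕ) : ℕ∞) := by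
          have : X.disjointUnion.edist ⟨i, v⟩ y ≤ ((R + 1 : ℕ) : ℕ∞) := hy
          rw [← hp] at this
          exact this
        have h2 : p.length + 1 ≤ R + 1 := by exact_mod_cast h1
        exact_mod_cast Nat.le_of_succ_le_succ h2

theorem exists_rank (R : ℕ) : ∃ (N : ℕ) (rank : X.Pt → X.Pt → ℕ),
    (∀ x y, X.dist x y ≤ R → rank x y < N) ∧
    ∀ x y y', X.dist x y ≤ R → X.dist x y' ≤ R → rank x y = rank x y' → y = y' := by
  classical
  obtain ⟨N, hN⟩ := X.exists_ball R
  choose s hs hmem using hN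
  refine ⟨N, fun x y => if h : y ∈ s x then ((s x).equivFin ⟨y, h⟩ : ℕ) else 0, ?_, ?_⟩
  · intro x y h
    simp only [dif_pos (hmem x y h)]
    exact (Fin.is_lt _).trans_le (hs x)
  · intro x y y' h h' heq
    simp only [dif_pos (hmem x y h), dif_pos (hmem x y' h')] at heq
    simpa using (s x).equivFin.injective (Fin.ext heq)

variable {X}

theorem exists_weightedShift (a : X.Pt → ℂ) (τ : X.Pt → X.Pt) {K : ℝ} (hK : ∀ y, ‖a y‖ ≤ K)
    (hτ : ∀ y y', a y ≠ 0 → a y' ≠ 0 → τ y = τ y' → y = y') :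
    ∃ W : X.L2 →L[ℂ] X.L2, ∀ f y, W f y = a y * f (τ y) := by
  classical
  have key : ∀ (f : X.L2) (s : Finset X.Pt), ∑ y ∈ s, ‖a y * f (τ y)‖ ^ 2 ≤ (|K| * ‖f‖) ^ 2 := by
    intro f s
    have hn := lp.sum_rpow_le_norm_rpow (p := 2) (by norm_num) f
      ((s.filter fun y => a y ≠ 0).image τ)
    have hn' : ∑ x ∈ (s.filter fun y => a y ≠ 0).image τ, ‖f x‖ ^ 2 ≤ ‖f‖ ^ 2 := by
      simpa using hn
    rw [Finset.sum_image] at hn'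
    · calc ∑ y ∈ s, ‖a y * f (τ y)‖ ^ 2
          = ∑ y ∈ s.filter fun y => a y ≠ 0, ‖a y * f (τ y)‖ ^ 2 := by
            rw [Finset.sum_filter]
            refine Finset.sum_congr rfl fun y _ => ?_
            by_cases h : a y = 0 <;> simp [h]
        _ ≤ ∑ y ∈ s.filter fun y => a y ≠ 0, |K| ^ 2 * ‖f (τ y)‖ ^ 2 := by
            refine Finset.sum_le_sum fun y _ => ?_
            rw [norm_mul, mul_pow]
            gcongr
            exact (hK y).trans (le_abs_self K)
        _ = |K| ^ 2 * ∑ y ∈ s.filter fun y => a y ≠ 0, ‖f (τ y)‖ ^ 2 := by rw [Finset.mul_sum]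
        _ ≤ |K| ^ 2 * ‖f‖ ^ 2 := by gcongr
        _ = _ := by ring
    · intro y hy y' hy' h
      simp only [Finset.coe_filter, Set.mem_ofPred_eq] at hy hy'
      exact hτ y y' hy.2 hy'.2 h
  refine ⟨LinearMap.mkContinuous
    { toFun := fun f => ⟨fun y => a y * f (τ y), memℓp_gen' (C := (|K| * ‖f‖) ^ 2)
        fun s => by simpa using key f s⟩
      map_add' := fun f g => by
        ext y
        exact mul_add _ _ _
      map_smul' := fun c f => by
        ext y
        exact mul_left_comm _ _ _ } |K|
    (fun f => lp.norm_le_of_forall_sum_le (by norm_num) (by positivity)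
      fun s => by simpa using key f s), fun f y => rfl⟩

theorem norm_map_partialInjection_le {H : Type*} [NormedAddCommGroup H] [InnerProductSpace ℂ H]
    [CompleteSpace H] (π : X.roe →⋆ₐ[ℂ] (H →L[ℂ] H)) (U : X.roe)
    (hU : ∀ x x' y, entry U.1 x y ≠ 0 → entry U.1 x' y ≠ 0 → x = x') : ‖π U‖ ≤ ‖U.1‖ := by
  set K := ‖U.1‖ with hKdef
  set b : X.Pt → ℂ := fun x => ((√(K ^ 2 - ‖U.1 (X.delta x)‖ ^ 2) : ℝ) : ℂ) with hb
  have hle : ∀ x, ‖U.1 (X.delta x)‖ ≤ K := fun x => by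
    simpa [norm_delta] using U.1.le_opNorm (X.delta x)
  obtain ⟨W, hW⟩ := exists_weightedShift (X := X) b id (K := K) (fun x => by
    simp only [hb, Complex.norm_real, Real.norm_eq_abs, abs_of_nonneg (Real.sqrt_nonneg _)]
    refine Real.sqrt_le_iff.2 ⟨norm_nonneg _, ?_⟩
    have := sq_nonneg ‖U.1 (X.delta x)‖
    linarith) (fun _ _ _ _ h => h)
  have hWne : ∀ x y, x ≠ y → entry W x y = 0 := fun x y h => by
    rw [entry_eq, hW, id, delta_ne h.symm, mul_zero]
  have hWmem : W ∈ X.roe := by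
    refine ⟨1, fun x y hxy => hWne x y ?_⟩
    rintro rfl
    simp [dist] at hxy
  have hsum : star U.1 * U.1 + star W * W = algebraMap ℂ _ ((K ^ 2 : ℝ) : ℂ) := by
    have hstar : ∀ (S : X.L2 →L[ℂ] X.L2) (x y : X.Pt),
        entry (star S * S) x y = inner ℂ (S (X.delta y)) (S (X.delta x)) := by
      intro S x y
      rw [entry, ContinuousLinearMap.star_eq_adjoint, mul_apply_eq_comp,
        ContinuousLinearMap.adjoint_inner_right]
    have hWd : ∀ x, W (X.delta x) = b x • X.delta x := by
      intro x
      ext y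
      rw [hW, lp.coeFn_smul, Pi.smul_apply, smul_eq_mul, id]
      by_cases h : y = x
      · rw [h]
      · rw [delta_ne h, mul_zero, mul_zero]
    refine entry_ext fun x y => ?_
    rw [entry_add, hstar, hstar]
    by_cases h : x = y
    · subst h
      rw [entry_algebraMap_self, hWd, inner_self_eq_norm_sq_to_K, inner_self_eq_norm_sq_to_K,
        norm_smul, norm_delta, mul_one]
      have h1 : ‖b x‖ ^ 2 = K ^ 2 - ‖U.1 (X.delta x)‖ ^ 2 := by
        simp only [hb, Complex.norm_real, Real.norm_eq_abs, sq_abs]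
        refine Real.sq_sqrt ?_
        have := pow_le_pow_left₀ (norm_nonneg _) (hle x) 2
        linarith
      have h2 : ‖U.1 (X.delta x)‖ ^ 2 + ‖b x‖ ^ 2 = K ^ 2 := by rw [h1]; ring
      rw [← h2]
      push_cast
      rfl
    · rw [entry_algebraMap_ne _ h, hWd, hWd, inner_smul_left, inner_smul_right, inner_delta,
        delta_ne (Ne.symm h), lp.inner_eq_tsum]
      have : ∀ z, inner ℂ (U.1 (X.delta y) z) (U.1 (X.delta x) z) = 0 := by
        intro z
        rw [← entry_eq, ← entry_eq, RCLike.inner_apply]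
        by_contra hne
        rw [mul_eq_zero, map_eq_zero, not_or] at hne
        exact h (hU x y z hne.1 hne.2)
      simp only [this, tsum_zero, mul_zero, add_zero]
  have hroe : star U * U + star (⟨W, hWmem⟩ : X.roe) * ⟨W, hWmem⟩ =
      algebraMap ℂ X.roe ((K ^ 2 : ℝ) : ℂ) := Subtype.ext hsum
  have hπ := congrArg π hroe
  rw [map_add, map_mul, map_mul, map_star, map_star, AlgHomClass.commutes] at hπ
  refine ContinuousLinearMap.opNorm_le_bound _ (norm_nonneg _) fun ξ => ?_
  refine le_of_sq_le_sq ?_ (by positivity)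
  have h := congrArg (fun A : H →L[ℂ] H => RCLike.re (inner ℂ ξ (A ξ))) hπ
  simp only [add_apply, mul_apply_eq_comp,
    ContinuousLinearMap.star_eq_adjoint, inner_add_right, ContinuousLinearMap.adjoint_inner_right,
    map_add, inner_self_eq_norm_sq, Algebra.algebraMap_eq_smul_one,
    smul_apply, one_apply_eq_self, inner_smul_right] at h
  have h2 : RCLike.re (((K ^ 2 : ℝ) : ℂ) * inner ℂ ξ ξ) = K ^ 2 * ‖ξ‖ ^ 2 := by
    have h4 : ((K ^ 2 : ℝ) : ℂ) * inner ℂ ξ ξ = ((K ^ 2 * ‖ξ‖ ^ 2 : ℝ) : ℂ) := by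
      rw [inner_self_eq_norm_sq_to_K]
      push_cast
      rfl
    rw [h4]
    exact Complex.ofReal_re _
  rw [h2] at h
  have h3 := sq_nonneg ‖π ⟨W, hWmem⟩ ξ‖
  nlinarith

theorem exists_norm_map_le (T : X.roe) : ∃ C : ℝ, ∀ (H : Type) [NormedAddCommGroup H]
    [InnerProductSpace ℂ H] [CompleteSpace H] (π : X.roe →⋆ₐ[ℂ] (H →L[ℂ] H)), ‖π T‖ ≤ C := by
  classical
  obtain ⟨R, hR⟩ := T.2
  obtain ⟨N, rank, hN, hinj⟩ := X.exists_rank R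
  let P : ℕ → ℕ → X.Pt → X.Pt → Prop := fun j k x y =>
    X.dist x y ≤ R ∧ rank x y = j ∧ rank y x = k
  have hU : ∀ j k, ∃ U : X.roe, ∀ x y, entry U.1 x y = if P j k x y then entry T.1 x y else 0 := by
    intro j k
    let τ : X.Pt → X.Pt := fun y => if h : ∃ x, P j k x y then h.choose else y
    let a : X.Pt → ℂ := fun y => if ∃ x, P j k x y then entry T.1 (τ y) y else 0
    have hτ : ∀ x y, P j k x y → τ y = x := by
      intro x y hx
      have h : ∃ x, P j k x y := ⟨x, hx⟩
      have h1 : τ y = h.choose := dif_pos h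
      have h2 := h.choose_spec
      rw [← h1] at h2
      exact hinj y _ _ (by rw [dist_comm]; exact h2.1) (by rw [dist_comm]; exact hx.1)
        (h2.2.2.trans hx.2.2.symm)
    have ha : ∀ y, a y ≠ 0 → P j k (τ y) y := by
      intro y hy
      by_cases h : ∃ x, P j k x y
      · obtain ⟨x, hx⟩ := h
        rwa [hτ x y hx]
      · exact absurd (if_neg h) hy
    obtain ⟨W, hW⟩ := exists_weightedShift (X := X) a τ (K := ‖T.1‖) (fun y => by
        by_cases h : ∃ x, P j k x y
        · simp only [a, if_pos h]
          exact norm_entry_le _ _ _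
        · simp only [a, if_neg h, norm_zero]
          exact norm_nonneg _)
      (fun y y' hy hy' h => by
        have h1 := ha y hy
        have h2 := ha y' hy'
        rw [h] at h1
        exact hinj _ _ _ h1.1 h2.1 (h1.2.1.trans h2.2.1.symm))
    have hent : ∀ x y, entry W x y = if P j k x y then entry T.1 x y else 0 := by
      intro x y
      rw [entry_eq, hW]
      by_cases h : P j k x y
      · rw [if_pos h, hτ x y h, delta_self, mul_one]
        simp only [a, if_pos (⟨x, h⟩ : ∃ x, P j k x y), hτ x y h]
      · rw [if_neg h]
        by_cases h' : a y = 0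
        · rw [h', zero_mul]
        · rw [delta_ne, mul_zero]
          rintro rfl
          exact h (ha y h')
    refine ⟨⟨W, R, fun x y hxy => ?_⟩, hent⟩
    rw [hent, hR x y hxy, ite_self]
  choose U hU using hU
  have hT : T = ∑ j ∈ Finset.range N, ∑ k ∈ Finset.range N, U j k := by
    refine Subtype.ext (entry_ext fun x y => ?_)
    push_cast
    simp only [entry_sum, hU]
    by_cases h : X.dist x y ≤ R
    · have h1 := hN x y h
      have h2 := hN y x (by rwa [dist_comm])
      simp [P, h, ite_and, h1, h2]
    · simp only [P, h, false_and, if_false, Finset.sum_const_zero]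
      exact hR x y (le_of_not_ge h)
  refine ⟨∑ j ∈ Finset.range N, ∑ k ∈ Finset.range N, ‖(U j k).1‖, fun H _ _ _ π => ?_⟩
  conv_lhs => rw [hT]
  simp only [map_sum]
  refine norm_sum_le_of_le _ fun j _ => norm_sum_le_of_le _ fun k _ => ?_
  refine norm_map_partialInjection_le π _ fun x x' y hx hx' => ?_
  rw [hU] at hx hx'
  have h1 : P j k x y := by
    by_contra h
    exact hx (if_neg h)
  have h2 : P j k x' y := by
    by_contra h
    exact hx' (if_neg h)
  exact hinj y _ _ (by rw [dist_comm]; exact h1.1) (by rw [dist_comm]; exact h2.1)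
    (h1.2.2.trans h2.2.2.symm)

end Bounded

end Roe

section Groupoid

/-- The set `E_R` of pairs of points at distance at most `R`. -/
def controlled (R : ℕ) : Set (X.Pt × X.Pt) := {p | X.dist p.1 p.2 ≤ R}

/-- The inclusion of `X × X` in `βX × βX`. The Stone-Čech compactification `βX` of the discrete space
`X` is the space `Ultrafilter X.Pt` of ultrafilters on `X`, with `X` embedded by `pure`. -/
def pairEmbedding (p : X.Pt × X.Pt) : Ultrafilter X.Pt × Ultrafilter X.Pt := (pure p.1, pure p.2)

/-- The coarse groupoid `G(X)`, the union of the closures of the `E_R` in `βX × βX`. It carries the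
weak topology of this union, and the operations of the pair groupoid `βX × βX`. -/
def coarseGroupoid : Set (Ultrafilter X.Pt × Ultrafilter X.Pt) :=
  ⋃ R : ℕ, closure (X.pairEmbedding '' X.controlled R)

/-- The Stone-Čech boundary `∂βX = βX \ X`. -/
def boundary : Set (Ultrafilter X.Pt) := (Set.range (pure : X.Pt → Ultrafilter X.Pt))ᶜ

/-- The boundary part `∂βA` of the closure of a subset `A` of `X` in `βX`. -/
def boundaryOf (A : Set X.Pt) : Set (Ultrafilter X.Pt) :=
  closure ((pure : X.Pt → Ultrafilter X.Pt) '' A) ∩ X.boundary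

/-- The saturation of a subset of `βX` with respect to the coarse groupoid. -/
def saturation (A : Set (Ultrafilter X.Pt)) : Set (Ultrafilter X.Pt) :=
  {x | ∃ a ∈ A, (a, x) ∈ X.coarseGroupoid}

/-- The core of a subset `Y` of `X`: the complement, in the boundary, of the saturation of `∂β(Yᶜ)`. -/
def core (Y : Set X.Pt) : Set (Ultrafilter X.Pt) :=
  X.boundary \ X.saturation (X.boundaryOf Yᶜ)

variable {X}

/-- An element `T` of the Roe algebra is identified with the function in `C_c(G(X))` that extends the
matrix `(T_{xy})` continuously from `X × X ∩ G(X)` to the coarse groupoid. This says that the extended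
function has the value `0` at the point `g` of `G(X)`: since `G(X)` has the weak topology of the union
of the closures of the `E_R`, this value is the limit of `T_{xy}` as `(x, y)` tends to `g` within any
`E_R` whose closure contains `g` (for the other `R` the filter below is trivial). -/
def VanishesAt (T : X.roe) (g : Ultrafilter X.Pt × Ultrafilter X.Pt) : Prop :=
  ∀ R : ℕ, Tendsto (fun p : X.Pt × X.Pt => entry T.1 p.1 p.2)
    (comap X.pairEmbedding (𝓝 g) ⊓ 𝓟 (X.controlled R)) (𝓝 0)

/-- The continuous function on `G(X)` given by `T` restricts to zero on the reduction `G(X)|_Z`. -/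
def VanishesOn (T : X.roe) (Z : Set (Ultrafilter X.Pt)) : Prop :=
  ∀ g ∈ X.coarseGroupoid, g.1 ∈ Z → g.2 ∈ Z → VanishesAt T g

variable (Z : Set (Ultrafilter X.Pt))

/-- For a closed invariant set `Z`, the restriction `C_c(G(X)) → C_c(G(X)|_Z)` is onto, so that the unital
*-representations of `C_c(G(X)|_Z)` are those of `C_c(G(X)) = ℂ[X]` which kill every function that
restricts to zero on `G(X)|_Z`. This is the set of the norms of the images of `T` under them. -/
def repNorms (T : X.roe) : Set ℝ :=
  {r | ∃ (H : Type) (_ : NormedAddCommGroup H) (_ : InnerProductSpace ℂ H) (_ : CompleteSpace H)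
    (π : X.roe →⋆ₐ[ℂ] (H →L[ℂ] H)), (∀ S, VanishesOn S Z → π S = 0) ∧ r = ‖π T‖}

theorem bddAbove_repNorms (T : X.roe) : BddAbove (repNorms Z T) := by
  obtain ⟨C, hC⟩ := exists_norm_map_le T
  refine ⟨C, ?_⟩
  rintro r ⟨H, _, _, _, π, -, rfl⟩
  exact hC H π

/-- The maximal C*-norm of the restriction of `T` to `G(X)|_Z`: the supremum of `‖π(T)‖` over all unital
*-representations `π` of `C_c(G(X)|_Z)` on Hilbert spaces. It is finite by `bddAbove_repNorms`. -/
def maxNorm (T : X.roe) : ℝ := sSup (repNorms Z T)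

theorem maxNorm_nonneg (T : X.roe) : 0 ≤ maxNorm Z T := by
  refine Real.sSup_nonneg ?_
  rintro r ⟨H, _, _, _, π, -, rfl⟩
  exact norm_nonneg _

theorem maxNorm_le {T : X.roe} {C : ℝ} (hC : 0 ≤ C) (h : ∀ r ∈ repNorms Z T, r ≤ C) :
    maxNorm Z T ≤ C := Real.sSup_le h hC

theorem norm_map_le_maxNorm (T : X.roe) {H : Type} [NormedAddCommGroup H]
    [InnerProductSpace ℂ H] [CompleteSpace H] (π : X.roe →⋆ₐ[ℂ] (H →L[ℂ] H))
    (hπ : ∀ S, VanishesOn S Z → π S = 0) : ‖π T‖ ≤ maxNorm Z T :=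
  le_csSup (bddAbove_repNorms Z T) ⟨H, _, _, _, π, hπ, rfl⟩

variable (X) in
/-- The Roe algebra `ℂ[X] = C_c(G(X))`, equipped with the maximal C*-seminorm of `C_c(G(X)|_Z)`. -/
def ReductionAlgebra (_Z : Set (Ultrafilter X.Pt)) : Type := X.roe

instance : Ring (X.ReductionAlgebra Z) := inferInstanceAs (Ring X.roe)

instance : Algebra ℂ (X.ReductionAlgebra Z) := inferInstanceAs (Algebra ℂ X.roe)

/-- The maximal norm, as a submultiplicative seminorm. -/
def maxSeminorm : RingSeminorm (X.ReductionAlgebra Z) where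
  toFun T := maxNorm Z (show X.roe from T)
  map_zero' := by
    refine le_antisymm (maxNorm_le Z le_rfl ?_) (maxNorm_nonneg Z _)
    rintro r ⟨H, _, _, _, π, -, rfl⟩
    exact (norm_eq_zero.2 (map_zero π)).le
  add_le' S T := by
    refine maxNorm_le Z (add_nonneg (maxNorm_nonneg Z _) (maxNorm_nonneg Z _)) ?_
    rintro r ⟨H, _, _, _, π, hπ, rfl⟩
    exact (congrArg norm (map_add π S T)).le.trans ((norm_add_le _ _).trans
      (add_le_add (norm_map_le_maxNorm Z _ π hπ) (norm_map_le_maxNorm Z _ π hπ)))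
  neg' T := by
    have h : ∀ T : X.roe, repNorms Z (-T) = repNorms Z T := by
      intro T
      ext r
      simp only [repNorms, map_neg, norm_neg]
    exact congrArg sSup (h T)
  mul_le' S T := by
    refine maxNorm_le Z (mul_nonneg (maxNorm_nonneg Z _) (maxNorm_nonneg Z _)) ?_
    rintro r ⟨H, _, _, _, π, hπ, rfl⟩
    exact (congrArg norm (map_mul π S T)).le.trans ((norm_mul_le _ _).trans
      (mul_le_mul (norm_map_le_maxNorm Z _ π hπ) (norm_map_le_maxNorm Z _ π hπ) (norm_nonneg _)
        (maxNorm_nonneg Z _)))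

instance : SeminormedRing (X.ReductionAlgebra Z) := (maxSeminorm Z).toSeminormedRing

instance : NormedAlgebra ℂ (X.ReductionAlgebra Z) where
  norm_smul_le c T := by
    refine maxNorm_le Z (mul_nonneg (norm_nonneg c) (maxNorm_nonneg Z _)) ?_
    rintro r ⟨H, _, _, _, π, hπ, rfl⟩
    refine (congrArg norm (map_smul π c (show X.roe from T))).le.trans ?_
    rw [norm_smul]
    exact mul_le_mul_of_nonneg_left (norm_map_le_maxNorm Z _ π hπ) (norm_nonneg c)

variable (X) in
/-- The maximal groupoid C*-algebra of `G(X)|_Z`: the Hausdorff completion of `C_c(G(X))` with respect to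
the maximal C*-seminorm of `C_c(G(X)|_Z)`. -/
abbrev MaxCStar : Type := UniformSpace.Completion (X.ReductionAlgebra Z)

variable (X) in
/-- The Laplace operator as an element of the maximal C*-algebra of `G(X)|_Z`. -/
def maxLaplacian : X.MaxCStar Z :=
  ((show X.ReductionAlgebra Z from X.roeLaplacian : X.ReductionAlgebra Z) : X.MaxCStar Z)

end Groupoid

section Ultraproduct

/-- The sequences `(f_i)` that are bounded in `L²(X_i, μ_i)` and for which the functions `|f_i|²` are
uniformly integrable, where `μ_i` is the normalized counting measure on `X_i`. -/
def uniformlyIntegrable : Submodule ℂ (∀ i, X.V i → ℂ) where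
  carrier := {f |
    (∃ B : ℝ, ∀ i, ∑ v, ‖f i v‖ ^ 2 ≤ B * Nat.card (X.V i)) ∧
    ∀ ε : ℝ, 0 < ε → ∃ δ : ℝ, 0 < δ ∧ ∀ i, ∀ T : Finset (X.V i),
      (T.card : ℝ) ≤ δ * Nat.card (X.V i) → ∑ v ∈ T, ‖f i v‖ ^ 2 ≤ ε * Nat.card (X.V i)}
  zero_mem' := by
    refine ⟨⟨0, fun i => by simp⟩, fun ε hε => ⟨1, one_pos, fun i T _ => ?_⟩⟩
    simp only [Pi.zero_apply, norm_zero]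
    have : (0 : ℝ) ≤ ε * Nat.card (X.V i) := by positivity
    simpa using this
  add_mem' := by
    rintro f g ⟨⟨B, hB⟩, hf⟩ ⟨⟨B', hB'⟩, hg⟩
    have key : ∀ i, ∀ T : Finset (X.V i), ∑ v ∈ T, ‖(f + g) i v‖ ^ 2 ≤
        2 * ∑ v ∈ T, ‖f i v‖ ^ 2 + 2 * ∑ v ∈ T, ‖g i v‖ ^ 2 := by
      intro i T
      rw [Finset.mul_sum, Finset.mul_sum, ← Finset.sum_add_distrib]
      refine Finset.sum_le_sum fun v _ => ?_
      have := norm_add_le (f i v) (g i v)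
      simp only [Pi.add_apply]
      nlinarith [sq_nonneg (‖f i v‖ - ‖g i v‖), norm_nonneg (f i v + g i v)]
    refine ⟨⟨2 * B + 2 * B', fun i => ?_⟩, fun ε hε => ?_⟩
    · have := key i Finset.univ
      have h1 := hB i
      have h2 := hB' i
      linarith
    · obtain ⟨δ, hδ, h1⟩ := hf (ε / 4) (by positivity)
      obtain ⟨δ', hδ', h2⟩ := hg (ε / 4) (by positivity)
      refine ⟨min δ δ', lt_min hδ hδ', fun i T hT => ?_⟩
      have h3 := h1 i T (hT.trans (by gcongr; exact min_le_left _ _))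
      have h4 := h2 i T (hT.trans (by gcongr; exact min_le_right _ _))
      have := key i T
      linarith
  smul_mem' := by
    rintro c f ⟨⟨B, hB⟩, hf⟩
    have key : ∀ i, ∀ T : Finset (X.V i), ∑ v ∈ T, ‖(c • f) i v‖ ^ 2 =
        ‖c‖ ^ 2 * ∑ v ∈ T, ‖f i v‖ ^ 2 := by
      intro i T
      rw [Finset.mul_sum]
      refine Finset.sum_congr rfl fun v _ => ?_
      simp only [Pi.smul_apply, smul_eq_mul, norm_mul, mul_pow]
    refine ⟨⟨‖c‖ ^ 2 * B, fun i => ?_⟩, fun ε hε => ?_⟩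
    · rw [key, mul_assoc]
      gcongr
      exact hB i
    · obtain ⟨δ, hδ, h1⟩ := hf (ε / (‖c‖ ^ 2 + 1)) (by positivity)
      refine ⟨δ, hδ, fun i T hT => ?_⟩
      rw [key]
      have h2 := h1 i T hT
      have h3 : (‖c‖ ^ 2 + 1) * ∑ v ∈ T, ‖f i v‖ ^ 2 ≤ ε * Nat.card (X.V i) := by
        calc (‖c‖ ^ 2 + 1) * ∑ v ∈ T, ‖f i v‖ ^ 2
            ≤ (‖c‖ ^ 2 + 1) * (ε / (‖c‖ ^ 2 + 1) * Nat.card (X.V i)) := by gcongr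
          _ = ε * Nat.card (X.V i) := by field_simp
      have h4 : 0 ≤ ∑ v ∈ T, ‖f i v‖ ^ 2 := Finset.sum_nonneg fun _ _ => by positivity
      linarith

/-- The inner product of `L²(X_i, μ_i)` for the normalized counting measure `μ_i`. -/
def avgInner (i : ℕ) (f g : X.V i → ℂ) : ℂ :=
  (∑ v, starRingEnd ℂ (f v) * g v) / Nat.card (X.V i)

theorem norm_avgInner_le {i : ℕ} {f g : X.V i → ℂ} {B C : ℝ}
    (hf : ∑ v, ‖f v‖ ^ 2 ≤ B * Nat.card (X.V i)) (hg : ∑ v, ‖g v‖ ^ 2 ≤ C * Nat.card (X.V i)) :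
    ‖X.avgInner i f g‖ ≤ |B| + |C| := by
  rcases Nat.eq_zero_or_pos (Nat.card (X.V i)) with h0 | h0
  · simp only [avgInner, h0, Nat.cast_zero, div_zero, norm_zero]
    positivity
  · have h1 : (0 : ℝ) < Nat.card (X.V i) := by exact_mod_cast h0
    rw [avgInner, norm_div, Complex.norm_natCast, div_le_iff₀ h1]
    calc ‖∑ v, starRingEnd ℂ (f v) * g v‖ ≤ ∑ v, ‖starRingEnd ℂ (f v) * g v‖ := norm_sum_le _ _
      _ ≤ ∑ v, (‖f v‖ ^ 2 + ‖g v‖ ^ 2) := by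
          refine Finset.sum_le_sum fun v _ => ?_
          rw [norm_mul, RCLike.norm_conj]
          nlinarith [sq_nonneg (‖f v‖ - ‖g v‖), sq_nonneg (‖f v‖), sq_nonneg (‖g v‖)]
      _ = ∑ v, ‖f v‖ ^ 2 + ∑ v, ‖g v‖ ^ 2 := Finset.sum_add_distrib
      _ ≤ B * Nat.card (X.V i) + C * Nat.card (X.V i) := by gcongr
      _ ≤ |B| * Nat.card (X.V i) + |C| * Nat.card (X.V i) := by
          gcongr <;> exact le_abs_self _
      _ = _ := by ring

theorem tendsto_avgInner (u : Ultrafilter ℕ) (f g : X.uniformlyIntegrable) :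
    Tendsto (fun i => X.avgInner i (f.1 i) (g.1 i)) u
      (𝓝 (limUnder (u : Filter ℕ) fun i => X.avgInner i (f.1 i) (g.1 i))) := by
  obtain ⟨B, hB⟩ := f.2.1
  obtain ⟨C, hC⟩ := g.2.1
  apply tendsto_nhds_limUnder
  have hK := isCompact_closedBall (0 : ℂ) (|B| + |C|)
  obtain ⟨z, -, hz⟩ := hK.ultrafilter_le_nhds
    (u.map fun i => X.avgInner i (f.1 i) (g.1 i)) (by
      rw [le_principal_iff]
      refine Ultrafilter.mem_map.2 (Filter.univ_mem' fun i => ?_)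
      simpa using X.norm_avgInner_le (hB i) (hC i))
  exact ⟨z, hz⟩

/-- The uniformly integrable sequences with the semi-inner product `lim_{i → u} ⟨f_i, g_i⟩`. -/
def PreUltraproduct (_u : Ultrafilter ℕ) : Type := X.uniformlyIntegrable

variable (u : Ultrafilter ℕ)

instance : AddCommGroup (X.PreUltraproduct u) :=
  inferInstanceAs (AddCommGroup X.uniformlyIntegrable)

instance : Module ℂ (X.PreUltraproduct u) :=
  inferInstanceAs (Module ℂ X.uniformlyIntegrable)

/-- The semi-inner product `lim_{i → u} ⟨f_i, g_i⟩`; the limits exist by `tendsto_avgInner`. -/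
@[reducible]
def ultraCore : PreInnerProductSpace.Core ℂ (X.PreUltraproduct u) where
  inner f g := limUnder (u : Filter ℕ) fun i => X.avgInner i (f.1 i) (g.1 i)
  conj_inner_symm f g := by
    refine tendsto_nhds_unique ((Complex.continuous_conj.tendsto _).comp
      (X.tendsto_avgInner u g f)) ?_
    refine (X.tendsto_avgInner u f g).congr fun i => ?_
    simp only [Function.comp, avgInner, map_div₀, map_sum, map_mul, Complex.conj_conj,
      map_natCast]
    congr 1
    exact Finset.sum_congr rfl fun _ _ => mul_comm _ _
  re_inner_nonneg f := by
    refine ge_of_tendsto' ((Complex.continuous_re.tendsto _).comp (X.tendsto_avgInner u f f))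
      fun i => ?_
    have : X.avgInner i (f.1 i) (f.1 i) =
        (((∑ v, ‖f.1 i v‖ ^ 2) / Nat.card (X.V i) : ℝ) : ℂ) := by
      simp only [avgInner, Complex.conj_mul']
      push_cast
      rfl
    simp only [Function.comp, this, Complex.ofReal_re]
    positivity
  add_left f g h := by
    refine tendsto_nhds_unique (X.tendsto_avgInner u (f + g) h) ?_
    refine ((X.tendsto_avgInner u f h).add (X.tendsto_avgInner u g h)).congr fun i => ?_
    have hs : (f + g).1 i = fun v => f.1 i v + g.1 i v := rfl
    simp only [avgInner, hs, map_add, add_mul, Finset.sum_add_distrib, add_div]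
  smul_left f g c := by
    refine tendsto_nhds_unique (X.tendsto_avgInner u (c • f) g) ?_
    refine ((X.tendsto_avgInner u f g).const_mul (starRingEnd ℂ c)).congr fun i => ?_
    have hs : (c • f).1 i = fun v => c * f.1 i v := rfl
    simp only [avgInner, hs, map_mul, mul_assoc, ← Finset.mul_sum, mul_div_assoc]

instance : SeminormedAddCommGroup (X.PreUltraproduct u) :=
  @InnerProductSpace.Core.toSeminormedAddCommGroup ℂ (X.PreUltraproduct u) _ _ _ (X.ultraCore u)

instance : InnerProductSpace ℂ (X.PreUltraproduct u) :=
  InnerProductSpace.ofCore (X.ultraCore u)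

theorem inner_def (f g : X.PreUltraproduct u) :
    inner ℂ f g = limUnder (u : Filter ℕ) fun i => X.avgInner i (f.1 i) (g.1 i) := rfl

theorem tendsto_norm_sq (f : X.PreUltraproduct u) :
    Tendsto (fun i => (∑ v, ‖f.1 i v‖ ^ 2) / Nat.card (X.V i)) u (𝓝 (‖f‖ ^ 2)) := by
  rw [@norm_sq_eq_re_inner ℂ]
  refine ((Complex.continuous_re.tendsto _).comp (X.tendsto_avgInner u f f)).congr fun i => ?_
  have : X.avgInner i (f.1 i) (f.1 i) =
      (((∑ v, ‖f.1 i v‖ ^ 2) / Nat.card (X.V i) : ℝ) : ℂ) := by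
    simp only [avgInner, Complex.conj_mul']
    push_cast
    rfl
  simp only [Function.comp, this, Complex.ofReal_re]

/-- The restricted ultraproduct Hilbert space `∏_{i → u} L²(X_i, μ_i)`: the Hilbert space of uniformly
integrable sequences, modulo those whose norms tend to zero along `u`. -/
abbrev Ultraproduct : Type := UniformSpace.Completion (X.PreUltraproduct u)

/-- The Laplace operators of the `X_i`, acting termwise on uniformly integrable sequences. -/
def seqLaplacian : X.uniformlyIntegrable →ₗ[ℂ] X.uniformlyIntegrable :=
  LinearMap.restrict (LinearMap.pi fun i => graphLaplacian (X.graph i) ∘ₗ LinearMap.proj i) <| by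
    classical
    rintro f ⟨⟨B, hB⟩, hf⟩
    refine ⟨⟨(2 * (X.degBound : ℝ)) ^ 2 * B, fun i => ?_⟩, fun ε hε => ?_⟩
    · refine (sum_sq_graphLaplacian_le_univ _ (X.card_nbrs_le i) (f i)).trans ?_
      rw [mul_assoc]
      gcongr
      exact hB i
    · obtain ⟨δ, hδ, h⟩ := hf (ε / (4 * (X.degBound : ℝ) ^ 2 + 1)) (by positivity)
      refine ⟨δ / (X.degBound + 1), by positivity, fun i T hT => ?_⟩
      have hd : (0 : ℝ) ≤ X.degBound := by positivity
      rw [div_mul_eq_mul_div, le_div_iff₀ (by positivity)] at hT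
      have hT0 : (0 : ℝ) ≤ T.card := by positivity
      have h1 := h i T (by nlinarith)
      have h2 := h i (T.biUnion (nbrs (X.graph i))) (by
        have : ((T.biUnion (nbrs (X.graph i))).card : ℝ) ≤ T.card * X.degBound := by
          exact_mod_cast Finset.card_biUnion_le_card_mul _ _ _ fun v _ => X.card_nbrs_le i v
        nlinarith)
      refine (sum_sq_graphLaplacian_le _ (X.card_nbrs_le i) (f i) T).trans ?_
      calc _ ≤ 2 * (X.degBound : ℝ) ^ 2 *
                (ε / (4 * (X.degBound : ℝ) ^ 2 + 1) * Nat.card (X.V i)) +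
              2 * (X.degBound : ℝ) ^ 2 *
                (ε / (4 * (X.degBound : ℝ) ^ 2 + 1) * Nat.card (X.V i)) := by gcongr
        _ = (4 * (X.degBound : ℝ) ^ 2 / (4 * (X.degBound : ℝ) ^ 2 + 1)) *
              (ε * Nat.card (X.V i)) := by ring
        _ ≤ 1 * (ε * Nat.card (X.V i)) := by
            gcongr
            rw [div_le_one (by positivity)]
            linarith
        _ = _ := one_mul _

/-- The termwise Laplace operator is bounded for the seminorm of the ultraproduct. -/
def preUltraLaplacian : X.PreUltraproduct u →L[ℂ] X.PreUltraproduct u :=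
  LinearMap.mkContinuous (show X.PreUltraproduct u →ₗ[ℂ] X.PreUltraproduct u from X.seqLaplacian)
    (2 * X.degBound) fun f => by
      have hd : (0 : ℝ) ≤ 2 * X.degBound := by positivity
      refine le_of_sq_le_sq ?_ (by positivity)
      rw [mul_pow]
      refine le_of_tendsto_of_tendsto' (X.tendsto_norm_sq u _)
        ((X.tendsto_norm_sq u f).const_mul _) fun i => ?_
      rw [← mul_div_assoc]
      gcongr
      exact sum_sq_graphLaplacian_le_univ _ (X.card_nbrs_le i) (f.1 i)

theorem preUltraLaplacian_apply (f : X.PreUltraproduct u) (i : ℕ) (v : X.V i) :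
    (X.preUltraLaplacian u f).1 i v = ∑ w ∈ nbrs (X.graph i) v, (f.1 i v - f.1 i w) := rfl

/-- The Laplace operator on the restricted ultraproduct along `u`. -/
def ultraLaplacian : X.Ultraproduct u →L[ℂ] X.Ultraproduct u :=
  (X.preUltraLaplacian u).completion

end Ultraproduct


section Properties

/-- The set `{0} ∪ [c, ∞)`. -/
def gapSet (c : ℝ) : Set ℂ := {0} ∪ (fun t : ℝ => (t : ℂ)) '' Set.Ici c

/-- The box space is an expander: `Δ` on `ℓ²(X)` has spectrum in `{0} ∪ [c, ∞)` for some `c > 0`. -/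
def IsExpander : Prop :=
  ∃ c : ℝ, 0 < c ∧ spectrum ℂ X.laplacian ⊆ gapSet c

/-- The box space has spectral gap `c` in the ultraproduct along `u`. -/
def HasSpectralGapAlong (u : Ultrafilter ℕ) (c : ℝ) : Prop :=
  spectrum ℂ (X.ultraLaplacian u) ⊆ gapSet c

/-- For some `c > 0`, the box space has spectral gap `c` in the ultraproduct along every non-principal
ultrafilter. -/
def HasUltraproductSpectralGap : Prop :=
  ∃ c : ℝ, 0 < c ∧ ∀ u : Ultrafilter ℕ, (∀ n, u ≠ pure n) → X.HasSpectralGapAlong u c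

/-- Almost boundary geometric property (T): for some `Y_i ⊆ X_i` with `|Y_i| / |X_i| → 1`, the Laplace
operator has spectral gap in the maximal C*-algebra of `G(X)|_Z`, where `Z` is the core of `⋃ Y_i`. -/
def HasAlmostBoundaryT : Prop :=
  ∃ Y : ∀ i, Set (X.V i),
    Tendsto (fun i => ((Y i).ncard : ℝ) / Nat.card (X.V i)) atTop (𝓝 1) ∧
    ∃ c : ℝ, 0 < c ∧ spectrum ℂ (X.maxLaplacian (X.core {x | x.2 ∈ Y x.1})) ⊆ gapSet c

/-- Approximate isomorphism: there are isomorphic subgraphs `Y_i ⊆ X_i` and `Y'_i ⊆ X'_i` that contain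
asymptotically all vertices and all edges. -/
def ApproximatelyIsomorphic (X X' : BoxSpace) : Prop :=
  ∃ (Y : ∀ i, (X.graph i).Subgraph) (Y' : ∀ i, (X'.graph i).Subgraph),
    (∀ i, Nonempty ((Y i).coe ≃g (Y' i).coe)) ∧
    Tendsto (fun i => ((Y i).verts.ncard : ℝ) / Nat.card (X.V i)) atTop (𝓝 1) ∧
    Tendsto (fun i => ((Y' i).verts.ncard : ℝ) / Nat.card (X'.V i)) atTop (𝓝 1) ∧
    Tendsto (fun i => ((Y i).edgeSet.ncard : ℝ) / (X.graph i).edgeSet.ncard) atTop (𝓝 1) ∧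
    Tendsto (fun i => ((Y' i).edgeSet.ncard : ℝ) / (X'.graph i).edgeSet.ncard) atTop (𝓝 1)

/-- The number of edges of `X_i` is at least a fixed positive multiple of the number of its vertices,
for all large `i`. -/
def HasPositiveEdgeDensity : Prop :=
  ∃ κ : ℝ, 0 < κ ∧ ∀ᶠ i in atTop, κ * Nat.card (X.V i) ≤ (X.graph i).edgeSet.ncard

end Properties

end BoxSpace

end

/-! Every gap is read as one inequality: a positive operator `D` has spectrum in {0} ∪ [c, ∞)
exactly when c⟨Df, f⟩ ≤ ‖Df‖² for all f. On ℓ²(X) this asks for the inequality on every X_i with the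
same c (`isExpander_iff`). In the ultraproduct it asks for it only in the limit, after division by
|X_i|, along uniformly integrable sequences (`hasSpectralGapAlong_iff`).

From expanders to ultraproducts: deleting or adding o(|X_i|) edges changes both sides by at most a
constant times the mass of |f|² on o(|X_i|) vertices, which uniform integrability makes negligible
(`HasGraphGap.exists_gap_le_of_map`).

Conversely, testing the ultraproduct gap on functions bounded by 1 gives each large X_i the
inequality with an error ε|X_i|. This error is traded for combinatorics. A lazy diffusion, applied
to the indicators of the classes of a partition and followed by thresholding, turns any partition
into a nearby one that cuts at most δ|X_i| edges (`exists_relabelling`); the essential point is that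
a single error serves all classes together, however many there are (`HasApproxGap.sum_le`). Start
from a greedy partition, whose pieces are minimal sets of small boundary, and improve it. A set that
fills at most half of each class and has small boundary inside the classes can be improved too, to a
set with almost no boundary, and minimality of the greedy pieces forces that set to be small
(`exists_weaklyExpanding_labelling`). Isolating a few vertices then makes every class expand
(`exists_expanding_labelling`), and Cheeger's inequality gives a gap to the graph of the edges
inside classes (`exists_spanning_subgraph_gap`).

The resulting gap depends only on c and the degree, while the proportion of lost edges is as small
as desired. Hence spanning subgraphs with this gap and as many edges as possible lose o(|X_i|)
edges, and positive edge density makes this o(|E(X_i)|).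

For almost boundary (T), the Roe algebra acts termwise on the ultraproduct. An element vanishing
over the core of Y has, far out in X, non-small entries only at bounded distance from the complement
of Y, hence only at o(|X_i|) vertices, and acts by zero (`ultraRep_eq_zero`). The representation
therefore factors through the maximal algebra of the reduction, and spectra shrink under unital
homomorphisms. -/

/-! ### Spectral gaps as quadratic form inequalities -/

/-- For t ≥ 0, the polynomial t² - ct is nonnegative exactly when t = 0 or t ≥ c. By the functional
calculus, positivity of D² - cD is therefore the gap, and its quadratic form is ‖Df‖² - c⟨Df, f⟩. -/
theorem ContinuousLinearMap.IsPositive.spectrum_subset_gapSet_iff {H : Type*}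
    [NormedAddCommGroup H] [InnerProductSpace ℂ H] [CompleteSpace H] {D : H →L[ℂ] H}
    (hD : D.IsPositive) {c : ℝ} (hc : 0 < c) :
    spectrum ℂ D ⊆ BoxSpace.gapSet c ↔
      ∀ f : H, c * RCLike.re (inner ℂ (D f) f) ≤ ‖D f‖ ^ 2 := by
  have hsa : IsSelfAdjoint D := hD.isSelfAdjoint
  have hQ : cfc (fun t : ℝ => t ^ 2 - c * t) D = D ^ 2 - c • D := by
    rw [cfc_sub (fun t : ℝ => t ^ 2) (fun t : ℝ => c * t) D, cfc_pow_id (R := ℝ) D 2,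
      cfc_const_mul_id c D]
  have hinner : ∀ f : H, RCLike.re (inner ℂ ((D ^ 2 - c • D) f) f) =
      ‖D f‖ ^ 2 - c * RCLike.re (inner ℂ (D f) f) := by
    intro f
    rw [sub_apply, inner_sub_left, map_sub, pow_two, mul_apply_eq_comp,
      hD.inner_left_eq_inner_right, inner_self_eq_norm_sq, smul_apply, inner_smul_left_eq_smul]
    simp
  have hQsa : IsSelfAdjoint (D ^ 2 - c • D) :=
    (hsa.pow 2).sub ((IsSelfAdjoint.all c).smul hsa)
  have h0 : (0 : H →L[ℂ] H) ≤ D ^ 2 - c • D ↔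
      ∀ f : H, c * RCLike.re (inner ℂ (D f) f) ≤ ‖D f‖ ^ 2 := by
    rw [ContinuousLinearMap.nonneg_iff_isPositive, ContinuousLinearMap.isPositive_def']
    simp only [hQsa, true_and, ContinuousLinearMap.reApplyInnerSelf, hinner, sub_nonneg]
  rw [← h0, ← hQ]
  have hDnn : ∀ t ∈ spectrum ℝ D, 0 ≤ t :=
    fun t ht => spectrum_nonneg_of_nonneg
      ((ContinuousLinearMap.nonneg_iff_isPositive D).2 hD) ht
  constructor
  · intro h
    refine cfc_nonneg fun t ht => ?_
    have hz : (t : ℂ) ∈ spectrum ℂ D := by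
      have := (spectrum.algebraMap_mem_iff (S := ℂ) (R := ℝ) (a := D) (r := t)).2 ht
      simpa using this
    rcases h hz with h1 | ⟨s, hs, hst⟩
    · have : t = 0 := by simpa using h1
      simp [this]
    · have : s = t := Complex.ofReal_injective hst
      subst this
      have : c ≤ s := hs
      nlinarith
  · intro h z hz
    have hre : z = (z.re : ℂ) := hsa.mem_spectrum_eq_re hz
    have hmem : z.re ∈ spectrum ℝ D := by
      rw [hre] at hz
      exact (spectrum.algebraMap_mem_iff (S := ℂ) (R := ℝ) (a := D) (r := z.re)).1 (by simpa using hz)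
    have h1 := (cfc_nonneg_iff (fun t : ℝ => t ^ 2 - c * t) D).1 h z.re hmem
    have h2 := hDnn _ hmem
    rcases h2.eq_or_lt with h3 | h3
    · left
      rw [hre, ← h3]
      simp
    · right
      refine ⟨z.re, ?_, hre.symm⟩
      have : 0 ≤ z.re * (z.re - c) := by simpa [sq, sub_mul, mul_sub, mul_comm] using h1
      have := (mul_nonneg_iff_of_pos_left h3).1 this
      simpa using this

/-- The Dirichlet energy, summed over ordered pairs of adjacent vertices. -/
noncomputable def dirichletEnergy {V E : Type} [Fintype V] [NormedAddCommGroup E]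
    (G : SimpleGraph V) (f : V → E) : ℝ :=
  ∑ v, ∑ w ∈ nbrs G v, ‖f v - f w‖ ^ 2

theorem dirichletEnergy_nonneg {V E : Type} [Fintype V] [NormedAddCommGroup E]
    (G : SimpleGraph V) (f : V → E) : 0 ≤ dirichletEnergy G f :=
  Finset.sum_nonneg fun _ _ => Finset.sum_nonneg fun _ _ => by positivity

theorem sum_nbrs_comm {M : Type*} {V : Type} [Fintype V] [AddCommMonoid M] (G : SimpleGraph V)
    (F : V → V → M) : ∑ v, ∑ w ∈ nbrs G v, F v w = ∑ v, ∑ w ∈ nbrs G v, F w v := by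
  classical
  simp only [nbrs, Finset.sum_filter]
  rw [Finset.sum_comm]
  simp only [G.adj_comm]

theorem two_mul_sum_graphLaplacian {V : Type} [Fintype V] (G : SimpleGraph V) (f g : V → ℂ) :
    2 * ∑ v, starRingEnd ℂ (graphLaplacian G f v) * g v =
      ∑ v, ∑ w ∈ nbrs G v, starRingEnd ℂ (f v - f w) * (g v - g w) := by
  have h : ∑ v, starRingEnd ℂ (graphLaplacian G f v) * g v =
      ∑ v, ∑ w ∈ nbrs G v, starRingEnd ℂ (f v - f w) * g v := by
    refine Finset.sum_congr rfl fun v _ => ?_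
    rw [← Finset.sum_mul, ← map_sum]
    rfl
  have h' := h.trans (sum_nbrs_comm G _)
  rw [two_mul]
  refine (congrArg₂ (· + ·) h h').trans ?_
  simp only [← Finset.sum_add_distrib]
  refine Finset.sum_congr rfl fun v _ => Finset.sum_congr rfl fun w _ => ?_
  simp only [map_sub]
  ring

theorem sum_graphLaplacian_symm {V : Type} [Fintype V] (G : SimpleGraph V) (f g : V → ℂ) :
    ∑ v, starRingEnd ℂ (graphLaplacian G f v) * g v =
      ∑ v, starRingEnd ℂ (f v) * graphLaplacian G g v := by
  have h1 := two_mul_sum_graphLaplacian G f g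
  have h2 := congrArg (starRingEnd ℂ) (two_mul_sum_graphLaplacian G g f)
  simp only [map_mul, map_sum, Complex.conj_conj, map_ofNat, map_sub] at h1 h2
  have h3 : ∑ v, starRingEnd ℂ (f v) * graphLaplacian G g v =
      ∑ v, graphLaplacian G g v * starRingEnd ℂ (f v) :=
    Finset.sum_congr rfl fun v _ => mul_comm _ _
  refine mul_left_cancel₀ (two_ne_zero (α := ℂ)) (h1.trans ?_)
  rw [h3, h2]
  exact Finset.sum_congr rfl fun v _ => Finset.sum_congr rfl fun w _ => mul_comm _ _

theorem sum_graphLaplacian_self {V : Type} [Fintype V] (G : SimpleGraph V) (f : V → ℂ) :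
    ∑ v, starRingEnd ℂ (graphLaplacian G f v) * f v = ((dirichletEnergy G f / 2 : ℝ) : ℂ) := by
  refine mul_left_cancel₀ (two_ne_zero (α := ℂ)) ((two_mul_sum_graphLaplacian G f f).trans ?_)
  simp only [Complex.conj_mul', dirichletEnergy]
  push_cast
  ring

/-- The spectral gap inequality `c ⟨Δ f, f⟩ ≤ ‖Δ f‖²` of a finite graph. -/
def HasGraphGap {V : Type} [Fintype V] (G : SimpleGraph V) (c : ℝ) : Prop :=
  ∀ f : V → ℂ, c * (dirichletEnergy G f / 2) ≤ ∑ v, ‖graphLaplacian G f v‖ ^ 2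

namespace BoxSpace

variable (X : BoxSpace)

theorem hasSum_inner_L2 (f g : X.L2) :
    HasSum (fun i => ∑ v : X.V i, starRingEnd ℂ (f ⟨i, v⟩) * g ⟨i, v⟩) (inner ℂ f g) := by
  have h := lp.hasSum_inner (𝕜 := ℂ) f g
  refine (congrArg (fun F : ℕ → ℂ => HasSum F _) (funext fun i => ?_)).mpr
    (h.sigma (fun i => hasSum_fintype _))
  exact Finset.sum_congr rfl fun v _ => (RCLike.inner_apply' (𝕜 := ℂ) _ _).symm

theorem hasSum_norm_sq_L2 (f : X.L2) :
    HasSum (fun i => ∑ v : X.V i, ‖f ⟨i, v⟩‖ ^ 2) (‖f‖ ^ 2) := by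
  have h := Complex.hasSum_re (X.hasSum_inner_L2 f f)
  rw [← @inner_self_eq_norm_sq ℂ]
  refine (congrArg (fun F : ℕ → ℝ => HasSum F _) (funext fun i => ?_)).mpr h
  simp only [Complex.conj_mul']
  norm_cast

theorem hasSum_inner_laplacian (f : X.L2) :
    HasSum (fun i => dirichletEnergy (X.graph i) (fun v => f ⟨i, v⟩) / 2)
      (RCLike.re (inner ℂ (X.laplacian f) f)) := by
  refine (congrArg (fun F : ℕ → ℝ => HasSum F _) (funext fun i => ?_)).mpr
    (Complex.hasSum_re (X.hasSum_inner_L2 (X.laplacian f) f))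
  have := sum_graphLaplacian_self (X.graph i) (fun v => f ⟨i, v⟩)
  exact (congrArg Complex.re this).symm

theorem isPositive_laplacian : X.laplacian.IsPositive := by
  rw [ContinuousLinearMap.isPositive_def]
  refine ⟨fun f g => ?_, fun f => ?_⟩
  · refine (X.hasSum_inner_L2 (X.laplacian f) g).unique ?_
    refine (congrArg (fun F : ℕ → ℂ => HasSum F _) (funext fun i => ?_)).mpr
      (X.hasSum_inner_L2 f (X.laplacian g))
    exact sum_graphLaplacian_symm (X.graph i) (fun v => f ⟨i, v⟩) (fun v => g ⟨i, v⟩)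
  · refine (X.hasSum_inner_laplacian f).nonneg fun i => ?_
    exact div_nonneg (dirichletEnergy_nonneg _ _) two_pos.le

theorem exists_extend {i : ℕ} (f : X.V i → ℂ) :
    ∃ F : X.L2, (∀ v, F ⟨i, v⟩ = f v) ∧ ∀ j v, j ≠ i → F ⟨j, v⟩ = 0 := by
  classical
  refine ⟨∑ w, f w • X.delta ⟨i, w⟩, fun v => ?_, fun j v hj => ?_⟩
  · rw [lp.coeFn_sum, Finset.sum_apply, Finset.sum_eq_single v]
    · simp [delta_self]
    · intro w _ hw
      rw [lp.coeFn_smul, Pi.smul_apply, delta_ne, smul_zero]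
      simpa using hw.symm
    · simp
  · rw [lp.coeFn_sum, Finset.sum_apply]
    refine Finset.sum_eq_zero fun w _ => ?_
    rw [lp.coeFn_smul, Pi.smul_apply, delta_ne, smul_zero]
    simp [hj]

/-- Both sides of the form inequality are sums over the graphs. Functions supported on one graph
give one direction, summation gives the other. -/
theorem spectrum_laplacian_subset_iff {c : ℝ} (hc : 0 < c) :
    spectrum ℂ X.laplacian ⊆ gapSet c ↔ ∀ i, HasGraphGap (X.graph i) c := by
  rw [X.isPositive_laplacian.spectrum_subset_gapSet_iff hc]
  constructor
  · intro h i f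
    obtain ⟨F, hF, hF0⟩ := X.exists_extend f
    have hFi : (fun v => F ⟨i, v⟩) = f := funext hF
    have h1 := h F
    have h2 := X.hasSum_inner_laplacian F
    have h3 := X.hasSum_norm_sq_L2 (X.laplacian F)
    have hz : ∀ j, j ≠ i → (fun v : X.V j => F ⟨j, v⟩) = 0 := fun j hj => funext fun v => hF0 j v hj
    rw [h2.unique (hasSum_single i fun j hj => by rw [hz j hj]; simp [dirichletEnergy]),
      h3.unique (hasSum_single i fun j hj => ?_), hFi] at h1
    · refine h1.trans_eq (Finset.sum_congr rfl fun v _ => ?_)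
      rw [← hFi]
      rfl
    · refine Finset.sum_eq_zero fun v _ => ?_
      have : X.laplacian F ⟨j, v⟩ = graphLaplacian (X.graph j) (fun v => F ⟨j, v⟩) v := rfl
      rw [this, hz j hj]
      simp
  · intro h f
    refine hasSum_le (fun i => ?_) ((X.hasSum_inner_laplacian f).mul_left c)
      (X.hasSum_norm_sq_L2 (X.laplacian f))
    exact h i fun v => f ⟨i, v⟩

theorem isExpander_iff : X.IsExpander ↔ ∃ c : ℝ, 0 < c ∧ ∀ i, HasGraphGap (X.graph i) c :=
  exists_congr fun _ => and_congr_right fun hc => X.spectrum_laplacian_subset_iff hc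

end BoxSpace

/-! ### The gap in the ultraproduct and its finitary consequence -/

namespace BoxSpace

variable (X : BoxSpace) (u : Ultrafilter ℕ)

theorem tendsto_inner_preUltra (f g : X.PreUltraproduct u) :
    Tendsto (fun i => X.avgInner i (f.1 i) (g.1 i)) u (𝓝 (inner ℂ f g)) :=
  X.tendsto_avgInner u f g

theorem tendsto_inner_preUltraLaplacian (f : X.PreUltraproduct u) :
    Tendsto (fun i => dirichletEnergy (X.graph i) (f.1 i) / 2 / Nat.card (X.V i)) u
      (𝓝 (RCLike.re (inner ℂ (X.preUltraLaplacian u f) f))) := by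
  refine ((Complex.continuous_re.tendsto _).comp
    (X.tendsto_inner_preUltra u (X.preUltraLaplacian u f) f)).congr fun i => ?_
  have h := sum_graphLaplacian_self (X.graph i) (f.1 i)
  have h2 : X.avgInner i ((X.preUltraLaplacian u f).1 i) (f.1 i) =
      ((dirichletEnergy (X.graph i) (f.1 i) / 2 / Nat.card (X.V i) : ℝ) : ℂ) := by
    have h3 : X.avgInner i ((X.preUltraLaplacian u f).1 i) (f.1 i) =
      (∑ v, starRingEnd ℂ (graphLaplacian (X.graph i) (f.1 i) v) * f.1 i v) / Nat.card (X.V i) := rfl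
    rw [h3, h]
    push_cast
    rfl
  simp only [Function.comp, h2, Complex.ofReal_re]

theorem preUltraLaplacian_symm (f g : X.PreUltraproduct u) :
    inner ℂ (X.preUltraLaplacian u f) g = inner ℂ f (X.preUltraLaplacian u g) := by
  refine tendsto_nhds_unique (X.tendsto_inner_preUltra u _ _)
    ((X.tendsto_inner_preUltra u f (X.preUltraLaplacian u g)).congr fun i => ?_)
  exact congrArg (· / (Nat.card (X.V i) : ℂ))
    (sum_graphLaplacian_symm (X.graph i) (f.1 i) (g.1 i)).symm

theorem ultraLaplacian_coe (f : X.PreUltraproduct u) :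
    X.ultraLaplacian u (f : X.Ultraproduct u) = (X.preUltraLaplacian u f : X.Ultraproduct u) :=
  UniformSpace.Completion.map_coe (X.preUltraLaplacian u).uniformContinuous f

theorem isPositive_ultraLaplacian : (X.ultraLaplacian u).IsPositive := by
  rw [ContinuousLinearMap.isPositive_def]
  refine ⟨fun f g => ?_, fun f => ?_⟩
  · show inner ℂ (X.ultraLaplacian u f) g = inner ℂ f (X.ultraLaplacian u g)
    refine UniformSpace.Completion.induction_on₂ f g ?_ fun f g => ?_
    · exact isClosed_eq (by fun_prop) (by fun_prop)
    · rw [ultraLaplacian_coe, ultraLaplacian_coe, UniformSpace.Completion.inner_coe,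
        UniformSpace.Completion.inner_coe, preUltraLaplacian_symm]
  · show 0 ≤ RCLike.re (inner ℂ (X.ultraLaplacian u f) f)
    refine UniformSpace.Completion.induction_on f ?_ fun f => ?_
    · exact isClosed_le (by fun_prop) (by fun_prop)
    · rw [ultraLaplacian_coe, UniformSpace.Completion.inner_coe]
      refine ge_of_tendsto' (X.tendsto_inner_preUltraLaplacian u f) fun i => ?_
      have := dirichletEnergy_nonneg (X.graph i) (f.1 i)
      positivity

/-- The form inequality is a closed condition, so it suffices to check it on the dense image of the
uniformly integrable sequences. -/
theorem hasSpectralGapAlong_iff {c : ℝ} (hc : 0 < c) : X.HasSpectralGapAlong u c ↔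
    ∀ f : X.PreUltraproduct u, c * RCLike.re (inner ℂ (X.preUltraLaplacian u f) f) ≤
      ‖X.preUltraLaplacian u f‖ ^ 2 := by
  rw [HasSpectralGapAlong, (X.isPositive_ultraLaplacian u).spectrum_subset_gapSet_iff hc]
  constructor
  · intro h f
    have := h f
    rwa [ultraLaplacian_coe, UniformSpace.Completion.inner_coe,
      UniformSpace.Completion.norm_coe] at this
  · intro h f
    refine UniformSpace.Completion.induction_on f ?_ fun f => ?_
    · exact isClosed_le (by fun_prop) (by fun_prop)
    · rw [ultraLaplacian_coe, UniformSpace.Completion.inner_coe,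
        UniformSpace.Completion.norm_coe]
      exact h f

theorem tendsto_norm_sq_preUltraLaplacian (f : X.PreUltraproduct u) :
    Tendsto (fun i => (∑ v, ‖graphLaplacian (X.graph i) (f.1 i) v‖ ^ 2) / Nat.card (X.V i)) u
      (𝓝 (‖X.preUltraLaplacian u f‖ ^ 2)) :=
  X.tendsto_norm_sq u (X.preUltraLaplacian u f)

variable {X} in
theorem exists_ultrafilter_of_frequently {P : ℕ → Prop} (h : ∃ᶠ i in atTop, P i) :
    ∃ u : Ultrafilter ℕ, (∀ n, u ≠ pure n) ∧ ∀ᶠ i in u, P i := by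
  have : (atTop ⊓ 𝓟 {i | P i}).NeBot := frequently_mem_iff_neBot.1 h
  refine ⟨Ultrafilter.of (atTop ⊓ 𝓟 {i | P i}), fun n hn => ?_, ?_⟩
  · have h1 : {i | n < i} ∈ Ultrafilter.of (atTop ⊓ 𝓟 {i | P i}) :=
      Ultrafilter.of_le _ (mem_inf_of_left (Ioi_mem_atTop n))
    rw [hn] at h1
    exact lt_irrefl n (show n < n from h1)
  · exact Ultrafilter.of_le _ (mem_inf_of_right (mem_principal_self _))

variable {u} in
theorem le_atTop_of_ne_pure (hu : ∀ n, u ≠ pure n) : (u : Filter ℕ) ≤ atTop := by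
  rw [← Nat.cofinite_eq_atTop]
  rcases u.le_cofinite_or_eq_pure with h | ⟨n, hn⟩
  · exact h
  · exact absurd hn (hu n)

/-- The approximate spectral gap inequality for real functions bounded by `1`. -/
def _root_.HasApproxGap {V : Type} [Fintype V] (G : SimpleGraph V) (c ε : ℝ) : Prop :=
  ∀ f : V → ℝ, (∀ v, |f v| ≤ 1) →
    c * (dirichletEnergy G f / 2) - ε * Nat.card V ≤ ∑ v, (∑ w ∈ nbrs G v, (f v - f w)) ^ 2

theorem mem_uniformlyIntegrable_of_norm_le_one (f : ∀ i, X.V i → ℂ) (hf : ∀ i v, ‖f i v‖ ≤ 1) :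
    f ∈ X.uniformlyIntegrable := by
  have key : ∀ i (T : Finset (X.V i)), ∑ v ∈ T, ‖f i v‖ ^ 2 ≤ T.card := by
    intro i T
    refine (Finset.sum_le_card_nsmul T _ 1 fun v _ => ?_).trans_eq (by simp)
    exact pow_le_one₀ (norm_nonneg _) (hf i v)
  refine ⟨⟨1, fun i => ?_⟩, fun ε hε => ⟨ε, hε, fun i T hT => (key i T).trans hT⟩⟩
  refine (key i Finset.univ).trans_eq ?_
  simp

/-- If the inequality failed for infinitely many graphs, some non-principal ultrafilter would
concentrate on them. The offending functions are bounded by 1, hence form a uniformly integrable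
sequence and a vector violating the gap along that ultrafilter. -/
theorem HasUltraproductSpectralGap.eventually_hasApproxGap {c : ℝ} (hc : 0 < c)
    (h : ∀ u : Ultrafilter ℕ, (∀ n, u ≠ pure n) → X.HasSpectralGapAlong u c) {ε : ℝ} (hε : 0 < ε) :
    ∀ᶠ i in atTop, HasApproxGap (X.graph i) c ε := by
  by_contra hcon
  obtain ⟨u, hu, hP⟩ := exists_ultrafilter_of_frequently (not_eventually.1 hcon)
  have hex : ∀ i, ∃ f : X.V i → ℝ, (∀ v, |f v| ≤ 1) ∧ (¬ HasApproxGap (X.graph i) c ε →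
      ∑ v, (∑ w ∈ nbrs (X.graph i) v, (f v - f w)) ^ 2 <
        c * (dirichletEnergy (X.graph i) f / 2) - ε * Nat.card (X.V i)) := by
    intro i
    by_cases hi : HasApproxGap (X.graph i) c ε
    · exact ⟨0, fun v => by simp, fun h => absurd hi h⟩
    · have h2 := hi
      rw [HasApproxGap] at hi
      push Not at hi
      obtain ⟨f, hf, hlt⟩ := hi
      exact ⟨f, hf, fun _ => hlt⟩
  choose f hf hlt using hex
  let F : X.PreUltraproduct u := ⟨fun i v => (f i v : ℂ),
    X.mem_uniformlyIntegrable_of_norm_le_one _ fun i v => by simpa using hf i v⟩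
  have h1 := (X.hasSpectralGapAlong_iff u hc).1 (h u hu) F
  have h2 := (X.tendsto_norm_sq_preUltraLaplacian u F).sub
    ((X.tendsto_inner_preUltraLaplacian u F).const_mul c)
  have hcard : ∀ᶠ i in u, 0 < Nat.card (X.V i) :=
    (le_atTop_of_ne_pure hu) (X.tendsto_card.eventually_gt_atTop 0)
  -- Divided by the number of vertices, each violated inequality leaves a deficit of at least ε,
  -- which survives in the limit and contradicts `h1`.
  have h3 := le_of_tendsto h2 (b := -ε) (by
    filter_upwards [hP, hcard] with i hi hn
    have hn' : (0 : ℝ) < Nat.card (X.V i) := by exact_mod_cast hn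
    have h4 := hlt i hi
    have h5 : ∀ v, ‖graphLaplacian (X.graph i) (F.1 i) v‖ ^ 2 =
        (∑ w ∈ nbrs (X.graph i) v, (f i v - f i w)) ^ 2 := by
      intro v
      have : graphLaplacian (X.graph i) (F.1 i) v =
          ((∑ w ∈ nbrs (X.graph i) v, (f i v - f i w) : ℝ) : ℂ) := by
        push_cast
        rfl
      rw [this, Complex.norm_real, Real.norm_eq_abs, sq_abs]
    have h6 : dirichletEnergy (X.graph i) (F.1 i) = dirichletEnergy (X.graph i) (f i) := by
      refine Finset.sum_congr rfl fun v _ => Finset.sum_congr rfl fun w _ => ?_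
      have : F.1 i v - F.1 i w = ((f i v - f i w : ℝ) : ℂ) := by
        push_cast
        rfl
      rw [this, Complex.norm_real]
    simp only [h5, h6]
    rw [mul_div_assoc', ← sub_div, div_le_iff₀ hn']
    linarith)
  linarith

end BoxSpace

/-! ### Lazy diffusion of partitions of unity -/

section Diffusion

variable {V : Type} [Fintype V] {G : SimpleGraph V}

/-- The Laplace operator on real functions. -/
noncomputable def realLaplacian (G : SimpleGraph V) : (V → ℝ) →ₗ[ℝ] (V → ℝ) where
  toFun f v := ∑ w ∈ nbrs G v, (f v - f w)
  map_add' f g := by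
    funext v
    simp only [Pi.add_apply, ← Finset.sum_add_distrib]
    exact Finset.sum_congr rfl fun _ _ => by ring
  map_smul' c f := by
    funext v
    simp only [Pi.smul_apply, smul_eq_mul, RingHom.id_apply, Finset.mul_sum]
    exact Finset.sum_congr rfl fun _ _ => by ring

theorem realLaplacian_apply (f : V → ℝ) (v : V) :
    realLaplacian G f v = ∑ w ∈ nbrs G v, (f v - f w) := rfl

theorem two_mul_sum_realLaplacian_mul (f g : V → ℝ) :
    2 * ∑ v, realLaplacian G f v * g v = ∑ v, ∑ w ∈ nbrs G v, (f v - f w) * (g v - g w) := by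
  have h : ∑ v, realLaplacian G f v * g v = ∑ v, ∑ w ∈ nbrs G v, (f v - f w) * g v := by
    refine Finset.sum_congr rfl fun v _ => ?_
    rw [← Finset.sum_mul]
    rfl
  have h' := h.trans (sum_nbrs_comm G _)
  rw [two_mul]
  refine (congrArg₂ (· + ·) h h').trans ?_
  simp only [← Finset.sum_add_distrib]
  refine Finset.sum_congr rfl fun v _ => Finset.sum_congr rfl fun w _ => ?_
  ring

theorem sum_realLaplacian_mul_comm (f g : V → ℝ) :
    ∑ v, realLaplacian G f v * g v = ∑ v, f v * realLaplacian G g v := by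
  have h1 := two_mul_sum_realLaplacian_mul (G := G) f g
  have h2 := two_mul_sum_realLaplacian_mul (G := G) g f
  have h3 : ∑ v, f v * realLaplacian G g v = ∑ v, realLaplacian G g v * f v :=
    Finset.sum_congr rfl fun v _ => mul_comm _ _
  have h4 : ∑ v, ∑ w ∈ nbrs G v, (f v - f w) * (g v - g w) =
      ∑ v, ∑ w ∈ nbrs G v, (g v - g w) * (f v - f w) :=
    Finset.sum_congr rfl fun v _ => Finset.sum_congr rfl fun w _ => mul_comm _ _
  linarith

theorem dirichletEnergy_real (f : V → ℝ) :
    dirichletEnergy G f = ∑ v, ∑ w ∈ nbrs G v, (f v - f w) ^ 2 := by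
  simp only [dirichletEnergy, Real.norm_eq_abs, sq_abs]

theorem sum_realLaplacian_mul_self (f : V → ℝ) :
    ∑ v, realLaplacian G f v * f v = dirichletEnergy G f / 2 := by
  have := two_mul_sum_realLaplacian_mul (G := G) f f
  rw [dirichletEnergy_real]
  simp only [pow_two]
  linarith

theorem sum_sq_realLaplacian_le {d : ℕ} (hd : ∀ v, (nbrs G v).card ≤ d) (f : V → ℝ) :
    ∑ v, realLaplacian G f v ^ 2 ≤ d * dirichletEnergy G f := by
  rw [dirichletEnergy_real, Finset.mul_sum]
  refine Finset.sum_le_sum fun v _ => ?_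
  refine (sq_sum_le_card_mul_sum_sq (s := nbrs G v) (f := fun w => f v - f w)).trans ?_
  have : ((nbrs G v).card : ℝ) ≤ d := by exact_mod_cast hd v
  exact mul_le_mul_of_nonneg_right this (Finset.sum_nonneg fun _ _ => sq_nonneg _)

theorem dirichletEnergy_le {d : ℕ} (hd : ∀ v, (nbrs G v).card ≤ d) (f : V → ℝ) :
    dirichletEnergy G f ≤ 4 * d * ∑ v, f v ^ 2 := by
  rw [dirichletEnergy_real]
  have h1 : ∑ v, ∑ w ∈ nbrs G v, (f v - f w) ^ 2 ≤
      ∑ v, ∑ w ∈ nbrs G v, 2 * f v ^ 2 + ∑ v, ∑ w ∈ nbrs G v, 2 * f w ^ 2 := by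
    rw [← Finset.sum_add_distrib]
    refine Finset.sum_le_sum fun v _ => ?_
    rw [← Finset.sum_add_distrib]
    exact Finset.sum_le_sum fun w _ => by nlinarith [sq_nonneg (f v + f w)]
  have h2 := sum_nbrs_comm G fun v _ => 2 * f v ^ 2
  have h3 : ∑ v, ∑ w ∈ nbrs G v, 2 * f v ^ 2 ≤ 2 * d * ∑ v, f v ^ 2 := by
    rw [Finset.mul_sum]
    refine Finset.sum_le_sum fun v _ => ?_
    rw [Finset.sum_const, nsmul_eq_mul]
    have : ((nbrs G v).card : ℝ) ≤ d := by exact_mod_cast hd v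
    nlinarith [mul_le_mul_of_nonneg_right this (sq_nonneg (f v))]
  linarith

/-- The lazy diffusion `1 - Δ / K`. -/
noncomputable def diffusion (G : SimpleGraph V) (K : ℝ) : Module.End ℝ (V → ℝ) :=
  1 - K⁻¹ • realLaplacian G

theorem diffusion_apply (K : ℝ) (f : V → ℝ) (v : V) :
    diffusion G K f v = f v - K⁻¹ * realLaplacian G f v := rfl

theorem sum_diffusion_mul_comm (K : ℝ) (f g : V → ℝ) :
    ∑ v, diffusion G K f v * g v = ∑ v, f v * diffusion G K g v := by
  simp only [diffusion_apply, sub_mul, mul_sub, Finset.sum_sub_distrib, mul_assoc, ← Finset.mul_sum,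
    mul_left_comm _ K⁻¹, sum_realLaplacian_mul_comm]

theorem sum_diffusion_pow_mul_comm (K : ℝ) (k : ℕ) (f g : V → ℝ) :
    ∑ v, (diffusion G K ^ k) f v * g v = ∑ v, f v * (diffusion G K ^ k) g v := by
  induction k generalizing f g with
  | zero => rfl
  | succ k ih =>
    rw [pow_succ, Module.End.mul_apply, ih, sum_diffusion_mul_comm, ← pow_succ, pow_succ',
      Module.End.mul_apply]

theorem diffusion_nonneg {d : ℕ} (hd : ∀ v, (nbrs G v).card ≤ d) {K : ℝ} (hK : d ≤ K) (hK0 : 0 < K)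
    {f : V → ℝ} (hf : ∀ v, 0 ≤ f v) (v : V) : 0 ≤ diffusion G K f v := by
  rw [diffusion_apply, realLaplacian_apply, Finset.sum_sub_distrib, Finset.sum_const, nsmul_eq_mul]
  have h1 : ((nbrs G v).card : ℝ) ≤ K := le_trans (by exact_mod_cast hd v) hK
  have h2 : 0 ≤ ∑ w ∈ nbrs G v, f w := Finset.sum_nonneg fun w _ => hf w
  have h3 : K⁻¹ * (nbrs G v).card ≤ 1 := by rw [inv_mul_le_iff₀ hK0]; linarith
  have h4 : 0 ≤ K⁻¹ * ∑ w ∈ nbrs G v, f w := by positivity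
  nlinarith [mul_le_mul_of_nonneg_right h3 (hf v)]

theorem diffusion_const_one (K : ℝ) : diffusion G K (fun _ => 1) = fun _ => 1 := by
  funext v
  simp [diffusion_apply, realLaplacian_apply]

variable {d : ℕ} (hd : ∀ v, (nbrs G v).card ≤ d) {K : ℝ} (hK : 2 * d ≤ K) (hK0 : 0 < K)
include hd hK hK0

/-- Writing the half energy as ⟨Δf, f⟩, expansion gives ⟨Δf, f⟩ - 2K⁻¹‖Δf‖² + K⁻²⟨ΔΔf, Δf⟩. Since Δ
≤ 2d ≤ K, the last term is at most K⁻¹‖Δf‖². -/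
theorem dirichletEnergy_diffusion_le (f : V → ℝ) :
    dirichletEnergy G (diffusion G K f) / 2 ≤
      dirichletEnergy G f / 2 - K⁻¹ * ∑ v, realLaplacian G f v ^ 2 := by
  have h1 : dirichletEnergy G (diffusion G K f) / 2 = dirichletEnergy G f / 2 -
      2 * K⁻¹ * ∑ v, realLaplacian G f v ^ 2 +
      K⁻¹ ^ 2 * (dirichletEnergy G (realLaplacian G f) / 2) := by
    rw [← sum_realLaplacian_mul_self, ← sum_realLaplacian_mul_self, ← sum_realLaplacian_mul_self]
    have h2 : realLaplacian G (diffusion G K f) =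
        fun v => realLaplacian G f v - K⁻¹ * realLaplacian G (realLaplacian G f) v := by
      funext v
      have : diffusion G K f = f - K⁻¹ • realLaplacian G f := rfl
      rw [this, map_sub, map_smul]
      rfl
    have h3 := sum_realLaplacian_mul_comm (G := G) (realLaplacian G f) f
    rw [h2]
    simp only [diffusion_apply]
    have h4 : ∀ v, (realLaplacian G f v - K⁻¹ * realLaplacian G (realLaplacian G f) v) *
        (f v - K⁻¹ * realLaplacian G f v) = realLaplacian G f v * f v -
        K⁻¹ * realLaplacian G f v ^ 2 - K⁻¹ * (realLaplacian G (realLaplacian G f) v * f v) +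
        K⁻¹ ^ 2 * (realLaplacian G (realLaplacian G f) v * realLaplacian G f v) := fun v => by ring
    simp only [h4, Finset.sum_add_distrib, Finset.sum_sub_distrib, ← Finset.mul_sum, h3]
    simp only [← pow_two]
    ring
  have h5 := dirichletEnergy_le hd (realLaplacian G f)
  have h6 : 0 ≤ ∑ v, realLaplacian G f v ^ 2 := Finset.sum_nonneg fun _ _ => sq_nonneg _
  have h7 : K⁻¹ ^ 2 * (dirichletEnergy G (realLaplacian G f) / 2) ≤
      K⁻¹ * ∑ v, realLaplacian G f v ^ 2 := by
    have : dirichletEnergy G (realLaplacian G f) / 2 ≤ K * ∑ v, realLaplacian G f v ^ 2 := by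
      nlinarith [mul_le_mul_of_nonneg_right hK h6]
    calc _ ≤ K⁻¹ ^ 2 * (K * ∑ v, realLaplacian G f v ^ 2) := by gcongr
      _ = _ := by field_simp
  linarith

theorem sum_sq_sub_diffusion_sq (f : V → ℝ) :
    0 ≤ ∑ v, f v ^ 2 - ∑ v, diffusion G K f v ^ 2 ∧
    ∑ v, f v ^ 2 - ∑ v, diffusion G K f v ^ 2 ≤ 2 * K⁻¹ * (dirichletEnergy G f / 2) := by
  have h1 : ∑ v, f v ^ 2 - ∑ v, diffusion G K f v ^ 2 =
      2 * K⁻¹ * (dirichletEnergy G f / 2) - K⁻¹ ^ 2 * ∑ v, realLaplacian G f v ^ 2 := by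
    rw [← sum_realLaplacian_mul_self, ← Finset.sum_sub_distrib, Finset.mul_sum, Finset.mul_sum,
      ← Finset.sum_sub_distrib]
    refine Finset.sum_congr rfl fun v _ => ?_
    rw [diffusion_apply]
    ring
  have h2 := sum_sq_realLaplacian_le hd f
  have h3 : 0 ≤ ∑ v, realLaplacian G f v ^ 2 := Finset.sum_nonneg fun _ _ => sq_nonneg _
  have h4 := dirichletEnergy_nonneg G f
  rw [h1]
  constructor
  · have : K⁻¹ ^ 2 * ∑ v, realLaplacian G f v ^ 2 ≤ K⁻¹ ^ 2 * (K * dirichletEnergy G f) := by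
      gcongr
      nlinarith
    have h5 : K⁻¹ ^ 2 * (K * dirichletEnergy G f) = K⁻¹ * dirichletEnergy G f := by field_simp
    linarith
  · have : 0 ≤ K⁻¹ ^ 2 * ∑ v, realLaplacian G f v ^ 2 := by positivity
    linarith

theorem sum_sq_diffusion_pow_le (f : V → ℝ) (k : ℕ) :
    ∑ v, (diffusion G K ^ k) f v ^ 2 ≤ ∑ v, f v ^ 2 := by
  induction k with
  | zero => rfl
  | succ k ih =>
    rw [pow_succ', Module.End.mul_apply]
    linarith [(sum_sq_sub_diffusion_sq hd hK hK0 ((diffusion G K ^ k) f)).1]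

/-- The exponent is even so that self-adjointness turns ⟨P²ᵐf, f⟩ into ‖Pᵐf‖², which is at least
‖P²ᵐf‖² because P is a contraction. Movement of f is thus controlled by loss of norm. -/
theorem sum_sq_sub_diffusion_pow_le (f : V → ℝ) (m : ℕ) :
    ∑ v, (f v - (diffusion G K ^ (m + m)) f v) ^ 2 ≤
      ∑ v, f v ^ 2 - ∑ v, (diffusion G K ^ (m + m)) f v ^ 2 := by
  have h1 : ∑ v, (diffusion G K ^ (m + m)) f v * f v = ∑ v, (diffusion G K ^ m) f v ^ 2 := by
    rw [pow_add, Module.End.mul_apply, sum_diffusion_pow_mul_comm]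
    simp only [pow_two]
  have h2 : ∑ v, (diffusion G K ^ (m + m)) f v ^ 2 ≤ ∑ v, (diffusion G K ^ m) f v ^ 2 := by
    rw [pow_add, Module.End.mul_apply]
    exact sum_sq_diffusion_pow_le hd hK hK0 _ m
  have h3 : ∑ v, (f v - (diffusion G K ^ (m + m)) f v) ^ 2 = ∑ v, f v ^ 2 -
      2 * ∑ v, (diffusion G K ^ (m + m)) f v * f v + ∑ v, (diffusion G K ^ (m + m)) f v ^ 2 := by
    rw [Finset.mul_sum, ← Finset.sum_sub_distrib, ← Finset.sum_add_distrib]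
    exact Finset.sum_congr rfl fun v _ => by ring
  linarith

omit hd hK hK0

/-- Averaging over signs: every combination ∑ ±g_j is still bounded by 1, so the approximate gap
applies to it with error ε|V|, and the cross terms of the quadratic form cancel on average. The
error is thus paid once, not once for each function. -/
theorem HasApproxGap.sum_le {c ε : ℝ} (h : HasApproxGap G c ε) {ι : Type*} (s : Finset ι)
    (g : ι → V → ℝ) (hg : ∀ v, ∑ j ∈ s, |g j v| ≤ 1) :
    c * ∑ j ∈ s, dirichletEnergy G (g j) / 2 - ε * Nat.card V ≤
      ∑ j ∈ s, ∑ v, realLaplacian G (g j) v ^ 2 := by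
  classical
  let F : (V → ℝ) → ℝ := fun f =>
    ∑ v, realLaplacian G f v ^ 2 - c * (dirichletEnergy G f / 2)
  have hF : ∀ a b : V → ℝ, F (a + b) + F (a - b) = 2 * F a + 2 * F b := by
    intro a b
    have h1 : dirichletEnergy G (a + b) + dirichletEnergy G (a - b) =
        2 * dirichletEnergy G a + 2 * dirichletEnergy G b := by
      simp only [dirichletEnergy_real, Finset.mul_sum, ← Finset.sum_add_distrib]
      refine Finset.sum_congr rfl fun v _ => Finset.sum_congr rfl fun w _ => ?_
      simp only [Pi.add_apply, Pi.sub_apply]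
      ring
    have h2 : ∑ v, realLaplacian G (a + b) v ^ 2 + ∑ v, realLaplacian G (a - b) v ^ 2 =
        2 * ∑ v, realLaplacian G a v ^ 2 + 2 * ∑ v, realLaplacian G b v ^ 2 := by
      simp only [Finset.mul_sum, ← Finset.sum_add_distrib, map_add, map_sub, Pi.add_apply,
        Pi.sub_apply]
      exact Finset.sum_congr rfl fun v _ => by ring
    simp only [F]
    linear_combination h2 - c / 2 * h1
  -- The function `a` is the signed sum of the functions already absorbed; the parallelogram
  -- identity `hF` averages the two choices a ± g_j of the next sign.
  have key : ∀ a : V → ℝ, (∀ v, |a v| + ∑ j ∈ s, |g j v| ≤ 1) →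
      -(ε * Nat.card V) ≤ F a + ∑ j ∈ s, F (g j) := by
    clear hg
    induction s using Finset.induction_on with
    | empty =>
      intro a ha
      have := h a (by simpa using ha)
      simp only [Finset.sum_empty, add_zero, F, realLaplacian_apply]
      linarith
    | insert j s hj ih =>
      intro a ha
      simp only [Finset.sum_insert hj] at ha ⊢
      have h1 := ih (a + g j) fun v => by
        have := abs_add_le (a v) (g j v)
        have := ha v
        simp only [Pi.add_apply]
        linarith
      have h2 := ih (a - g j) fun v => by
        have := abs_sub (a v) (g j v)
        have := ha v
        simp only [Pi.sub_apply]
        linarith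
      have := hF a (g j)
      linarith
  have h0 := key 0 (by simpa using hg)
  have hF0 : F 0 = 0 := by simp [F, dirichletEnergy]
  rw [hF0, zero_add] at h0
  simp only [F, Finset.sum_sub_distrib, ← Finset.mul_sum] at h0
  linarith

/-- The three conclusions say that diffusion keeps a partition of unity, that its total energy after
m steps is of order K/(cm) times the initial energy up to the error, and that 2m steps move it, in
squared norm, by at most about 2/c times the initial energy. This last bound, apart from the error,
does not grow with m. -/
theorem HasApproxGap.diffusion_estimates (hd : ∀ v, (nbrs G v).card ≤ d) (hK : 2 * d ≤ K)
    (hK0 : 0 < K) {c ε : ℝ} (hc : 0 < c) (h : HasApproxGap G c ε) {ι : Type*} (s : Finset ι)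
    (g : ι → V → ℝ) (hg0 : ∀ j ∈ s, ∀ v, 0 ≤ g j v) (hg : ∀ v, ∑ j ∈ s, g j v = 1) (m : ℕ) :
    (∀ k, (∀ j ∈ s, ∀ v, 0 ≤ (diffusion G K ^ k) (g j) v) ∧
      ∀ v, ∑ j ∈ s, (diffusion G K ^ k) (g j) v = 1) ∧
    (m : ℝ) * (c * ∑ j ∈ s, dirichletEnergy G ((diffusion G K ^ m) (g j)) / 2) ≤
      K * (∑ j ∈ s, dirichletEnergy G (g j) / 2) + m * (ε * Nat.card V) ∧
    c * (∑ j ∈ s, ∑ v, (g j v - (diffusion G K ^ (m + m)) (g j) v) ^ 2) ≤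
      2 * (∑ j ∈ s, dirichletEnergy G (g j) / 2) + 2 * K⁻¹ * ((m + m : ℕ) * (ε * Nat.card V)) := by
  have hdK : (d : ℝ) ≤ K := by
    have : (0 : ℝ) ≤ d := by positivity
    linarith
  have hprob : ∀ k, (∀ j ∈ s, ∀ v, 0 ≤ (diffusion G K ^ k) (g j) v) ∧
      ∀ v, ∑ j ∈ s, (diffusion G K ^ k) (g j) v = 1 := by
    intro k
    induction k with
    | zero => exact ⟨hg0, hg⟩
    | succ k ih =>
      constructor
      · intro j hj v
        rw [pow_succ', Module.End.mul_apply]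
        exact diffusion_nonneg hd hdK hK0 (ih.1 j hj) v
      · intro v
        have h1 : ∑ j ∈ s, (diffusion G K ^ k) (g j) = fun _ => 1 := by
          funext v
          rw [Finset.sum_apply, ih.2]
        have h2 := congrFun (congrArg (diffusion G K) h1) v
        rw [diffusion_const_one, map_sum, Finset.sum_apply] at h2
        simpa only [pow_succ', Module.End.mul_apply] using h2
  set E : ℕ → ℝ := fun k => ∑ j ∈ s, dirichletEnergy G ((diffusion G K ^ k) (g j)) / 2 with hE
  set N : ℕ → ℝ := fun k => ∑ j ∈ s, ∑ v, (diffusion G K ^ k) (g j) v ^ 2 with hN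
  set D : ℕ → ℝ := fun k => ∑ j ∈ s, ∑ v, realLaplacian G ((diffusion G K ^ k) (g j)) v ^ 2 with hD
  have hE0 : ∀ k, 0 ≤ E k := fun k => Finset.sum_nonneg fun j _ =>
    div_nonneg (dirichletEnergy_nonneg _ _) two_pos.le
  have hD0 : ∀ k, 0 ≤ D k := fun k => Finset.sum_nonneg fun j _ =>
    Finset.sum_nonneg fun _ _ => sq_nonneg _
  -- At every time the functions are nonnegative with sum 1, so `HasApproxGap.sum_le` applies to all
  -- of them with a single error.
  have hgap : ∀ k, c * E k - ε * Nat.card V ≤ D k := fun k =>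
    h.sum_le s (fun j => (diffusion G K ^ k) (g j)) fun v => by
      rw [Finset.sum_congr rfl fun j hj => abs_of_nonneg ((hprob k).1 j hj v), (hprob k).2 v]
  have hstep : ∀ k, E (k + 1) ≤ E k - K⁻¹ * D k := by
    intro k
    simp only [hE, hD, Finset.mul_sum, ← Finset.sum_sub_distrib]
    refine Finset.sum_le_sum fun j _ => ?_
    rw [pow_succ', Module.End.mul_apply, ← Finset.mul_sum]
    exact dirichletEnergy_diffusion_le hd hK hK0 _
  have hNstep : ∀ k, N k - N (k + 1) ≤ 2 * K⁻¹ * E k := by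
    intro k
    simp only [hE, hN, Finset.mul_sum, ← Finset.sum_sub_distrib]
    refine Finset.sum_le_sum fun j _ => ?_
    rw [pow_succ', Module.End.mul_apply, Finset.sum_sub_distrib]
    exact (sum_sq_sub_diffusion_sq hd hK hK0 _).2
  have hKi : 0 < K⁻¹ := inv_pos.2 hK0
  have hanti : ∀ k, E (k + 1) ≤ E k := fun k => by
    have := mul_nonneg hKi.le (hD0 k)
    linarith [hstep k]
  -- Each step dissipates at least K⁻¹(cE_k - ε|V|) of energy; the sum telescopes.
  have hsum : ∀ k, c * ∑ i ∈ Finset.range k, E i ≤ K * (E 0 - E k) + k * (ε * Nat.card V) := by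
    intro k
    induction k with
    | zero => simp
    | succ k ih =>
      rw [Finset.sum_range_succ, mul_add]
      push_cast
      have h1 := mul_le_mul_of_nonneg_left (hstep k) hK0.le
      have h2 : K * (E k - K⁻¹ * D k) = K * E k - D k := by field_simp
      linarith [hgap k]
  have hNsum : ∀ k, N 0 - N k ≤ 2 * K⁻¹ * ∑ i ∈ Finset.range k, E i := by
    intro k
    induction k with
    | zero => simp
    | succ k ih =>
      rw [Finset.sum_range_succ, mul_add]
      linarith [hNstep k]
  have hE0' : E 0 = ∑ j ∈ s, dirichletEnergy G (g j) / 2 := rfl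
  refine ⟨hprob, ?_, ?_⟩
  · have h1 : (m : ℝ) * E m ≤ ∑ i ∈ Finset.range m, E i := by
      have := Finset.card_nsmul_le_sum (Finset.range m) E (E m) fun i hi =>
        antitone_nat_of_succ_le hanti (Finset.mem_range.1 hi).le
      simpa using this
    have h2 := hsum m
    have h3 := mul_nonneg hK0.le (hE0 m)
    rw [← hE0']
    nlinarith [mul_le_mul_of_nonneg_left h1 hc.le]
  · have h1 : ∑ j ∈ s, ∑ v, (g j v - (diffusion G K ^ (m + m)) (g j) v) ^ 2 ≤ N 0 - N (m + m) := by
      simp only [hN, ← Finset.sum_sub_distrib]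
      refine Finset.sum_le_sum fun j _ => ?_
      rw [Finset.sum_sub_distrib]
      exact sum_sq_sub_diffusion_pow_le hd hK hK0 (g j) m
    have h2 := hNsum (m + m)
    have h3 := hsum (m + m)
    rw [← hE0']
    have h4 : c * (2 * K⁻¹ * ∑ i ∈ Finset.range (m + m), E i) ≤
        2 * K⁻¹ * (K * E 0 + (m + m : ℕ) * (ε * Nat.card V)) := by
      have h5 := mul_nonneg hK0.le (hE0 (m + m))
      have h6 : c * ∑ i ∈ Finset.range (m + m), E i ≤ K * E 0 + (m + m : ℕ) * (ε * Nat.card V) := by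
        linarith
      have := mul_le_mul_of_nonneg_left h6 (by positivity : 0 ≤ 2 * K⁻¹)
      linarith
    have h7 : 2 * K⁻¹ * (K * E 0 + (m + m : ℕ) * (ε * Nat.card V)) =
        2 * E 0 + 2 * K⁻¹ * ((m + m : ℕ) * (ε * Nat.card V)) := by
      field_simp
    have := mul_le_mul_of_nonneg_left (h1.trans h2) hc.le
    linarith

end Diffusion

/-! ### Improving a labelling to one with few cut edges -/

section Relabel

open Classical in
/-- The number of ordered pairs of adjacent vertices with different labels. -/
noncomputable def cutSize {V : Type} [Fintype V] {ι : Type*} (G : SimpleGraph V) (l : V → ι) : ℝ :=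
  ∑ v, ∑ w ∈ nbrs G v, if l v = l w then 0 else 1

theorem cutSize_le {V : Type} [Fintype V] {ι : Type*} {G : SimpleGraph V} {d : ℕ}
    (hd : ∀ v, (nbrs G v).card ≤ d) (l : V → ι) : cutSize G l ≤ d * Nat.card V := by
  classical
  have : ∀ v, (∑ w ∈ nbrs G v, if l v = l w then (0 : ℝ) else 1) ≤ d := by
    intro v
    calc _ ≤ ∑ w ∈ nbrs G v, (1 : ℝ) := Finset.sum_le_sum fun w _ => by split_ifs <;> norm_num
      _ = (nbrs G v).card := by simp
      _ ≤ d := by exact_mod_cast hd v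
  refine (Finset.sum_le_card_nsmul _ _ _ fun v _ => this v).trans_eq ?_
  rw [nsmul_eq_mul, Nat.card_eq_fintype_card, Finset.card_univ, mul_comm]

theorem card_filter_range_le (N : ℕ) {x y : ℝ} (hxy : x ≤ y) :
    (((Finset.range N).filter fun m : ℕ => x ≤ (m : ℝ) ∧ (m : ℝ) < y).card : ℝ) ≤ y - x + 1 := by
  have h1 : ((Finset.range N).filter fun m : ℕ => x ≤ (m : ℝ) ∧ (m : ℝ) < y).card ≤
      (Finset.Ico ⌈x⌉ ⌈y⌉).card := by
    refine Finset.card_le_card_of_injOn (fun m : ℕ => (m : ℤ)) ?_ (by simp)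
    intro m hm
    have hm := (Finset.mem_filter.1 hm).2
    simp only [Finset.coe_Ico, Set.mem_Ico]
    exact ⟨Int.ceil_le.2 (by exact_mod_cast hm.1), Int.lt_ceil.2 (by exact_mod_cast hm.2)⟩
  rw [Int.card_Ico] at h1
  have h2 : ⌈x⌉ ≤ ⌈y⌉ := Int.ceil_mono hxy
  have h3 : (((⌈y⌉ - ⌈x⌉).toNat : ℤ) : ℝ) = (⌈y⌉ : ℝ) - ⌈x⌉ := by
    rw [Int.toNat_of_nonneg (by omega)]
    push_cast
    rfl
  have h4 : (((Finset.range N).filter fun m : ℕ => x ≤ (m : ℝ) ∧ (m : ℝ) < y).card : ℝ) ≤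
      (((⌈y⌉ - ⌈x⌉).toNat : ℤ) : ℝ) := by exact_mod_cast h1
  have h5 := Int.ceil_lt_add_one y
  have h6 := Int.le_ceil x
  linarith

open Classical in
-- Rounding a partition of unity to a partition: give v the label j when q_j(v) exceeds a threshold
-- between 1/2 and 3/4. Above 1/2 at most one label qualifies, and `none` covers the case of no
-- label. A good threshold is found by averaging the cut over N equally spaced ones.
theorem exists_threshold_labelling {V : Type} [Fintype V] {G : SimpleGraph V} {d : ℕ}
    (hd : ∀ v, (nbrs G v).card ≤ d) {ι : Type*} (s : Finset ι) (q : ι → V → ℝ)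
    (hq0 : ∀ j ∈ s, ∀ v, 0 ≤ q j v) (hq : ∀ v, ∑ j ∈ s, q j v = 1) {N : ℕ} (hN : 0 < N) :
    ∃ l : V → Option ι, (∀ j ∈ s, ∀ v, 3 / 4 < q j v → l v = some j) ∧
      cutSize G l ≤ 10 * d / N * Nat.card V + 8 * N * ∑ j ∈ s, dirichletEnergy G (q j) := by
  have hN' : (0 : ℝ) < N := by exact_mod_cast hN
  set t : ℕ → ℝ := fun m => 1 / 2 + m / (4 * N) with ht
  have ht1 : ∀ m, 1 / 2 ≤ t m := fun m => by
    have : (0 : ℝ) ≤ m / (4 * N) := by positivity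
    simp only [ht]
    linarith
  have ht2 : ∀ m ∈ Finset.range N, t m ≤ 3 / 4 := fun m hm => by
    have h1 : (m : ℝ) ≤ N := by exact_mod_cast (Finset.mem_range.1 hm).le
    have : (m : ℝ) / (4 * N) ≤ 1 / 4 := by
      rw [div_le_iff₀ (by positivity)]
      linarith
    simp only [ht]
    linarith
  have huniq : ∀ v, ∀ j ∈ s, ∀ k ∈ s, 1 / 2 < q j v → 1 / 2 < q k v → j = k := by
    intro v j hj k hk h1 h2
    by_contra hne
    have h3 : ∑ i ∈ {j, k}, q i v ≤ ∑ i ∈ s, q i v :=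
      Finset.sum_le_sum_of_subset_of_nonneg (by simp [Finset.insert_subset_iff, hj, hk])
        fun i hi _ => hq0 i hi v
    rw [Finset.sum_pair hne, hq] at h3
    linarith
  let L : ℕ → V → Option ι := fun m v =>
    if h : ∃ j ∈ s, t m < q j v then some h.choose else none
  have hL : ∀ m v, ∀ j ∈ s, t m < q j v → L m v = some j := by
    intro m v j hj hlt
    have h : ∃ j ∈ s, t m < q j v := ⟨j, hj, hlt⟩
    simp only [L, dif_pos h]
    have := h.choose_spec
    exact congrArg some (huniq v _ this.1 j hj ((ht1 m).trans_lt this.2) ((ht1 m).trans_lt hlt))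
  have hLne : ∀ m v w, L m v ≠ L m w → (∃ j ∈ s, q j w ≤ t m ∧ t m < q j v) ∨
      ∃ j ∈ s, q j v ≤ t m ∧ t m < q j w := by
    intro m v w hne
    by_cases h : ∃ j ∈ s, t m < q j v
    · obtain ⟨j, hj, h1⟩ := h
      refine Or.inl ⟨j, hj, ?_, h1⟩
      by_contra! h2
      exact hne ((hL m v j hj h1).trans (hL m w j hj h2).symm)
    · by_cases h' : ∃ j ∈ s, t m < q j w
      · obtain ⟨j, hj, h1⟩ := h'
        refine Or.inr ⟨j, hj, ?_, h1⟩
        by_contra! h2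
        exact h ⟨j, hj, h2⟩
      · exact absurd (by simp only [L, dif_neg h, dif_neg h']) hne
  let c : ℕ → V → V → ℝ := fun m v w => if ∃ j ∈ s, q j w ≤ t m ∧ t m < q j v then 1 else 0
  have hc0 : ∀ m v w, 0 ≤ c m v w := fun m v w => by simp only [c]; split_ifs <;> norm_num
  have hcut : ∀ m, cutSize G (L m) ≤ 2 * ∑ v, ∑ w ∈ nbrs G v, c m v w := by
    intro m
    have h1 : cutSize G (L m) ≤ ∑ v, ∑ w ∈ nbrs G v, (c m v w + c m w v) := by
      refine Finset.sum_le_sum fun v _ => Finset.sum_le_sum fun w _ => ?_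
      split_ifs with h
      · exact add_nonneg (hc0 _ _ _) (hc0 _ _ _)
      · rcases hLne m v w h with h2 | h2
        · have : c m v w = 1 := if_pos h2
          linarith [hc0 m w v]
        · have : c m w v = 1 := if_pos h2
          linarith [hc0 m v w]
    simp only [Finset.sum_add_distrib] at h1
    rw [← sum_nbrs_comm G (fun v w => c m v w)] at h1
    linarith
  have hpair : ∀ v w, ∑ m ∈ Finset.range N, c m v w ≤
      5 + 4 * N ^ 2 * ∑ j ∈ s, (q j v - q j w) ^ 2 := by
    intro v w
    have hnn : 0 ≤ ∑ j ∈ s, (q j v - q j w) ^ 2 := Finset.sum_nonneg fun _ _ => sq_nonneg _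
    by_cases h : ∃ j ∈ s, 1 / 2 < q j v ∧ q j w ≤ q j v
    · obtain ⟨j, hj, hjv, hjw⟩ := h
      have h1 : ∑ m ∈ Finset.range N, c m v w ≤ (((Finset.range N).filter fun m : ℕ =>
          4 * N * (q j w - 1 / 2) ≤ (m : ℝ) ∧ (m : ℝ) < 4 * N * (q j v - 1 / 2)).card : ℝ) := by
        rw [Finset.card_filter]
        push_cast
        refine Finset.sum_le_sum fun m _ => ?_
        by_cases h2 : ∃ k ∈ s, q k w ≤ t m ∧ t m < q k v
        · obtain ⟨k, hk, h3, h4⟩ := h2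
          obtain rfl := huniq v k hk j hj ((ht1 m).trans_lt h4) hjv
          have h5 : 4 * N * (t m - 1 / 2) = m := by
            have h6 : 4 * N * (m / (4 * N)) = (m : ℝ) := by field_simp
            simp only [ht]
            linarith
          have h6 : 4 * N * (q k w - 1 / 2) ≤ (m : ℝ) ∧ (m : ℝ) < 4 * N * (q k v - 1 / 2) := by
            rw [← h5]
            exact ⟨by gcongr, by gcongr⟩
          rw [if_pos h6]
          exact (if_pos ⟨k, hk, h3, h4⟩ : c m v w = 1).le
        · have : c m v w = 0 := if_neg h2
          rw [this]
          split_ifs <;> norm_num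
      have h2 := card_filter_range_le N (x := 4 * N * (q j w - 1 / 2))
        (y := 4 * N * (q j v - 1 / 2)) (by gcongr)
      have h3 : (q j v - q j w) ^ 2 ≤ ∑ j ∈ s, (q j v - q j w) ^ 2 :=
        Finset.single_le_sum (f := fun j => (q j v - q j w) ^ 2) (fun _ _ => sq_nonneg _) hj
      have h4 : 4 * N ^ 2 * (q j v - q j w) ^ 2 ≤ 4 * N ^ 2 * ∑ j ∈ s, (q j v - q j w) ^ 2 := by
        gcongr
      -- With x = q_j(v) - q_j(w), at most 4Nx + 1 thresholds separate the two values, and 4Nx ≤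
      -- 4N²x² + 1. The quadratic bound lets the Dirichlet energy enter.
      nlinarith [sq_nonneg (2 * N * (q j v - q j w) - 1)]
    · have : ∀ m ∈ Finset.range N, c m v w = 0 := by
        intro m _
        refine if_neg ?_
        rintro ⟨j, hj, h1, h2⟩
        exact h ⟨j, hj, (ht1 m).trans_lt h2, (h1.trans_lt h2).le⟩
      rw [Finset.sum_eq_zero this]
      positivity
  have htot : ∑ m ∈ Finset.range N, cutSize G (L m) ≤ N • (10 * d / N * (Nat.card V : ℝ) +
      8 * N * ∑ j ∈ s, dirichletEnergy G (q j)) := by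
    have h1 : ∑ m ∈ Finset.range N, cutSize G (L m) ≤
        2 * ∑ v, ∑ w ∈ nbrs G v, ∑ m ∈ Finset.range N, c m v w := by
      refine (Finset.sum_le_sum fun m _ => hcut m).trans_eq ?_
      rw [← Finset.mul_sum, Finset.sum_comm]
      congr 1
      exact Finset.sum_congr rfl fun v _ => Finset.sum_comm
    have h2 : ∑ v, ∑ w ∈ nbrs G v, ∑ m ∈ Finset.range N, c m v w ≤
        ∑ v : V, ∑ w ∈ nbrs G v, (5 + 4 * N ^ 2 * ∑ j ∈ s, (q j v - q j w) ^ 2) :=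
      Finset.sum_le_sum fun v _ => Finset.sum_le_sum fun w _ => hpair v w
    have h3 : ∑ v : V, ∑ w ∈ nbrs G v, (5 + 4 * (N : ℝ) ^ 2 * ∑ j ∈ s, (q j v - q j w) ^ 2) =
        ∑ v : V, ∑ w ∈ nbrs G v, (5 : ℝ) + 4 * N ^ 2 * ∑ j ∈ s, dirichletEnergy G (q j) := by
      simp only [Finset.sum_add_distrib, ← Finset.mul_sum, dirichletEnergy_real]
      congr 2
      rw [Finset.sum_comm]
      exact Finset.sum_congr rfl fun v _ => Finset.sum_comm
    have h4 : ∑ v : V, ∑ w ∈ nbrs G v, (5 : ℝ) ≤ 5 * d * Nat.card V := by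
      have : ∀ v : V, ∑ w ∈ nbrs G v, (5 : ℝ) ≤ 5 * d := fun v => by
        rw [Finset.sum_const, nsmul_eq_mul, mul_comm]
        have : ((nbrs G v).card : ℝ) ≤ d := by exact_mod_cast hd v
        gcongr
      refine (Finset.sum_le_card_nsmul _ _ _ fun v _ => this v).trans_eq ?_
      rw [nsmul_eq_mul, Nat.card_eq_fintype_card, Finset.card_univ, mul_comm]
    have h5 : N • (10 * d / N * (Nat.card V : ℝ) + 8 * N * ∑ j ∈ s, dirichletEnergy G (q j)) =
        2 * (5 * d * Nat.card V + 4 * N ^ 2 * ∑ j ∈ s, dirichletEnergy G (q j)) := by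
      rw [nsmul_eq_mul]
      field_simp
      ring
    rw [h5]
    linarith
  obtain ⟨m, hm, hle⟩ : ∃ m ∈ Finset.range N, cutSize G (L m) ≤
      10 * d / N * (Nat.card V : ℝ) + 8 * N * ∑ j ∈ s, dirichletEnergy G (q j) := by
    refine Finset.exists_le_of_sum_le (Finset.nonempty_range_iff.2 hN.ne') ?_
    simpa using htot
  exact ⟨L m, fun j hj v hv => hL m v j hj ((ht2 m hm).trans_lt hv), hle⟩

open Classical in
-- Diffuse the indicators of the classes long enough to make their energy tiny, then round by a
-- threshold. The distance moved is governed by the initial cut divided by c, regardless of how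
-- small the final cut must be and of how many classes there are.
theorem exists_relabelling (d : ℕ) {c : ℝ} (hc : 0 < c) {δ : ℝ} (hδ : 0 < δ) :
    ∃ ε : ℝ, 0 < ε ∧ ∀ {V : Type} [Fintype V] (G : SimpleGraph V),
      (∀ v, (nbrs G v).card ≤ d) → HasApproxGap G c ε →
      ∀ {ι : Type} (l : V → ι), ∃ l' : V → Option ι, cutSize G l' ≤ δ * Nat.card V ∧
        ((Finset.univ.filter fun v => l' v ≠ some (l v)).card : ℝ) ≤
          32 / c * cutSize G l + δ * Nat.card V := by
  -- `N` makes the first term of the rounding bound at most (δ/2)|V|. Half energy at most σ|V| does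
  -- the same for the second term; `m` is a diffusion time reaching it, and `ε` is chosen last to
  -- absorb the errors accumulated over 2m steps.
  obtain ⟨N, hN⟩ := exists_nat_gt (20 * d / δ)
  have hN0 : (0 : ℝ) < N := lt_of_le_of_lt (by positivity) hN
  have hNpos : 0 < N := by exact_mod_cast hN0
  set K : ℝ := 2 * d + 1 with hKdef
  have hK0 : 0 < K := by positivity
  set σ : ℝ := δ / (32 * N) with hσ
  have hσ0 : 0 < σ := by positivity
  obtain ⟨m, hm⟩ := exists_nat_gt (2 * (K * d) / (c * σ))
  have hm0 : (0 : ℝ) < m := lt_of_le_of_lt (by positivity) hm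
  set ε : ℝ := min (c * σ / 2) (c * δ / (32 * K⁻¹ * (m + m : ℕ))) with hε
  have hmm : (0 : ℝ) < (m + m : ℕ) := by
    push_cast
    linarith
  have hε0 : 0 < ε := by
    refine lt_min (by positivity) ?_
    positivity
  refine ⟨ε, hε0, fun {V} _ G hd hG ι l => ?_⟩
  set n : ℝ := (Nat.card V : ℝ) with hn
  have hn0 : 0 ≤ n := by positivity
  set s : Finset ι := Finset.univ.image l with hs
  have hls : ∀ v, l v ∈ s := fun v => Finset.mem_image_of_mem _ (Finset.mem_univ v)
  let g : ι → V → ℝ := fun j v => if l v = j then 1 else 0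
  have hg0 : ∀ j ∈ s, ∀ v, 0 ≤ g j v := fun j _ v => by simp only [g]; split_ifs <;> norm_num
  have hg1 : ∀ v, ∑ j ∈ s, g j v = 1 := fun v => by
    simp only [g, Finset.sum_ite_eq, hls, if_true]
  have henergy : ∑ j ∈ s, dirichletEnergy G (g j) / 2 = cutSize G l := by
    have h1 : ∑ j ∈ s, dirichletEnergy G (g j) = ∑ v, ∑ w ∈ nbrs G v,
        ∑ j ∈ s, (g j v - g j w) ^ 2 := by
      simp only [dirichletEnergy_real]
      rw [Finset.sum_comm]
      exact Finset.sum_congr rfl fun v _ => Finset.sum_comm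
    have h2 : ∀ v w, ∑ j ∈ s, (g j v - g j w) ^ 2 = 2 * if l v = l w then 0 else 1 := by
      intro v w
      have h3 : ∀ j, (g j v - g j w) ^ 2 =
          g j v + g j w - 2 * (if l v = j then (if l v = l w then 1 else 0) else 0) := by
        intro j
        simp only [g]
        by_cases h4 : l v = j
        · subst h4
          by_cases h5 : l v = l w
          · rw [if_pos rfl, if_pos h5.symm, if_pos rfl, if_pos h5]
            norm_num
          · rw [if_pos rfl, if_neg (Ne.symm h5), if_pos rfl, if_neg h5]
            norm_num
        · rw [if_neg h4, if_neg h4]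
          split_ifs <;> norm_num
      simp only [h3, Finset.sum_sub_distrib, Finset.sum_add_distrib, hg1, ← Finset.mul_sum,
        Finset.sum_ite_eq, hls, if_true]
      split_ifs <;> norm_num
    rw [← Finset.sum_div, h1]
    simp only [h2, ← Finset.mul_sum]
    rw [mul_div_assoc, mul_comm, div_mul_cancel₀ _ two_ne_zero]
    rfl
  obtain ⟨hprob, hE, hdist⟩ := hG.diffusion_estimates hd (by linarith : 2 * (d : ℝ) ≤ K) hK0 hc
    s g hg0 hg1 m
  rw [henergy] at hE hdist
  have hcut := cutSize_le hd l
  obtain ⟨-, -⟩ := hprob m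
  -- The distance estimate needs 2m steps while the energy estimate is available at m; energy
  -- decreases in between.
  have hE2 : ∀ k, k = m + m → ∑ j ∈ s, dirichletEnergy G ((diffusion G K ^ k) (g j)) ≤
      ∑ j ∈ s, dirichletEnergy G ((diffusion G K ^ m) (g j)) := by
    rintro k rfl
    have : ∀ k, ∑ j ∈ s, dirichletEnergy G ((diffusion G K ^ (k + 1)) (g j)) ≤
        ∑ j ∈ s, dirichletEnergy G ((diffusion G K ^ k) (g j)) := by
      intro k
      refine Finset.sum_le_sum fun j _ => ?_
      rw [pow_succ', Module.End.mul_apply]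
      have h1 := dirichletEnergy_diffusion_le hd (by linarith : 2 * (d : ℝ) ≤ K) hK0
        ((diffusion G K ^ k) (g j))
      have h2 : 0 ≤ K⁻¹ * ∑ v, realLaplacian G ((diffusion G K ^ k) (g j)) v ^ 2 :=
        mul_nonneg (inv_pos.2 hK0).le (Finset.sum_nonneg fun _ _ => sq_nonneg _)
      linarith
    exact antitone_nat_of_succ_le
      (f := fun k => ∑ j ∈ s, dirichletEnergy G ((diffusion G K ^ k) (g j)))
      this (Nat.le_add_left m m)
  obtain ⟨l', hl', hcut'⟩ := exists_threshold_labelling hd s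
    (fun j => (diffusion G K ^ (m + m)) (g j)) (hprob (m + m)).1 (hprob (m + m)).2 hNpos
  refine ⟨l', hcut'.trans ?_, ?_⟩
  · have h1 : 10 * d / N * n ≤ δ / 2 * n := by
      refine mul_le_mul_of_nonneg_right ?_ hn0
      rw [div_lt_iff₀ hδ] at hN
      rw [div_le_iff₀ hN0]
      linarith
    have h2 := hE2 _ rfl
    have h3 : ∑ j ∈ s, dirichletEnergy G ((diffusion G K ^ m) (g j)) ≤ 2 * (σ * n) := by
      rw [← Finset.sum_div] at hE
      set S := ∑ j ∈ s, dirichletEnergy G ((diffusion G K ^ m) (g j))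
      have h4 : K * cutSize G l ≤ m * (c * σ / 2) * n := by
        rw [div_lt_iff₀ (by positivity)] at hm
        have : K * cutSize G l ≤ K * (d * n) := by gcongr
        nlinarith
      have h5 : m * (ε * n) ≤ m * (c * σ / 2 * n) := by
        gcongr
        exact min_le_left _ _
      have h6 : m * (c * (S / 2)) ≤ m * (c * (σ * n)) := by linarith
      have h7 := le_of_mul_le_mul_left (le_of_mul_le_mul_left h6 hm0) hc
      linarith
    have h4 : 8 * N * (2 * (σ * n)) = δ / 2 * n := by
      rw [hσ]
      field_simp
      ring
    have h5 : 8 * N * ∑ j ∈ s, dirichletEnergy G ((diffusion G K ^ (m + m)) (g j)) ≤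
        8 * N * (2 * (σ * n)) := by
      gcongr
      exact h2.trans h3
    linarith
  · set q : ι → V → ℝ := fun j => (diffusion G K ^ (m + m)) (g j) with hq
    -- Where the label changes, the diffused indicator of the old class is at most 3/4 instead of 1,
    -- contributing at least 1/16 to the squared distance.
    have h1 : ((Finset.univ.filter fun v => l' v ≠ some (l v)).card : ℝ) ≤
        16 * ∑ j ∈ s, ∑ v, (g j v - q j v) ^ 2 := by
      rw [Finset.sum_comm, Finset.mul_sum, Finset.card_filter]
      push_cast
      refine Finset.sum_le_sum fun v _ => ?_
      have hnn : 0 ≤ ∑ j ∈ s, (g j v - q j v) ^ 2 := Finset.sum_nonneg fun _ _ => sq_nonneg _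
      split_ifs with h
      · have h2 : q (l v) v ≤ 3 / 4 := by
          by_contra! h3
          exact h (hl' (l v) (hls v) v h3)
        have h3 : (g (l v) v - q (l v) v) ^ 2 ≤ ∑ j ∈ s, (g j v - q j v) ^ 2 :=
          Finset.single_le_sum (f := fun j => (g j v - q j v) ^ 2) (fun _ _ => sq_nonneg _) (hls v)
        have h4 : g (l v) v = 1 := if_pos rfl
        rw [h4] at h3
        nlinarith
      · positivity
    have h2 : 2 * K⁻¹ * ((m + m : ℕ) * (ε * n)) ≤ c * (δ * n) / 16 := by
      have h3 : ε ≤ c * δ / (32 * K⁻¹ * (m + m : ℕ)) := min_le_right _ _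
      rw [le_div_iff₀ (by positivity)] at h3
      nlinarith [mul_le_mul_of_nonneg_right h3 hn0]
    have h3 : c * ∑ j ∈ s, ∑ v, (g j v - q j v) ^ 2 ≤
        c * (2 / c * cutSize G l + δ * n / 16) := by
      have : c * (2 / c * cutSize G l + δ * n / 16) = 2 * cutSize G l + c * (δ * n) / 16 := by
        field_simp
      rw [this]
      linarith
    have h4 := le_of_mul_le_mul_left h3 hc
    have h5 : 32 / c * cutSize G l = 16 * (2 / c * cutSize G l) := by ring
    linarith

end Relabel

/-! ### Edge counts and greedy partitions -/

section EdgeCount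

variable {V : Type} [Fintype V]

open Classical in
/-- The number of pairs of adjacent vertices in `A × B`. -/
noncomputable def edgeCount (G : SimpleGraph V) (A B : Finset V) : ℝ :=
  ∑ v ∈ A, ∑ w ∈ nbrs G v, if w ∈ B then 1 else 0

open Classical in
/-- The number of pairs of adjacent vertices in `A × Aᶜ` that have the same label. -/
noncomputable def innerBoundary {ι : Type*} (G : SimpleGraph V) (l : V → ι) (A : Finset V) : ℝ :=
  ∑ v ∈ A, ∑ w ∈ nbrs G v, if w ∉ A ∧ l v = l w then 1 else 0

open Classical in
/-- A set of vertices that contains at most half of each label class. -/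
def IsHalfSized {ι : Type*} (l : V → ι) (A : Finset V) : Prop :=
  ∀ j, 2 * (A.filter fun v => l v = j).card ≤ (Finset.univ.filter fun v => l v = j).card

theorem edgeCount_eq (G : SimpleGraph V) (A B : Finset V) [DecidablePred (· ∈ B)] :
    edgeCount G A B = ∑ v ∈ A, ∑ w ∈ nbrs G v, if w ∈ B then 1 else 0 := by
  unfold edgeCount
  congr!

theorem innerBoundary_eq {ι : Type*} (G : SimpleGraph V) (l : V → ι) (A : Finset V)
    [∀ v w, Decidable (w ∉ A ∧ l v = l w)] :
    innerBoundary G l A = ∑ v ∈ A, ∑ w ∈ nbrs G v, if w ∉ A ∧ l v = l w then 1 else 0 := by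
  unfold innerBoundary
  congr!

theorem isHalfSized_iff {ι : Type*} [DecidableEq ι] (l : V → ι) (A : Finset V) :
    IsHalfSized l A ↔ ∀ j,
      2 * (A.filter fun v => l v = j).card ≤ (Finset.univ.filter fun v => l v = j).card := by
  unfold IsHalfSized
  refine forall_congr' fun j => ?_
  congr!

theorem cutSize_eq {ι : Type*} [DecidableEq ι] (G : SimpleGraph V) (l : V → ι) :
    cutSize G l = ∑ v, ∑ w ∈ nbrs G v, if l v = l w then 0 else 1 := by
  unfold cutSize
  congr!

theorem IsHalfSized.mono {ι : Type*} {l : V → ι} {A B : Finset V} (hA : IsHalfSized l A)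
    (h : B ⊆ A) : IsHalfSized l B := fun j => by
  classical
  refine le_trans ?_ (hA j)
  gcongr

theorem sum_ite_nonneg {G : SimpleGraph V} (A : Finset V) (p : V → V → Prop)
    [∀ v w, Decidable (p v w)] :
    (0 : ℝ) ≤ ∑ v ∈ A, ∑ w ∈ nbrs G v, if p v w then 1 else 0 :=
  Finset.sum_nonneg fun _ _ => Finset.sum_nonneg fun _ _ => by split_ifs <;> norm_num

theorem sum_ite_le_sum_ite {G : SimpleGraph V} {A B : Finset V} {p q : V → V → Prop}
    [∀ v w, Decidable (p v w)] [∀ v w, Decidable (q v w)] (hAB : A ⊆ B)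
    (h : ∀ v ∈ A, ∀ w, p v w → q v w) :
    ∑ v ∈ A, ∑ w ∈ nbrs G v, (if p v w then (1 : ℝ) else 0) ≤
      ∑ v ∈ B, ∑ w ∈ nbrs G v, if q v w then 1 else 0 := by
  refine le_trans (Finset.sum_le_sum fun v hv => Finset.sum_le_sum fun w _ => ?_)
    (Finset.sum_le_sum_of_subset_of_nonneg hAB fun v _ _ =>
      Finset.sum_nonneg fun w _ => ?_)
  · by_cases h1 : p v w
    · rw [if_pos h1, if_pos (h v hv w h1)]
    · rw [if_neg h1]
      split_ifs <;> norm_num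
  · split_ifs <;> norm_num

theorem edgeCount_nonneg (G : SimpleGraph V) (A B : Finset V) : 0 ≤ edgeCount G A B :=
  by classical exact sum_ite_nonneg A fun _ w => w ∈ B

theorem edgeCount_mono {G : SimpleGraph V} {A A' B B' : Finset V} (hA : A ⊆ A') (hB : B ⊆ B') :
    edgeCount G A B ≤ edgeCount G A' B' :=
  by classical exact sum_ite_le_sum_ite hA fun _ _ _ h => hB h

theorem edgeCount_comm (G : SimpleGraph V) (A B : Finset V) : edgeCount G A B = edgeCount G B A := by
  classical
  have h : ∀ A B : Finset V, edgeCount G A B =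
      ∑ v, ∑ w ∈ nbrs G v, if v ∈ A ∧ w ∈ B then 1 else 0 := by
    intro A B
    rw [edgeCount, ← Finset.sum_filter_add_sum_filter_not Finset.univ (· ∈ A)]
    rw [Finset.sum_eq_zero (s := Finset.univ.filter fun v => ¬ v ∈ A), add_zero]
    · rw [Finset.filter_univ_mem]
      refine Finset.sum_congr rfl fun v hv => Finset.sum_congr rfl fun w _ => ?_
      simp [hv]
    · intro v hv
      refine Finset.sum_eq_zero fun w _ => ?_
      simp [(Finset.mem_filter.1 hv).2]
  rw [h, h, sum_nbrs_comm]
  simp only [and_comm]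

theorem edgeCount_union_le [DecidableEq V] (G : SimpleGraph V) (A A' B : Finset V) :
    edgeCount G (A ∪ A') B ≤ edgeCount G A B + edgeCount G A' B := by
  have h := Finset.sum_union_inter (s₁ := A) (s₂ := A')
    (f := fun v => ∑ w ∈ nbrs G v, if w ∈ B then (1 : ℝ) else 0)
  have h2 := edgeCount_nonneg G (A ∩ A') B
  simp only [edgeCount_eq] at h2 ⊢
  linarith

open Classical in
-- Repeatedly split off a nonempty set of least cardinality whose boundary in the remainder is at
-- most θ times its size; the whole remainder is always a candidate. Labels record the order of
-- removal. Minimality says that any smaller set in the remainder of that stage has large boundary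
-- there.
theorem exists_greedy_labelling (G : SimpleGraph V) {θ : ℝ} (hθ : 0 ≤ θ) (R : Finset V) :
    ∃ l : V → ℕ, ∀ k,
      edgeCount G (R.filter fun v => l v = k) (R.filter fun v => k < l v) ≤
        θ * (R.filter fun v => l v = k).card ∧
      ∀ D ⊆ R.filter fun v => k ≤ l v, D.Nonempty →
        D.card < (R.filter fun v => l v = k).card →
        θ * D.card < edgeCount G D ((R.filter fun v => k ≤ l v) \ D) := by
  induction R using Finset.strongInduction with
  | H R ih =>
    rcases R.eq_empty_or_nonempty with rfl | hR
    · refine ⟨fun _ => 0, fun k => ⟨by simp [edgeCount], fun D hD hne => ?_⟩⟩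
      obtain ⟨x, hx⟩ := hne
      simp at hD
      simp [hD] at hx
    · let S := R.powerset.filter fun B => B.Nonempty ∧ edgeCount G B (R \ B) ≤ θ * B.card
      have hS : S.Nonempty := by
        refine ⟨R, Finset.mem_filter.2 ⟨Finset.mem_powerset_self R, hR, ?_⟩⟩
        rw [Finset.sdiff_self]
        have : edgeCount G R ∅ = 0 := by simp [edgeCount]
        rw [this]
        positivity
      obtain ⟨B, hB, hmin⟩ := S.exists_min_image Finset.card hS
      obtain ⟨hBR, hBne, hBle⟩ := Finset.mem_filter.1 hB
      rw [Finset.mem_powerset] at hBR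
      obtain ⟨l, hl⟩ := ih (R \ B) (Finset.sdiff_ssubset hBR hBne)
      refine ⟨fun v => if v ∈ B then 0 else l v + 1, fun k => ?_⟩
      rcases k with _ | k
      · have h1 : (R.filter fun v => (if v ∈ B then 0 else l v + 1) = 0) = B := by
          ext v
          simp only [Finset.mem_filter, ite_eq_left_iff, Nat.add_eq_zero_iff, one_ne_zero, and_false,
            imp_false, not_not]
          exact ⟨fun h => h.2, fun h => ⟨hBR h, h⟩⟩
        have h2 : (R.filter fun v => 0 < (if v ∈ B then 0 else l v + 1)) = R \ B := by
          ext v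
          by_cases hv : v ∈ B <;> simp [hv]
        have h3 : (R.filter fun v => 0 ≤ (if v ∈ B then 0 else l v + 1)) = R := by simp
        rw [h1, h2, h3]
        refine ⟨hBle, fun D hD hne hlt => ?_⟩
        by_contra! hcon
        exact absurd (hmin D (Finset.mem_filter.2 ⟨Finset.mem_powerset.2 hD, hne, hcon⟩))
          (not_le.2 hlt)
      · have h1 : (R.filter fun v => (if v ∈ B then 0 else l v + 1) = k + 1) =
            (R \ B).filter fun v => l v = k := by
          ext v
          by_cases hv : v ∈ B <;> simp [hv]
        have h2 : (R.filter fun v => k + 1 < (if v ∈ B then 0 else l v + 1)) =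
            (R \ B).filter fun v => k < l v := by
          ext v
          by_cases hv : v ∈ B <;> simp [hv]
        have h3 : (R.filter fun v => k + 1 ≤ (if v ∈ B then 0 else l v + 1)) =
            (R \ B).filter fun v => k ≤ l v := by
          ext v
          by_cases hv : v ∈ B <;> simp [hv]
        rw [h1, h2, h3]
        exact hl k

open Classical in
-- Each cut edge is charged to its endpoint removed first; the factor 2 accounts for ordered pairs.
theorem cutSize_le_of_greedy (G : SimpleGraph V) {θ : ℝ} {l : V → ℕ}
    (hl : ∀ k, edgeCount G (Finset.univ.filter fun v => l v = k)
      (Finset.univ.filter fun v => k < l v) ≤ θ * (Finset.univ.filter fun v => l v = k).card) :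
    cutSize G l ≤ 2 * θ * Nat.card V := by
  have h1 : cutSize G l = ∑ v, ∑ w ∈ nbrs G v, (if l v < l w then (1 : ℝ) else 0) +
      ∑ v, ∑ w ∈ nbrs G v, (if l w < l v then (1 : ℝ) else 0) := by
    simp only [cutSize, ← Finset.sum_add_distrib]
    refine Finset.sum_congr rfl fun v _ => Finset.sum_congr rfl fun w _ => ?_
    rcases lt_trichotomy (l v) (l w) with h | h | h
    · simp [h, h.ne, h.le]
    · simp [h]
    · simp [h, h.ne', h.le]
  rw [sum_nbrs_comm G fun v w => if l w < l v then (1 : ℝ) else 0] at h1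
  have h2 : ∑ v, ∑ w ∈ nbrs G v, (if l v < l w then (1 : ℝ) else 0) ≤ θ * Nat.card V := by
    have hs : ∀ v ∈ Finset.univ, l v ∈ Finset.univ.image l :=
      fun v hv => Finset.mem_image_of_mem _ hv
    rw [← Finset.sum_fiberwise_of_maps_to hs]
    have h3 : (Nat.card V : ℝ) =
        ∑ j ∈ Finset.univ.image l, ((Finset.univ.filter fun v => l v = j).card : ℝ) := by
      rw [Nat.card_eq_fintype_card, ← Finset.card_univ, Finset.card_eq_sum_card_fiberwise hs]
      push_cast
      rfl
    rw [h3, Finset.mul_sum]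
    refine Finset.sum_le_sum fun j _ => le_trans (le_of_eq ?_) (hl j)
    refine Finset.sum_congr rfl fun v hv => Finset.sum_congr rfl fun w _ => ?_
    rw [(Finset.mem_filter.1 hv).2]
    simp
  linarith

open Classical in
-- Compare the trace of S on a class of `l'` with the greedy piece of the same label. If the trace
-- is smaller than the piece, its part with greedy label at least k expands by minimality, and the
-- rest is mislabelled. If not, being at most half of a class that exceeds the piece only by
-- mislabelled vertices, it is no larger than their number. Vertices labelled `none` are all
-- mislabelled.
theorem card_halfSized_le_of_greedy (G : SimpleGraph V) {θ : ℝ} (hθ : 0 < θ) {l : V → ℕ}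
    (hl : ∀ k, ∀ D ⊆ Finset.univ.filter fun v => k ≤ l v, D.Nonempty →
        D.card < (Finset.univ.filter fun v => l v = k).card →
        θ * D.card < edgeCount G D ((Finset.univ.filter fun v => k ≤ l v) \ D))
    (l' : V → Option ℕ) {S : Finset V} (hS : IsHalfSized l' S) :
    θ * S.card ≤ θ * (Finset.univ.filter fun v => l' v ≠ some (l v)).card + cutSize G l' +
      innerBoundary G l' S := by
  set W := Finset.univ.filter fun v => l' v ≠ some (l v) with hW
  have key : ∀ j, θ * (S.filter fun v => l' v = j).card ≤
      θ * (W.filter fun v => l' v = j).card +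
        edgeCount G (S.filter fun v => l' v = j) (S.filter fun v => l' v = j)ᶜ := by
    intro j
    have hnn := edgeCount_nonneg G (S.filter fun v => l' v = j) (S.filter fun v => l' v = j)ᶜ
    suffices h : (S.filter fun v => l' v = j).card ≤ (W.filter fun v => l' v = j).card ∨
        θ * (S.filter fun v => l' v = j).card ≤ θ * (W.filter fun v => l' v = j).card +
        edgeCount G (S.filter fun v => l' v = j) (S.filter fun v => l' v = j)ᶜ by
      rcases h with h | h
      · have : ((S.filter fun v => l' v = j).card : ℝ) ≤ (W.filter fun v => l' v = j).card := by
          exact_mod_cast h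
        nlinarith
      · exact h
    rcases j with _ | k
    · left
      refine Finset.card_le_card fun v hv => ?_
      have := (Finset.mem_filter.1 hv).2
      simp [hW, this]
    · set Sk := S.filter fun v => l' v = some k with hSk
      set P := Finset.univ.filter fun v => l v = k with hP
      rcases lt_or_ge Sk.card P.card with hlt | hge
      · right
        set D := Sk.filter fun v => k ≤ l v with hD
        have h1 : (Sk.card : ℝ) ≤ D.card + (W.filter fun v => l' v = some k).card := by
          have h2 : Sk.card = D.card + (Sk.filter fun v => ¬ k ≤ l v).card :=
            (Finset.card_filter_add_card_filter_not _).symm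
          have h3 : (Sk.filter fun v => ¬ k ≤ l v).card ≤
              (W.filter fun v => l' v = some k).card := by
            refine Finset.card_le_card fun v hv => ?_
            obtain ⟨h4, h5⟩ := Finset.mem_filter.1 hv
            have h6 := (Finset.mem_filter.1 h4).2
            simp only [hW, Finset.mem_filter, Finset.mem_univ, true_and, h6, ne_eq, and_true]
            intro h7
            have : k = l v := by simpa using h7
            omega
          exact_mod_cast h2.trans_le (by omega)
        rcases D.eq_empty_or_nonempty with h0 | hne
        · rw [h0, Finset.card_empty] at h1
          push_cast at h1
          nlinarith
        · have h2 := hl k D (fun v hv => by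
            simpa using (Finset.mem_filter.1 hv).2) hne
            ((Finset.card_le_card (Finset.filter_subset _ _)).trans_lt hlt)
          have h3 : edgeCount G D ((Finset.univ.filter fun v => k ≤ l v) \ D) ≤
              edgeCount G Sk Skᶜ := by
            refine edgeCount_mono (Finset.filter_subset _ _) fun v hv => ?_
            rw [Finset.mem_sdiff] at hv
            rw [Finset.mem_compl]
            intro h4
            exact hv.2 (Finset.mem_filter.2 ⟨h4, by simpa using hv.1⟩)
          nlinarith
      · left
        have h1 : 2 * Sk.card ≤ (Finset.univ.filter fun v => l' v = some k).card := by
          convert (isHalfSized_iff l' S).1 hS (some k)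
        have h2 : (Finset.univ.filter fun v => l' v = some k).card ≤
            P.card + (W.filter fun v => l' v = some k).card := by
          refine (Finset.card_le_card fun v hv => ?_).trans (Finset.card_union_le _ _)
          have h3 := (Finset.mem_filter.1 hv).2
          rw [Finset.mem_union]
          by_cases h4 : l v = k
          · exact Or.inl (by simp [hP, h4])
          · right
            simp only [hW, Finset.mem_filter, Finset.mem_univ, true_and, h3, ne_eq, and_true]
            intro h5
            exact h4 (by simpa using h5.symm)
        omega
  set s := Finset.univ.image l' with hs
  have hmaps : ∀ A : Finset V, ∀ v ∈ A, l' v ∈ s :=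
    fun A v _ => Finset.mem_image_of_mem _ (Finset.mem_univ v)
  have hcard : ∀ A : Finset V, (A.card : ℝ) = ∑ j ∈ s, ((A.filter fun v => l' v = j).card : ℝ) := by
    intro A
    rw [Finset.card_eq_sum_card_fiberwise (hmaps A)]
    push_cast
    rfl
  have hedge : ∑ j ∈ s, edgeCount G (S.filter fun v => l' v = j) (S.filter fun v => l' v = j)ᶜ ≤
      cutSize G l' + innerBoundary G l' S := by
    have h1 : ∀ j, edgeCount G (S.filter fun v => l' v = j) (S.filter fun v => l' v = j)ᶜ ≤
        ∑ v ∈ S.filter (fun v => l' v = j), ∑ w ∈ nbrs G v,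
          ((if l' v = l' w then (0 : ℝ) else 1) + if w ∉ S ∧ l' v = l' w then 1 else 0) := by
      intro j
      refine Finset.sum_le_sum fun v hv => Finset.sum_le_sum fun w _ => ?_
      have hv := (Finset.mem_filter.1 hv).2
      by_cases h2 : l' v = l' w
      · have h3 : l' w = j := h2.symm.trans hv
        simp [h2, h3]
      · have : (0 : ℝ) ≤ if w ∉ S ∧ l' v = l' w then 1 else 0 := by split_ifs <;> norm_num
        rw [if_neg h2]
        split_ifs <;> linarith
    refine (Finset.sum_le_sum fun j _ => h1 j).trans ?_
    rw [Finset.sum_fiberwise_of_maps_to (hmaps S)]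
    simp only [Finset.sum_add_distrib]
    rw [innerBoundary_eq, cutSize_eq]
    refine add_le_add ?_ le_rfl
    exact Finset.sum_le_sum_of_subset_of_nonneg (Finset.subset_univ _) fun _ _ _ =>
      Finset.sum_nonneg fun _ _ => by split_ifs <;> norm_num
  rw [hcard S, hcard W, Finset.mul_sum, Finset.mul_sum]
  have := Finset.sum_le_sum fun j (_ : j ∈ s) => key j
  rw [Finset.sum_add_distrib] at this
  linarith

end EdgeCount

/-! ### Weakly expanding partitions -/

section WeakExpansion

variable {V : Type} [Fintype V]

open Classical in
-- Here `b` is meant as an improved version of the indicator of A. In each class, S is the set where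
-- b is `some true` if this is at most half of the class, and its complement in the class otherwise.
-- Taking complements does not create boundary inside a class, and since A itself is at most half,
-- |A| is at most the size of its complement there, so the comparison of sizes survives.
theorem exists_halfSized_of_labelling (G : SimpleGraph V) {ι : Type*} (l : V → ι) {A : Finset V}
    (hA : IsHalfSized l A) (b : V → Option Bool) :
    ∃ S : Finset V, IsHalfSized l S ∧ innerBoundary G l S ≤ cutSize G b ∧
      A.card ≤ S.card + (Finset.univ.filter fun v => b v ≠ some (decide (v ∈ A))).card := by
  set M := Finset.univ.filter fun v => b v ≠ some (decide (v ∈ A)) with hM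
  set B := Finset.univ.filter fun v => b v = some true with hB
  let Q : ι → Finset V := fun j => Finset.univ.filter fun v => l v = j
  let small : ι → Prop := fun j => 2 * (B.filter fun v => l v = j).card ≤ (Q j).card
  set S := Finset.univ.filter fun v => (v ∈ B ↔ small (l v)) with hS
  have hS1 : ∀ j, small j → (S.filter fun v => l v = j) = B.filter fun v => l v = j := by
    intro j hj
    ext v
    simp only [hS, Finset.mem_filter, Finset.mem_univ, true_and]
    constructor
    · rintro ⟨h1, rfl⟩
      exact ⟨h1.2 hj, rfl⟩
    · rintro ⟨h1, rfl⟩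
      exact ⟨⟨fun _ => hj, fun _ => h1⟩, rfl⟩
  have hS2 : ∀ j, ¬ small j → (S.filter fun v => l v = j) = Q j \ B := by
    intro j hj
    ext v
    simp only [hS, Q, Finset.mem_filter, Finset.mem_univ, true_and, Finset.mem_sdiff]
    constructor
    · rintro ⟨h1, rfl⟩
      exact ⟨rfl, fun h => hj (h1.1 h)⟩
    · rintro ⟨rfl, h1⟩
      exact ⟨⟨fun h => absurd h h1, fun h => absurd h hj⟩, rfl⟩
  have hsub : ∀ (T : Finset V) j, (T.filter fun v => l v = j) ⊆ Q j := fun T j v hv => by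
    simp [Q, (Finset.mem_filter.1 hv).2]
  have hQB : ∀ j, (Q j \ B).card + (B.filter fun v => l v = j).card = (Q j).card := by
    intro j
    have : B.filter (fun v => l v = j) = Q j ∩ B := by
      ext v
      simp [Q, and_comm]
    rw [this, Finset.card_sdiff_add_card_inter]
  refine ⟨S, fun j => ?_, ?_, ?_⟩
  · by_cases hj : small j
    · rw [hS1 j hj]
      exact hj
    · rw [hS2 j hj]
      have h1 := hQB j
      have h2 : ¬ 2 * (B.filter fun v => l v = j).card ≤ (Q j).card := hj
      show 2 * (Q j \ B).card ≤ (Q j).card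
      omega
  · rw [innerBoundary_eq, cutSize_eq]
    refine (sum_ite_le_sum_ite (q := fun v w => ¬ b v = b w) (Finset.subset_univ S) ?_).trans_eq
      (Finset.sum_congr rfl fun v _ => Finset.sum_congr rfl fun w _ => ite_not _ _ _)
    rintro v hv w ⟨hw, hvw⟩ hbb
    have hvB : v ∈ B ↔ w ∈ B := by simp [hB, hbb]
    simp only [hS, Finset.mem_filter, Finset.mem_univ, true_and] at hv hw
    rw [hvB, hvw] at hv
    exact hw hv
  · have hcard : ∀ A : Finset V, A.card =
        ∑ j ∈ Finset.univ.image l, (A.filter fun v => l v = j).card := fun A =>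
      Finset.card_eq_sum_card_fiberwise fun v _ => Finset.mem_image_of_mem _ (Finset.mem_univ v)
    rw [hcard A, hcard S, hcard M, ← Finset.sum_add_distrib]
    refine Finset.sum_le_sum fun j _ => ?_
    by_cases hj : small j
    · rw [hS1 j hj]
      refine (Finset.card_le_card fun v hv => ?_).trans (Finset.card_union_le _ _)
      obtain ⟨h1, h2⟩ := Finset.mem_filter.1 hv
      simp only [hM, hB, Finset.mem_union, Finset.mem_filter, Finset.mem_univ, true_and, h1, h2,
        and_true, decide_true]
      exact Classical.em _
    · rw [hS2 j hj]
      have h1 : (Q j \ A).card ≤ (Q j \ B).card + (M.filter fun v => l v = j).card := by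
        refine (Finset.card_le_card fun v hv => ?_).trans (Finset.card_union_le _ _)
        obtain ⟨h1, h2⟩ := Finset.mem_sdiff.1 hv
        simp only [Finset.mem_union, Finset.mem_sdiff, h1, true_and]
        by_cases h3 : v ∈ B
        · right
          have h4 : b v = some true := (Finset.mem_filter.1 h3).2
          have h5 : l v = j := (Finset.mem_filter.1 h1).2
          simp [hM, h4, h2, h5]
        · exact Or.inl h3
      have h2 : (Q j \ A).card + (A.filter fun v => l v = j).card = (Q j).card := by
        have : A.filter (fun v => l v = j) = Q j ∩ A := by
          ext v
          simp [Q, and_comm]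
        rw [this, Finset.card_sdiff_add_card_inter]
      have h3 : 2 * (A.filter fun v => l v = j).card ≤ (Q j).card := hA j
      omega

/-- `exists_relabelling` is used twice: on the greedy partition, to obtain `l`, and on the indicator
of a hypothetical set A of small inner boundary. The second gives a half-sized set with almost no
inner boundary, whose size is controlled by the greedy property. The expansion threshold c/128 does
not depend on η, which is what later gives a gap independent of the number of lost edges. -/
theorem exists_weaklyExpanding_labelling (d : ℕ) {c : ℝ} (hc : 0 < c) {η : ℝ} (hη : 0 < η) :
    ∃ ε : ℝ, 0 < ε ∧ ∀ {V : Type} [Fintype V] (G : SimpleGraph V),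
      (∀ v, (nbrs G v).card ≤ d) → HasApproxGap G c ε →
      ∃ l : V → Option ℕ, cutSize G l ≤ η * Nat.card V ∧ ∀ A, IsHalfSized l A →
        innerBoundary G l A ≤ c / 128 * A.card → A.card ≤ η * Nat.card V := by
  classical
  set C : ℝ := 32 / c with hC
  have hC0 : 0 < C := by positivity
  -- The final bound on |A|/|V| is 4Cθ + δ(4 + 4/θ + 4C); `θ` makes the first term η/2 and then `δ`
  -- makes the second at most η/2.
  set θ : ℝ := η / (8 * C) with hθ
  have hθ0 : 0 < θ := by positivity
  set δ : ℝ := min η (η / (2 * (4 + 4 / θ + 4 * C))) with hδ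
  have hδ0 : 0 < δ := lt_min hη (by positivity)
  obtain ⟨ε, hε, H⟩ := exists_relabelling d hc hδ0
  refine ⟨ε, hε, fun {V} _ G hd hG => ?_⟩
  obtain ⟨l₀, hl₀⟩ := exists_greedy_labelling G hθ0.le Finset.univ
  obtain ⟨l, hl, hW⟩ := H G hd hG l₀
  have hcut₀ := cutSize_le_of_greedy G fun k => (hl₀ k).1
  set n : ℝ := (Nat.card V : ℝ) with hn
  have hn0 : 0 ≤ n := by positivity
  refine ⟨l, hl.trans (by gcongr; exact min_le_left _ _), fun A hA hAb => ?_⟩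
  obtain ⟨b, hb, hM⟩ := H G hd hG fun v => decide (v ∈ A)
  obtain ⟨S, hS, hSb, hAS⟩ := exists_halfSized_of_labelling G l hA b
  have hexp' := card_halfSized_le_of_greedy G hθ0 (fun k => (hl₀ k).2) l hS
  set W : ℝ := ((Finset.univ.filter fun v => l v ≠ some (l₀ v)).card : ℝ) with hWdef
  have hW' : W ≤ C * cutSize G l₀ + δ * n := by
    rw [hWdef]
    convert hW
  set m : ℝ := ((Finset.univ.filter fun v => b v ≠ some (decide (v ∈ A))).card : ℝ) with hmdef
  have hM' : m ≤ C * cutSize G (fun v => decide (v ∈ A)) + δ * n := by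
    rw [hmdef]
    convert hM
  have hexp : θ * S.card ≤ θ * W + cutSize G l + innerBoundary G l S := by
    rw [hWdef]
    convert hexp'
  -- A boundary edge of A either joins two classes of `l` or belongs to the inner boundary.
  have hcutA : cutSize G (fun v => decide (v ∈ A)) ≤
      2 * (cutSize G l + innerBoundary G l A) := by
    have h1 : cutSize G (fun v => decide (v ∈ A)) =
        ∑ v, ∑ w ∈ nbrs G v, (if v ∈ A ∧ w ∉ A then (1 : ℝ) else 0) +
        ∑ v, ∑ w ∈ nbrs G v, (if w ∈ A ∧ v ∉ A then (1 : ℝ) else 0) := by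
      rw [cutSize_eq]
      simp only [← Finset.sum_add_distrib]
      refine Finset.sum_congr rfl fun v _ => Finset.sum_congr rfl fun w _ => ?_
      by_cases h1 : v ∈ A <;> by_cases h2 : w ∈ A <;> simp [h1, h2]
    rw [sum_nbrs_comm G fun v w => if w ∈ A ∧ v ∉ A then (1 : ℝ) else 0] at h1
    have h2 : ∑ v, ∑ w ∈ nbrs G v, (if v ∈ A ∧ w ∉ A then (1 : ℝ) else 0) ≤
        cutSize G l + innerBoundary G l A := by
      have h3 : innerBoundary G l A =
          ∑ v, ∑ w ∈ nbrs G v, (if v ∈ A ∧ w ∉ A ∧ l v = l w then (1 : ℝ) else 0) := by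
        rw [innerBoundary_eq]
        refine Finset.sum_subset_zero_on_sdiff (Finset.subset_univ A) (fun v hv => ?_)
          fun v hv => ?_
        · have : v ∉ A := (Finset.mem_sdiff.1 hv).2
          simp [this]
        · simp [hv]
      rw [h3, cutSize_eq, ← Finset.sum_add_distrib]
      refine Finset.sum_le_sum fun v _ => ?_
      rw [← Finset.sum_add_distrib]
      refine Finset.sum_le_sum fun w _ => ?_
      by_cases h1 : v ∈ A <;> by_cases h2 : w ∈ A <;> by_cases h3 : l v = l w <;> simp [h1, h2, h3]
    linarith
  have hAS' : (A.card : ℝ) ≤ S.card + m := by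
    rw [hmdef]
    have : A.card ≤ S.card + (Finset.univ.filter fun v => b v ≠ some (decide (v ∈ A))).card := by
      convert hAS
    exact_mod_cast this
  set a : ℝ := (A.card : ℝ)
  -- The constant 128 = 4 · 32 is chosen so that this contribution, half of |A|, can be absorbed on
  -- the left.
  have h1 : 2 * C * (c / 128 * a) = a / 2 := by
    rw [hC]
    field_simp
    norm_num
  have h2 : a ≤ S.card + C * (2 * (cutSize G l + innerBoundary G l A)) + δ * n := by
    have := mul_le_mul_of_nonneg_left hcutA hC0.le
    linarith
  have h3 : a / 2 ≤ S.card + 2 * C * (δ * n) + δ * n := by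
    have h4 := mul_le_mul_of_nonneg_left hl (by positivity : 0 ≤ 2 * C)
    have h5 := mul_le_mul_of_nonneg_left hAb (by positivity : 0 ≤ 2 * C)
    linarith
  have h4 : (S.card : ℝ) ≤ C * (2 * θ * n) + δ * n + 2 * (δ * n) / θ := by
    have h5 : θ * (S.card : ℝ) ≤ θ * (C * (2 * θ * n) + δ * n + 2 * (δ * n) / θ) := by
      have h6 : θ * (C * (2 * θ * n) + δ * n + 2 * (δ * n) / θ) =
          θ * (C * (2 * θ * n) + δ * n) + 2 * (δ * n) := by field_simp
      have h7 := mul_le_mul_of_nonneg_left hW' hθ0.le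
      have h8 := mul_le_mul_of_nonneg_left hcut₀ (by positivity : 0 ≤ θ * C)
      linarith
    exact le_of_mul_le_mul_left h5 hθ0
  have h5 : 4 * C * θ = η / 2 := by
    rw [hθ]
    field_simp
    norm_num
  have h6 : δ * (4 + 4 / θ + 4 * C) ≤ η / 2 := by
    have : δ ≤ η / (2 * (4 + 4 / θ + 4 * C)) := min_le_right _ _
    rw [le_div_iff₀ (by positivity)] at this
    linarith
  have h7 : a ≤ 4 * C * θ * n + δ * (4 + 4 / θ + 4 * C) * n := by
    have : 2 * (δ * n) / θ = δ * n * (2 / θ) := by ring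
    have h8 : δ * (4 + 4 / θ + 4 * C) * n = 4 * (δ * n) + 2 * (δ * n * (2 / θ)) +
      4 * C * (δ * n) := by ring
    linarith
  have h8 := mul_le_mul_of_nonneg_right h6 hn0
  rw [h5] at h7
  linarith

end WeakExpansion

/-! ### From weak to genuine expansion -/

section Pruning

variable {V : Type} [Fintype V]

open Classical in
theorem innerBoundary_eq_sum (G : SimpleGraph V) {ι : Type*} (l : V → ι) (A : Finset V)
    (s : Finset ι) (hs : ∀ v ∈ A, l v ∈ s) :
    innerBoundary G l A = ∑ j ∈ s, edgeCount G (A.filter fun v => l v = j)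
      ((Finset.univ.filter fun v => l v = j) \ A.filter fun v => l v = j) := by
  rw [innerBoundary_eq, ← Finset.sum_fiberwise_of_maps_to hs]
  refine Finset.sum_congr rfl fun j _ => ?_
  refine Finset.sum_congr rfl fun v hv => Finset.sum_congr rfl fun w _ => ?_
  have hv := (Finset.mem_filter.1 hv).2
  have : (w ∉ A ∧ l v = l w) ↔
      w ∈ (Finset.univ.filter fun v => l v = j) \ A.filter fun v => l v = j := by
    simp only [Finset.mem_sdiff, Finset.mem_filter, Finset.mem_univ, true_and, hv, not_and]
    constructor
    · rintro ⟨h1, h2⟩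
      exact ⟨h2.symm, fun h3 => absurd h3 h1⟩
    · rintro ⟨h1, h2⟩
      exact ⟨fun h3 => h2 h3 h1, h1.symm⟩
  simp only [this]

open Classical in
theorem edgeCount_union_sdiff_le (G : SimpleGraph V) {A A' Q : Finset V} :
    edgeCount G (A ∪ A') (Q \ (A ∪ A')) ≤
      edgeCount G A (Q \ A) + edgeCount G A' ((Q \ A) \ A') := by
  refine (edgeCount_union_le G A A' _).trans (add_le_add ?_ ?_)
  · exact edgeCount_mono le_rfl (Finset.sdiff_subset_sdiff le_rfl Finset.subset_union_left)
  · refine edgeCount_mono le_rfl ?_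
    rw [sdiff_sdiff_left]
    rfl

open Classical in
-- Take A largest among the nonexpanding subsets of at most half of Q. If Q \ A still has a
-- nonexpanding half-sized subset A', then A ∪ A' is nonexpanding, hence by maximality more than
-- half of Q. Its complement T contains at least a quarter of Q, so T is nonexpanding with constant
-- 4β.
theorem exists_maximal_nonexpanding (G : SimpleGraph V) {β : ℝ} (hβ : 0 ≤ β) (Q : Finset V) :
    ∃ A ⊆ Q, 2 * A.card ≤ Q.card ∧ edgeCount G A (Q \ A) ≤ β * A.card ∧
      ∀ A' ⊆ Q \ A, 2 * A'.card ≤ (Q \ A).card → edgeCount G A' ((Q \ A) \ A') < β * A'.card →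
        ∃ T ⊆ Q, 2 * T.card ≤ Q.card ∧ Q.card ≤ 4 * T.card ∧
          edgeCount G T (Q \ T) ≤ 4 * β * T.card := by
  let S := Q.powerset.filter fun A => 2 * A.card ≤ Q.card ∧ edgeCount G A (Q \ A) ≤ β * A.card
  have hS : S.Nonempty := ⟨∅, Finset.mem_filter.2 ⟨Finset.empty_mem_powerset Q, by simp,
    by simp [edgeCount]⟩⟩
  obtain ⟨A, hA, hmax⟩ := S.exists_max_image Finset.card hS
  obtain ⟨hAQ, hA2, hAβ⟩ := Finset.mem_filter.1 hA
  rw [Finset.mem_powerset] at hAQ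
  refine ⟨A, hAQ, hA2, hAβ, fun A' hA' hA'2 hlt => ?_⟩
  have hdisj : Disjoint A A' := Finset.disjoint_of_subset_right hA' Finset.disjoint_sdiff
  have hcard := Finset.card_union_of_disjoint hdisj
  have hsub : A ∪ A' ⊆ Q := Finset.union_subset hAQ (hA'.trans Finset.sdiff_subset)
  have hne : A'.card ≠ 0 := by
    intro h0
    have h1 := edgeCount_nonneg G A' ((Q \ A) \ A')
    rw [h0] at hlt
    push_cast at hlt
    linarith
  have hbound : edgeCount G (A ∪ A') (Q \ (A ∪ A')) ≤ β * (A ∪ A').card := by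
    refine (edgeCount_union_sdiff_le G).trans ?_
    rw [hcard]
    push_cast
    linarith
  have hbig : Q.card < 2 * (A ∪ A').card := by
    by_contra! hle
    have := hmax _ (Finset.mem_filter.2 ⟨Finset.mem_powerset.2 hsub, hle, hbound⟩)
    omega
  have h1 := Finset.card_sdiff_add_card_eq_card hsub
  have h2 := Finset.card_sdiff_add_card_eq_card hAQ
  have h3 : Q.card ≤ 4 * (Q \ (A ∪ A')).card := by omega
  refine ⟨Q \ (A ∪ A'), Finset.sdiff_subset, by omega, h3, ?_⟩
  rw [Finset.sdiff_sdiff_eq_self hsub, edgeCount_comm]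
  refine hbound.trans ?_
  have h4 : ((A ∪ A').card : ℝ) ≤ 4 * (Q \ (A ∪ A')).card := by
    have : (A ∪ A').card ≤ 4 * (Q \ (A ∪ A')).card := (Finset.card_le_card hsub).trans h3
    exact_mod_cast this
  nlinarith

open Classical in
-- In each class remove a maximal nonexpanding set; discard entirely the classes whose remainder
-- still fails to expand. Nonexpanding sets of different classes can be united, so the hypothesis
-- bounds what is removed. Removed vertices become singleton classes, which expand vacuously.
theorem exists_expanding_labelling (G : SimpleGraph V) {d : ℕ} (hd : ∀ v, (nbrs G v).card ≤ d)
    {ι : Type} (l : V → ι) {α M : ℝ} (hα : 0 ≤ α)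
    (h : ∀ A, IsHalfSized l A → innerBoundary G l A ≤ α * A.card → A.card ≤ M) :
    ∃ (κ : Type) (m : V → κ), cutSize G m ≤ cutSize G l + 2 * d * (5 * M) ∧
      ∀ A, IsHalfSized m A → α / 4 * A.card ≤ innerBoundary G m A := by
  have hβ : 0 ≤ α / 4 := by positivity
  set s := Finset.univ.image l with hs
  have hmaps : ∀ A : Finset V, ∀ v ∈ A, l v ∈ s :=
    fun A v _ => Finset.mem_image_of_mem _ (Finset.mem_univ v)
  have hcard : ∀ A : Finset V, (A.card : ℝ) = ∑ j ∈ s, ((A.filter fun v => l v = j).card : ℝ) := by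
    intro A
    rw [Finset.card_eq_sum_card_fiberwise (hmaps A)]
    push_cast
    rfl
  let Q : ι → Finset V := fun j => Finset.univ.filter fun v => l v = j
  choose A hAQ hA2 hAβ hAT using fun j => exists_maximal_nonexpanding G hβ (Q j)
  let J : ι → Prop := fun j => ∃ A' ⊆ Q j \ A j, 2 * A'.card ≤ (Q j \ A j).card ∧
    edgeCount G A' ((Q j \ A j) \ A') < α / 4 * A'.card
  have hT : ∀ j, ∃ T ⊆ Q j, 2 * T.card ≤ (Q j).card ∧ (J j → (Q j).card ≤ 4 * T.card) ∧
      edgeCount G T (Q j \ T) ≤ α * T.card := by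
    intro j
    by_cases hj : J j
    · obtain ⟨A', h1, h2, h3⟩ := hj
      obtain ⟨T, h4, h5, h6, h7⟩ := hAT j A' h1 h2 h3
      exact ⟨T, h4, h5, fun _ => h6, h7.trans_eq (by ring)⟩
    · exact ⟨∅, Finset.empty_subset _, Nat.zero_le _, fun h => absurd h hj,
        by simp [edgeCount]⟩
  choose T hTQ hT2 hTJ hTβ using hT
  -- Inner boundaries add over classes, so the union of one nonexpanding half-sized set per class is
  -- a test set for the hypothesis.
  have hunion : ∀ B : ι → Finset V, (∀ j, B j ⊆ Q j) → (∀ j, 2 * (B j).card ≤ (Q j).card) →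
      (∀ j, edgeCount G (B j) (Q j \ B j) ≤ α * (B j).card) →
      ((Finset.univ.filter fun v => v ∈ B (l v)).card : ℝ) ≤ M := by
    intro B hBQ hB2 hBβ
    have hB : ∀ j, (Finset.univ.filter fun v => v ∈ B (l v)).filter (fun v => l v = j) = B j := by
      intro j
      ext v
      simp only [Finset.mem_filter, Finset.mem_univ, true_and]
      constructor
      · rintro ⟨h1, rfl⟩
        exact h1
      · intro h1
        have h2 : l v = j := (Finset.mem_filter.1 (hBQ j h1)).2
        exact ⟨by rwa [h2], h2⟩
    refine h _ (fun j => ?_) ?_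
    · rw [hB]
      exact hB2 j
    · rw [innerBoundary_eq_sum G l _ s (hmaps _), hcard, Finset.mul_sum]
      refine Finset.sum_le_sum fun j _ => ?_
      rw [hB]
      exact hBβ j
  set UA := Finset.univ.filter fun v => v ∈ A (l v) with hUA
  set UT := Finset.univ.filter fun v => v ∈ T (l v) with hUT
  have hUAM : (UA.card : ℝ) ≤ M := hunion A hAQ hA2 fun j => (hAβ j).trans (by
    have : (0 : ℝ) ≤ (A j).card := Nat.cast_nonneg _
    nlinarith)
  have hUTM : (UT.card : ℝ) ≤ M := hunion T hTQ hT2 hTβ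
  -- In a discarded class the set `T j` fills at least a quarter, so the discarded classes have at
  -- most 4M vertices; with the sets `A j` this gives 5M.
  set UJ := Finset.univ.filter fun v => J (l v) with hUJ
  have hUJM : (UJ.card : ℝ) ≤ 4 * M := by
    have : (UJ.card : ℝ) ≤ 4 * UT.card := by
      rw [hcard UJ, hcard UT, Finset.mul_sum]
      refine Finset.sum_le_sum fun j _ => ?_
      by_cases hj : J j
      · have h1 : (UJ.filter fun v => l v = j).card ≤ (Q j).card :=
          Finset.card_le_card fun v hv =>
            Finset.mem_filter.2 ⟨Finset.mem_univ v, (Finset.mem_filter.1 hv).2⟩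
        have h2 : (T j).card ≤ (UT.filter fun v => l v = j).card :=
          Finset.card_le_card fun v hv => by
            have h3 : l v = j := (Finset.mem_filter.1 (hTQ j hv)).2
            refine Finset.mem_filter.2 ⟨Finset.mem_filter.2 ⟨Finset.mem_univ v, ?_⟩, h3⟩
            rwa [h3]
        have h3 := hTJ j hj
        exact_mod_cast (by omega : (UJ.filter fun v => l v = j).card ≤
          4 * (UT.filter fun v => l v = j).card)
      · have h1 : UJ.filter (fun v => l v = j) = ∅ := by
          refine Finset.filter_eq_empty_iff.2 fun v hv hvj => ?_
          have := (Finset.mem_filter.1 hv).2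
          rw [hvj] at this
          exact hj this
        rw [h1, Finset.card_empty, Nat.cast_zero]
        exact mul_nonneg zero_le_four (Nat.cast_nonneg _)
    linarith
  set bad := UA ∪ UJ with hbad
  have hbadM : (bad.card : ℝ) ≤ 5 * M := by
    have : (bad.card : ℝ) ≤ UA.card + UJ.card := by exact_mod_cast Finset.card_union_le _ _
    linarith
  obtain ⟨κ, inl, inr, hinl, hinr, hne⟩ : ∃ (κ : Type) (a : ι → κ) (b : V → κ),
      Function.Injective a ∧ Function.Injective b ∧ ∀ i v, a i ≠ b v :=
    ⟨ι ⊕ V, Sum.inl, Sum.inr, Sum.inl_injective, Sum.inr_injective, by simp⟩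
  let m : V → κ := fun v => if v ∈ bad then inr v else inl (l v)
  have hm1 : ∀ v, v ∈ bad → m v = inr v := fun v hv => if_pos hv
  have hm2 : ∀ v, v ∉ bad → m v = inl (l v) := fun v hv => if_neg hv
  refine ⟨κ, m, ?_, fun S hS => ?_⟩
  · have h1 : cutSize G m ≤ cutSize G l +
        (∑ v, ∑ w ∈ nbrs G v, (if v ∈ bad then (1 : ℝ) else 0) +
          ∑ v, ∑ w ∈ nbrs G v, (if w ∈ bad then (1 : ℝ) else 0)) := by
      simp only [cutSize_eq, ← Finset.sum_add_distrib]
      refine Finset.sum_le_sum fun v _ => Finset.sum_le_sum fun w _ => ?_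
      have hite : ∀ (p : Prop) [Decidable p], (0 : ℝ) ≤ if p then 1 else 0 := fun p _ => by
        split_ifs <;> norm_num
      have hl0 : (0 : ℝ) ≤ if l v = l w then 0 else 1 := by split_ifs <;> norm_num
      have hm0 : (if m v = m w then (0 : ℝ) else 1) ≤ 1 := by split_ifs <;> norm_num
      by_cases hv : v ∈ bad
      · have := hite (w ∈ bad)
        rw [if_pos hv]
        linarith
      · by_cases hw : w ∈ bad
        · have := hite (v ∈ bad)
          rw [if_pos hw]
          linarith
        · rw [if_neg hv, if_neg hw, hm2 v hv, hm2 w hw]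
          simp only [hinl.eq_iff]
          linarith
    rw [← sum_nbrs_comm G fun v w => if v ∈ bad then (1 : ℝ) else 0] at h1
    have h2 : ∑ v, ∑ w ∈ nbrs G v, (if v ∈ bad then (1 : ℝ) else 0) ≤ d * bad.card := by
      have h3 : ∀ v, ∑ w ∈ nbrs G v, (if v ∈ bad then (1 : ℝ) else 0) ≤
          d * if v ∈ bad then (1 : ℝ) else 0 := by
        intro v
        rw [Finset.sum_const, nsmul_eq_mul]
        refine mul_le_mul_of_nonneg_right (by exact_mod_cast hd v) ?_
        split_ifs <;> norm_num
      refine (Finset.sum_le_sum fun v _ => h3 v).trans_eq ?_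
      rw [← Finset.mul_sum, Finset.sum_ite_mem, Finset.univ_inter]
      simp
    have h3 : (d : ℝ) * bad.card ≤ d * (5 * M) := by gcongr
    linarith
  · have hSbad : ∀ v ∈ S, v ∉ bad := by
      intro v hv hvb
      have h1 := hS (inr v)
      have h2 : (Finset.univ.filter fun w => m w = inr v) = {v} := by
        ext w
        simp only [Finset.mem_filter, Finset.mem_univ, true_and, Finset.mem_singleton]
        constructor
        · intro h3
          by_cases hw : w ∈ bad
          · rw [hm1 w hw] at h3
            exact hinr h3
          · rw [hm2 w hw] at h3
            exact absurd h3 (hne _ _)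
        · rintro rfl
          exact hm1 w hvb
      have h3 : 0 < (S.filter fun w => m w = inr v).card :=
        Finset.card_pos.2 ⟨v, Finset.mem_filter.2 ⟨hv, hm1 v hvb⟩⟩
      rw [h2, Finset.card_singleton] at h1
      omega
    have hmS : ∀ v ∈ S, m v = inl (l v) := fun v hv => hm2 v (hSbad v hv)
    have hms : ∀ v ∈ S, m v ∈ s.image inl := fun v hv => by
      rw [hmS v hv]
      exact Finset.mem_image_of_mem _ (hmaps S v hv)
    rw [innerBoundary_eq_sum G m S _ hms, Finset.sum_image fun _ _ _ _ h => hinl h,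
      hcard, Finset.mul_sum]
    refine Finset.sum_le_sum fun j _ => ?_
    have h1 : S.filter (fun v => m v = inl j) = S.filter fun v => l v = j := by
      refine Finset.filter_congr fun v hv => ?_
      rw [hmS v hv]
      exact hinl.eq_iff
    rw [h1]
    by_cases hj : J j
    · have : S.filter (fun v => l v = j) = ∅ := by
        refine Finset.filter_eq_empty_iff.2 fun v hv hvj => hSbad v hv ?_
        refine Finset.mem_union_right _ (Finset.mem_filter.2 ⟨Finset.mem_univ v, ?_⟩)
        rw [hvj]
        exact hj
      rw [this]
      simp [edgeCount]
    · have h2 : (Finset.univ.filter fun v => m v = inl j) = Q j \ A j := by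
        ext v
        simp only [Q, Finset.mem_filter, Finset.mem_univ, true_and, Finset.mem_sdiff]
        by_cases hv : v ∈ bad
        · rw [hm1 v hv]
          simp only [(hne _ _).symm, false_iff, not_and, not_not]
          rintro rfl
          rcases Finset.mem_union.1 hv with h3 | h3
          · exact (Finset.mem_filter.1 h3).2
          · exact absurd (Finset.mem_filter.1 h3).2 hj
        · rw [hm2 v hv, hinl.eq_iff]
          refine ⟨fun h3 => ⟨h3, fun h4 => hv ?_⟩, fun h3 => h3.1⟩
          refine Finset.mem_union_left _ (Finset.mem_filter.2 ⟨Finset.mem_univ v, ?_⟩)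
          rwa [h3]
      have h3 := hS (inl j)
      rw [h1, h2] at h3
      have h4 : S.filter (fun v => l v = j) ⊆ Q j \ A j := by
        rw [← h2, ← h1]
        exact Finset.filter_subset_filter _ (Finset.subset_univ S)
      rw [h2]
      by_contra! hcon
      exact hj ⟨_, h4, h3, hcon⟩

end Pruning

/-! ### Cheeger's inequality within classes -/

section Cheeger

variable {V : Type} [Fintype V]

open Classical in
-- The discrete coarea formula: f is a positive combination of indicators of its superlevel sets,
-- which are half-sized because its support is. The induction peels off one level at a time; the 2
-- comes from ordered pairs.
theorem sum_le_sum_abs_sub_of_expansion (H : SimpleGraph V) {κ : Type} (m : V → κ) {β : ℝ}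
    (hexp : ∀ A, IsHalfSized m A → β * A.card ≤ edgeCount H A Aᶜ) (f : V → ℝ)
    (hf : ∀ v, 0 ≤ f v) (hs : IsHalfSized m (Finset.univ.filter fun v => 0 < f v)) :
    2 * β * ∑ v, f v ≤ ∑ v, ∑ w ∈ nbrs H v, |f v - f w| := by
  induction hk : (Finset.univ.filter fun v => 0 < f v).card using Nat.strong_induction_on
    generalizing f with
  | _ k ih =>
    set A := Finset.univ.filter fun v => 0 < f v with hA
    have hA0 : ∀ v, v ∉ A → f v = 0 := fun v hv => by
      refine le_antisymm ?_ (hf v)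
      by_contra! h
      exact hv (Finset.mem_filter.2 ⟨Finset.mem_univ v, h⟩)
    rcases A.eq_empty_or_nonempty with h0 | hne
    · have : ∀ v, f v = 0 := fun v => hA0 v (by simp [h0])
      simp [this]
    · obtain ⟨a, haA, hmin⟩ := A.exists_min_image f hne
      have ha : 0 < f a := (Finset.mem_filter.1 haA).2
      -- Subtracting the least positive value on the support strictly shrinks the support and
      -- removes f(a) times its indicator.
      set g : V → ℝ := fun v => if v ∈ A then f v - f a else 0 with hg
      have hg0 : ∀ v, 0 ≤ g v := fun v => by
        simp only [hg]
        split_ifs with h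
        · linarith [hmin v h]
        · exact le_rfl
      have hsub : (Finset.univ.filter fun v => 0 < g v) ⊂ A := by
        refine Finset.ssubset_iff_of_subset (fun v hv => ?_) |>.2 ⟨a, haA, ?_⟩
        · have h1 := (Finset.mem_filter.1 hv).2
          by_contra h2
          simp only [hg, if_neg h2, lt_irrefl] at h1
        · simp [hg, haA]
      have h1 := ih _ (hk ▸ Finset.card_lt_card hsub) g hg0 (hs.mono hsub.1) rfl
      have h2 : ∑ v, f v = ∑ v, g v + f a * A.card := by
        have h3 : ∀ v, f v = g v + f a * if v ∈ A then 1 else 0 := by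
          intro v
          by_cases h : v ∈ A
          · simp [hg, h]
          · simp [hg, h, hA0 v h]
        rw [Finset.sum_congr rfl fun v _ => h3 v, Finset.sum_add_distrib, ← Finset.mul_sum]
        simp
      have h4 : ∑ v, ∑ w ∈ nbrs H v, |f v - f w| = ∑ v, ∑ w ∈ nbrs H v, |g v - g w| +
          f a * (2 * edgeCount H A Aᶜ) := by
        have h5 : ∀ v w, |f v - f w| = |g v - g w| +
            f a * ((if v ∈ A ∧ w ∈ Aᶜ then 1 else 0) + if w ∈ A ∧ v ∈ Aᶜ then 1 else 0) := by
          intro v w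
          by_cases hv : v ∈ A <;> by_cases hw : w ∈ A
          · simp [hg, hv, hw]
          · have := hmin v hv
            simp only [hg, hv, hw, hA0 w hw, if_true, if_false, Finset.mem_compl, not_false_eq_true,
              not_true, and_true, and_false, sub_zero, add_zero, mul_one]
            rw [abs_of_nonneg (hf v), abs_of_nonneg (by linarith)]
            ring
          · have := hmin w hw
            simp only [hg, hv, hw, hA0 v hv, if_true, if_false, Finset.mem_compl, not_false_eq_true,
              not_true, and_true, and_false, zero_sub, zero_add, mul_one, abs_neg]
            rw [abs_of_nonneg (hf w), abs_of_nonneg (by linarith)]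
            ring
          · simp [hg, hv, hw, hA0 v hv, hA0 w hw]
        have h6 : edgeCount H A Aᶜ =
            ∑ v, ∑ w ∈ nbrs H v, if v ∈ A ∧ w ∈ Aᶜ then 1 else 0 := by
          rw [edgeCount_eq]
          refine Finset.sum_subset_zero_on_sdiff (Finset.subset_univ A) (fun v hv => ?_)
            fun v hv => ?_
          · have : v ∉ A := (Finset.mem_sdiff.1 hv).2
            simp [this]
          · simp [hv]
        have h7 := sum_nbrs_comm H fun v w => if v ∈ A ∧ w ∈ Aᶜ then (1 : ℝ) else 0
        rw [Finset.sum_congr rfl fun v _ => Finset.sum_congr rfl fun w _ => h5 v w]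
        simp only [Finset.sum_add_distrib, mul_add, ← Finset.mul_sum]
        rw [← h7, ← h6]
        ring
      have h5 := hexp A hs
      rw [h2, h4]
      nlinarith

variable {H : SimpleGraph V} {d : ℕ} {κ : Type} {m : V → κ} {β : ℝ}

open Classical in
-- Cheeger's trick: apply the L¹ inequality to f² and factor f(v)² - f(w)².
theorem sum_sq_le_of_expansion (hd : ∀ v, (nbrs H v).card ≤ d) (hd0 : 0 < d)
    (hβ : 0 < β) (hexp : ∀ A, IsHalfSized m A → β * A.card ≤ edgeCount H A Aᶜ) (f : V → ℝ)
    (hf : ∀ v, 0 ≤ f v) (hs : IsHalfSized m (Finset.univ.filter fun v => 0 < f v)) :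
    β ^ 2 * ∑ v, f v ^ 2 ≤ d * dirichletEnergy H f := by
  have hd0' : (0 : ℝ) < d := by exact_mod_cast hd0
  have hpos : ∀ v, 0 < f v ^ 2 ↔ 0 < f v := fun v =>
    ⟨fun h => (hf v).lt_of_ne fun h0 => by simp [← h0] at h, fun h => by positivity⟩
  have h1 := sum_le_sum_abs_sub_of_expansion H m hexp (fun v => f v ^ 2) (fun v => sq_nonneg _)
    (by simpa only [hpos] using hs)
  -- Young's inequality, weighted so that the terms (f(v) + f(w))² cost at most β∑f², half of the
  -- available 2β∑f².
  have h2 : ∑ v, ∑ w ∈ nbrs H v, |f v ^ 2 - f w ^ 2| ≤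
      ∑ v, ∑ w ∈ nbrs H v, (d / β * (f v - f w) ^ 2 + β / (4 * d) * (f v + f w) ^ 2) := by
    refine Finset.sum_le_sum fun v _ => Finset.sum_le_sum fun w _ => ?_
    rw [sq_sub_sq, abs_mul, ← sq_abs (f v - f w), ← sq_abs (f v + f w)]
    have h3 : d / β * |f v - f w| ^ 2 + β / (4 * d) * |f v + f w| ^ 2 -
        |f v + f w| * |f v - f w| =
        d / β * (|f v - f w| - β / (2 * d) * |f v + f w|) ^ 2 := by
      field_simp
      ring
    have h4 : 0 ≤ d / β * (|f v - f w| - β / (2 * d) * |f v + f w|) ^ 2 := by positivity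
    linarith
  have h3 : ∑ v, ∑ w ∈ nbrs H v, (f v + f w) ^ 2 ≤ 4 * d * ∑ v, f v ^ 2 := by
    have h4 : ∑ v, ∑ w ∈ nbrs H v, (f v + f w) ^ 2 ≤
        ∑ v, ∑ w ∈ nbrs H v, 2 * f v ^ 2 + ∑ v, ∑ w ∈ nbrs H v, 2 * f w ^ 2 := by
      rw [← Finset.sum_add_distrib]
      refine Finset.sum_le_sum fun v _ => ?_
      rw [← Finset.sum_add_distrib]
      exact Finset.sum_le_sum fun w _ => by nlinarith [sq_nonneg (f v - f w)]
    have h5 := sum_nbrs_comm H fun v _ => 2 * f v ^ 2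
    have h6 : ∑ v, ∑ w ∈ nbrs H v, 2 * f v ^ 2 ≤ 2 * d * ∑ v, f v ^ 2 := by
      rw [Finset.mul_sum]
      refine Finset.sum_le_sum fun v _ => ?_
      rw [Finset.sum_const, nsmul_eq_mul]
      have : ((nbrs H v).card : ℝ) ≤ d := by exact_mod_cast hd v
      nlinarith [mul_le_mul_of_nonneg_right this (sq_nonneg (f v))]
    linarith
  simp only [Finset.sum_add_distrib, ← Finset.mul_sum] at h2
  rw [← dirichletEnergy_real] at h2
  have h4 : β / (4 * d) * ∑ v, ∑ w ∈ nbrs H v, (f v + f w) ^ 2 ≤ β * ∑ v, f v ^ 2 := by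
    calc _ ≤ β / (4 * d) * (4 * d * ∑ v, f v ^ 2) := by gcongr
      _ = _ := by field_simp
  have h5 : β * ∑ v, f v ^ 2 ≤ d / β * dirichletEnergy H f := by linarith
  have h6 := mul_le_mul_of_nonneg_left h5 hβ.le
  have h7 : β * (d / β * dirichletEnergy H f) = d * dirichletEnergy H f := by field_simp
  linarith

theorem exists_median {W : Type} (P : Finset W) (f : W → ℝ) : ∃ t : ℝ,
    2 * (P.filter fun v => t < f v).card ≤ P.card ∧
    2 * (P.filter fun v => f v < t).card ≤ P.card := by
  classical
  rcases P.eq_empty_or_nonempty with rfl | hP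
  · exact ⟨0, by simp⟩
  · set S := P.filter fun p => 2 * (P.filter fun v => f p < f v).card ≤ P.card with hS
    have hSne : S.Nonempty := by
      obtain ⟨p, hp, hmax⟩ := P.exists_max_image f hP
      refine ⟨p, Finset.mem_filter.2 ⟨hp, ?_⟩⟩
      rw [Finset.filter_eq_empty_iff.2 fun v hv => not_lt.2 (hmax v hv)]
      simp
    obtain ⟨p, hp, hmin⟩ := S.exists_min_image f hSne
    obtain ⟨hpP, hp2⟩ := Finset.mem_filter.1 hp
    refine ⟨f p, hp2, ?_⟩
    by_contra! hcon
    have hne : (P.filter fun v => f v < f p).Nonempty := by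
      rw [← Finset.card_pos]
      have := hP.card_pos
      omega
    -- The next lower value: if more than half of the values lay below f(p), then at most half lie
    -- above f(q), against minimality of p.
    obtain ⟨q, hq, hqmax⟩ := Finset.exists_max_image _ f hne
    obtain ⟨hqP, hqp⟩ := Finset.mem_filter.1 hq
    have h1 : (P.filter fun v => f q < f v).card + (P.filter fun v => f v < f p).card ≤ P.card := by
      rw [← Finset.card_union_of_disjoint]
      · exact Finset.card_le_card
          (Finset.union_subset (Finset.filter_subset _ _) (Finset.filter_subset _ _))
      · refine Finset.disjoint_left.2 fun v hv hv' => ?_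
        exact not_lt.2 (hqmax v hv') (Finset.mem_filter.1 hv).2
    have h2 : q ∈ S := Finset.mem_filter.2 ⟨hqP, by omega⟩
    exact not_lt.2 (hmin q h2) hqp

open Classical in
-- Subtract from f its median on each class. No edge joins two classes, so the differences along
-- edges are unchanged, while the positive and negative parts of the result h have half-sized
-- supports. This gives β²‖h‖² ≤ dE, where E is the energy of f. As E/2 = ⟨Δf, h⟩, Cauchy–Schwarz
-- bounds ‖Δf‖² from below. Complex functions split into real and imaginary parts.
theorem hasGraphGap_of_expansion (hd : ∀ v, (nbrs H v).card ≤ d) (hd0 : 0 < d)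
    (hm : ∀ v w, H.Adj v w → m v = m w)
    (hβ : 0 < β) (hexp : ∀ A, IsHalfSized m A → β * A.card ≤ edgeCount H A Aᶜ) :
    HasGraphGap H (β ^ 2 / (2 * d)) := by
  have hd0' : (0 : ℝ) < d := by exact_mod_cast hd0
  have hreal : ∀ f : V → ℝ, β ^ 2 / (2 * d) * (dirichletEnergy H f / 2) ≤
      ∑ v, realLaplacian H f v ^ 2 := by
    intro f
    choose t ht1 ht2 using fun j => exists_median (Finset.univ.filter fun v => m v = j) f
    set h : V → ℝ := fun v => f v - t (m v) with hh
    have hfh : ∀ v, ∀ w ∈ nbrs H v, f v - f w = h v - h w := by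
      intro v w hw
      simp only [hh, hm v w (mem_nbrs.1 hw)]
      ring
    have hpos : IsHalfSized m (Finset.univ.filter fun v => 0 < max (h v) 0) := by
      rw [isHalfSized_iff]
      refine fun j => le_trans ?_ (ht1 j)
      refine Nat.mul_le_mul_left 2 (Finset.card_le_card fun v hv => ?_)
      obtain ⟨h1, rfl⟩ := Finset.mem_filter.1 hv
      have h2 := (Finset.mem_filter.1 h1).2
      simp only [lt_max_iff, lt_irrefl, or_false, hh, sub_pos] at h2
      simpa using h2
    have hneg : IsHalfSized m (Finset.univ.filter fun v => 0 < max (-h v) 0) := by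
      rw [isHalfSized_iff]
      refine fun j => le_trans ?_ (ht2 j)
      refine Nat.mul_le_mul_left 2 (Finset.card_le_card fun v hv => ?_)
      obtain ⟨h1, rfl⟩ := Finset.mem_filter.1 hv
      have h2 := (Finset.mem_filter.1 h1).2
      simp only [lt_max_iff, lt_irrefl, or_false, hh, neg_sub, sub_pos] at h2
      simpa using h2
    have h1 := sum_sq_le_of_expansion hd hd0 hβ hexp _ (fun v => le_max_right _ _) hpos
    have h2 := sum_sq_le_of_expansion hd hd0 hβ hexp _ (fun v => le_max_right _ _) hneg
    have h3 : dirichletEnergy H (fun v => max (h v) 0) + dirichletEnergy H (fun v => max (-h v) 0) ≤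
        dirichletEnergy H f := by
      simp only [dirichletEnergy_real, ← Finset.sum_add_distrib]
      refine Finset.sum_le_sum fun v _ => Finset.sum_le_sum fun w hw => ?_
      rw [hfh v w hw]
      rcases le_total 0 (h v) with a | a <;> rcases le_total 0 (h w) with b | b
      · rw [max_eq_left a, max_eq_left b, max_eq_right (by linarith), max_eq_right (by linarith)]
        nlinarith
      · rw [max_eq_left a, max_eq_right b, max_eq_right (by linarith), max_eq_left (by linarith)]
        nlinarith [mul_nonneg a (neg_nonneg.2 b)]
      · rw [max_eq_right a, max_eq_left b, max_eq_left (by linarith), max_eq_right (by linarith)]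
        nlinarith [mul_nonneg (neg_nonneg.2 a) b]
      · rw [max_eq_right a, max_eq_right b, max_eq_left (by linarith), max_eq_left (by linarith)]
        nlinarith
    have h4 : ∑ v, h v ^ 2 = ∑ v, max (h v) 0 ^ 2 + ∑ v, max (-h v) 0 ^ 2 := by
      rw [← Finset.sum_add_distrib]
      refine Finset.sum_congr rfl fun v _ => ?_
      rcases le_total 0 (h v) with a | a
      · rw [max_eq_left a, max_eq_right (by linarith)]
        ring
      · rw [max_eq_right a, max_eq_left (by linarith)]
        ring
    have h5 : β ^ 2 * ∑ v, h v ^ 2 ≤ d * dirichletEnergy H f := by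
      rw [h4]
      have := mul_le_mul_of_nonneg_left h3 hd0'.le
      linarith
    have h6 : dirichletEnergy H f / 2 = ∑ v, realLaplacian H f v * h v := by
      have h7 := two_mul_sum_realLaplacian_mul (G := H) f h
      have h8 : ∑ v, ∑ w ∈ nbrs H v, (f v - f w) * (h v - h w) = dirichletEnergy H f := by
        rw [dirichletEnergy_real]
        refine Finset.sum_congr rfl fun v _ => Finset.sum_congr rfl fun w hw => ?_
        rw [← hfh v w hw, pow_two]
      linarith
    have h7 := Finset.sum_mul_sq_le_sq_mul_sq Finset.univ (realLaplacian H f) h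
    rw [← h6] at h7
    set E := dirichletEnergy H f
    have hE : 0 ≤ E := dirichletEnergy_nonneg H f
    have hD : 0 ≤ ∑ v, realLaplacian H f v ^ 2 := Finset.sum_nonneg fun _ _ => sq_nonneg _
    set D := ∑ v, realLaplacian H f v ^ 2
    rcases hE.eq_or_lt with h0 | h0
    · rw [← h0]
      simpa using hD
    · have h8 : β ^ 2 * (E / 2) ^ 2 ≤ D * (d * E) := by
        have := mul_le_mul_of_nonneg_left h7 (sq_nonneg β)
        have := mul_le_mul_of_nonneg_left h5 hD
        nlinarith
      have h9 : E * (β ^ 2 * E / 4) ≤ E * (D * d) := by nlinarith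
      have h10 := le_of_mul_le_mul_left h9 h0
      rw [div_mul_eq_mul_div, div_le_iff₀ (by positivity)]
      linarith
  intro f
  have h1 := hreal fun v => (f v).re
  have h2 := hreal fun v => (f v).im
  have hsq : ∀ z : ℂ, ‖z‖ ^ 2 = z.re ^ 2 + z.im ^ 2 := fun z => by
    rw [← Complex.normSq_eq_norm_sq, Complex.normSq_apply]
    ring
  have h3 : dirichletEnergy H f = dirichletEnergy H (fun v => (f v).re) +
      dirichletEnergy H (fun v => (f v).im) := by
    rw [dirichletEnergy_real, dirichletEnergy_real]
    simp only [dirichletEnergy, ← Finset.sum_add_distrib, hsq, Complex.sub_re, Complex.sub_im]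
  have h4 : ∑ v, ‖graphLaplacian H f v‖ ^ 2 = ∑ v, realLaplacian H (fun v => (f v).re) v ^ 2 +
      ∑ v, realLaplacian H (fun v => (f v).im) v ^ 2 := by
    rw [← Finset.sum_add_distrib]
    refine Finset.sum_congr rfl fun v _ => ?_
    have : graphLaplacian H f v = ∑ w ∈ nbrs H v, (f v - f w) := rfl
    rw [hsq, this, Complex.re_sum, Complex.im_sum]
    rfl
  rw [h3, h4, add_div, mul_add]
  exact add_le_add h1 h2

end Cheeger

/-! ### Spanning subgraphs with a uniform gap -/

open Classical in
-- The subgraph keeps the edges inside the classes of an expanding labelling. The order of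
-- quantifiers matters: c' is fixed before the proportion ω of lost edges.
theorem exists_spanning_subgraph_gap (d : ℕ) (hd0 : 0 < d) {c : ℝ} (hc : 0 < c) :
    ∃ c' : ℝ, 0 < c' ∧ ∀ ω : ℝ, 0 < ω → ∃ ε : ℝ, 0 < ε ∧
      ∀ {V : Type} [Fintype V] (G : SimpleGraph V),
        (∀ v, (nbrs G v).card ≤ d) → HasApproxGap G c ε →
        ∃ H ≤ G, HasGraphGap H c' ∧
          ∑ v, ((nbrs G v).card : ℝ) - ∑ v, ((nbrs H v).card : ℝ) ≤ ω * Nat.card V := by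
  refine ⟨(c / 128 / 4) ^ 2 / (2 * d), by positivity, fun ω hω => ?_⟩
  -- The cut is at most η|V| from the weakly expanding labelling plus 2d · 5η|V| from the isolated
  -- vertices.
  set η : ℝ := ω / (1 + 10 * d) with hη
  have hη0 : 0 < η := by positivity
  obtain ⟨ε, hε, hG⟩ := exists_weaklyExpanding_labelling d hc hη0
  refine ⟨ε, hε, fun {V} _ G hd hgap => ?_⟩
  obtain ⟨l, hl, hexp⟩ := hG G hd hgap
  obtain ⟨κ, m, hm, hmexp⟩ := exists_expanding_labelling G hd l (by positivity : 0 ≤ c / 128) hexp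
  let H : SimpleGraph V :=
    { Adj := fun v w => G.Adj v w ∧ m v = m w
      symm := ⟨fun v w h => ⟨h.1.symm, h.2.symm⟩⟩
      loopless := ⟨fun v h => G.loopless.irrefl v h.1⟩ }
  have hH : ∀ v w, H.Adj v w ↔ G.Adj v w ∧ m v = m w := fun _ _ => Iff.rfl
  have hnb : ∀ v, nbrs H v = (nbrs G v).filter fun w => m v = m w := fun v => by
    ext w
    simp [mem_nbrs, hH]
  refine ⟨H, fun v w h => h.1, ?_, ?_⟩
  · refine hasGraphGap_of_expansion (m := m) (fun v => ?_) hd0 (fun v w h => h.2) (by positivity)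
      fun A hA => (hmexp A hA).trans_eq ?_
    · rw [hnb]
      exact (Finset.card_filter_le _ _).trans (hd v)
    · rw [innerBoundary_eq, edgeCount_eq]
      refine Finset.sum_congr rfl fun v _ => ?_
      rw [hnb, Finset.sum_filter]
      refine Finset.sum_congr rfl fun w _ => ?_
      by_cases h1 : m v = m w <;> by_cases h2 : w ∈ A <;> simp [h1, h2]
  · have h1 : ∑ v, ((nbrs G v).card : ℝ) - ∑ v, ((nbrs H v).card : ℝ) = cutSize G m := by
      rw [cutSize_eq, ← Finset.sum_sub_distrib]
      refine Finset.sum_congr rfl fun v _ => ?_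
      rw [hnb, Finset.card_filter, Finset.card_eq_sum_ones]
      push_cast
      rw [← Finset.sum_sub_distrib]
      refine Finset.sum_congr rfl fun w _ => ?_
      by_cases h : m v = m w <;> simp [h]
    rw [h1]
    have h2 : ω = η * (1 + 10 * d) := by
      rw [hη]
      field_simp
    refine hm.trans ?_
    rw [h2]
    linarith

theorem sum_card_nbrs {V : Type} [Fintype V] (G : SimpleGraph V) :
    ∑ v, ((nbrs G v).card : ℝ) = 2 * (G.edgeSet.ncard : ℝ) := by
  classical
  have h := G.sum_degrees_eq_twice_card_edges
  have h1 : ∀ v, (nbrs G v).card = G.degree v := fun v => by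
    rw [← SimpleGraph.card_neighborFinset_eq_degree]
    congr 1
    ext w
    simp [mem_nbrs]
  have h2 : G.edgeSet.ncard = G.edgeFinset.card := by
    rw [← Set.ncard_coe_finset, SimpleGraph.coe_edgeFinset]
  rw [h2]
  simp only [h1]
  exact_mod_cast h

theorem hasGraphGap_bot {V : Type} [Fintype V] (c : ℝ) : HasGraphGap (⊥ : SimpleGraph V) c := by
  intro f
  have h : ∀ v, nbrs (⊥ : SimpleGraph V) v = ∅ := fun v => by
    ext w
    simp [mem_nbrs]
  simp only [dirichletEnergy, h, Finset.sum_empty, Finset.sum_const_zero, zero_div, mul_zero]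
  exact Finset.sum_nonneg fun _ _ => by positivity

/-- A choice made without reference to ω that loses no more edges than any competitor, so it serves
all ω simultaneously and replaces a diagonal argument. The edgeless graph shows that there is a
competitor. -/
theorem exists_max_spanning_subgraph_gap {V : Type} [Fintype V] (G : SimpleGraph V) (c : ℝ) :
    ∃ H ≤ G, HasGraphGap H c ∧
      ∀ H' ≤ G, HasGraphGap H' c → H'.edgeSet.ncard ≤ H.edgeSet.ncard := by
  obtain ⟨H, hH, hmax⟩ := Set.exists_max_image {H : SimpleGraph V | H ≤ G ∧ HasGraphGap H c}
    (fun H => H.edgeSet.ncard) (Set.toFinite _) ⟨⊥, bot_le, hasGraphGap_bot c⟩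
  exact ⟨H, hH.1, hH.2, fun H' h1 h2 => hmax H' ⟨h1, h2⟩⟩

namespace BoxSpace

variable (X : BoxSpace)

/-- The box space of spanning subgraphs of the graphs of a box space. -/
def spanning (H : ∀ i, SimpleGraph (X.V i)) (hH : ∀ i, H i ≤ X.graph i) : BoxSpace where
  V := X.V
  fintype := X.fintype
  graph := H
  exists_degree_le := by
    obtain ⟨d, hd⟩ := X.exists_degree_le
    exact ⟨d, fun i v => (Set.ncard_le_ncard (fun w hw => hH i hw) (Set.toFinite _)).trans (hd i v)⟩
  tendsto_card := X.tendsto_card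

theorem tendsto_natCast_card :
    Tendsto (fun i => (Nat.card (X.V i) : ℝ)) atTop atTop :=
  tendsto_natCast_atTop_atTop.comp X.tendsto_card

/-- The loss of edges is small compared with the number of vertices; edge density is what makes it
small compared with the number of edges. -/
theorem approximatelyIsomorphic_spanning (H : ∀ i, SimpleGraph (X.V i))
    (hH : ∀ i, H i ≤ X.graph i) (hX : X.HasPositiveEdgeDensity)
    (hω : ∀ ω : ℝ, 0 < ω → ∀ᶠ i in atTop,
      ((X.graph i).edgeSet.ncard : ℝ) - (H i).edgeSet.ncard ≤ ω * Nat.card (X.V i)) :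
    X.ApproximatelyIsomorphic (X.spanning H hH) := by
  obtain ⟨κ, hκ, hκX⟩ := hX
  have hpos : ∀ᶠ i in atTop, (0 : ℝ) < Nat.card (X.V i) :=
    X.tendsto_natCast_card.eventually_gt_atTop 0
  have hlim : Tendsto (fun i => ((H i).edgeSet.ncard : ℝ) / (X.graph i).edgeSet.ncard)
      atTop (𝓝 1) := by
    rw [Metric.tendsto_nhds]
    intro ε hε
    filter_upwards [hpos, hκX, hω (κ * ε / 2) (by positivity)] with i hn hE hr
    have hE0 : (0 : ℝ) < (X.graph i).edgeSet.ncard := lt_of_lt_of_le (by positivity) hE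
    have hle : ((H i).edgeSet.ncard : ℝ) ≤ (X.graph i).edgeSet.ncard := by
      exact_mod_cast Set.ncard_le_ncard (SimpleGraph.edgeSet_mono (hH i)) (Set.toFinite _)
    rw [Real.dist_eq, div_sub_one hE0.ne', abs_div, abs_of_pos hE0, div_lt_iff₀ hE0,
      abs_sub_comm, abs_of_nonneg (sub_nonneg.2 hle)]
    nlinarith [mul_pos hε hE0]
  have hvert : Tendsto (fun i => ((Set.univ : Set (X.V i)).ncard : ℝ) / Nat.card (X.V i))
      atTop (𝓝 1) := by
    refine tendsto_const_nhds.congr' ?_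
    filter_upwards [hpos] with i hn
    rw [Set.ncard_univ, div_self hn.ne']
  refine ⟨fun i => SimpleGraph.toSubgraph (H i) (hH i), fun i => ⊤,
    fun i => ⟨⟨Equiv.refl _, Iff.rfl⟩⟩, hvert, hvert, ?_, ?_⟩
  · refine hlim.congr fun i => ?_
    congr 3
  · refine tendsto_const_nhds.congr' ?_
    filter_upwards [hlim.eventually (lt_mem_nhds one_pos)] with i hi
    have h1 : ((H i).edgeSet.ncard : ℝ) ≠ 0 := fun h0 => by
      rw [h0, zero_div] at hi
      exact lt_irrefl _ hi
    have h2 : (⊤ : (H i).Subgraph).edgeSet = (H i).edgeSet := SimpleGraph.Subgraph.edgeSet_top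
    exact (show ((⊤ : (H i).Subgraph).edgeSet.ncard : ℝ) / (H i).edgeSet.ncard = 1 by
      rw [h2, div_self h1]).symm

theorem HasUltraproductSpectralGap.exists_approximatelyIsomorphic {X : BoxSpace}
    (h : X.HasUltraproductSpectralGap) (hX : X.HasPositiveEdgeDensity) :
    ∃ X' : BoxSpace, X'.IsExpander ∧ X.ApproximatelyIsomorphic X' := by
  obtain ⟨c, hc, hgap⟩ := h
  -- The degree bound is raised by one because it has to be positive.
  obtain ⟨c', hc', hsub⟩ := exists_spanning_subgraph_gap (X.degBound + 1) (Nat.succ_pos _) hc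
  choose H hH hHgap hHmax using fun i => exists_max_spanning_subgraph_gap (X.graph i) c'
  refine ⟨X.spanning H hH, (isExpander_iff _).2 ⟨c', hc', hHgap⟩,
    X.approximatelyIsomorphic_spanning H hH hX fun ω hω => ?_⟩
  obtain ⟨ε, hε, hεsub⟩ := hsub ω hω
  filter_upwards [HasUltraproductSpectralGap.eventually_hasApproxGap X hc hgap hε] with i hi
  obtain ⟨H', hH', hgap', hcard⟩ := hεsub (X.graph i)
    (fun v => (X.card_nbrs_le i v).trans (Nat.le_succ _)) hi
  rw [sum_card_nbrs, sum_card_nbrs] at hcard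
  have h1 : (H'.edgeSet.ncard : ℝ) ≤ (H i).edgeSet.ncard := by exact_mod_cast hHmax i H' hH' hgap'
  have h2 : (0 : ℝ) ≤ ω * Nat.card (X.V i) := by positivity
  linarith

end BoxSpace

/-! ### Stability of the gap under approximate isomorphism -/

section Comparison

variable {V : Type} [Fintype V]

theorem graphLaplacian_congr {G H : SimpleGraph V} {v : V} (h : nbrs G v = nbrs H v) (f : V → ℂ) :
    graphLaplacian G f v = graphLaplacian H f v := by
  show ∑ w ∈ nbrs G v, (f v - f w) = ∑ w ∈ nbrs H v, (f v - f w)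
  rw [h]

theorem nbrs_subset_nbrs {G H : SimpleGraph V} (h : H ≤ G) (v : V) : nbrs H v ⊆ nbrs G v :=
  fun _ hw => mem_nbrs.2 (h (mem_nbrs.1 hw))

/-- The vertices with different neighbourhoods in G and H number at most the total degree lost,
twice the number of lost edges. T consists of them and their G-neighbours; all differences between
energies and Laplacians come from values of f on T. -/
theorem exists_comparison_set {G H : SimpleGraph V} (hHG : H ≤ G) {d : ℕ}
    (hd : ∀ v, (nbrs G v).card ≤ d) :
    ∃ T : Finset V, (T.card : ℝ) ≤
        (d + 1) * (2 * ((G.edgeSet.ncard : ℝ) - H.edgeSet.ncard)) ∧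
      ∀ f : V → ℂ,
        dirichletEnergy H f ≤ dirichletEnergy G f ∧
        dirichletEnergy G f ≤ dirichletEnergy H f + 4 * d ^ 2 * ∑ v ∈ T, ‖f v‖ ^ 2 ∧
        ∑ v, ‖graphLaplacian G f v‖ ^ 2 ≤
          ∑ v, ‖graphLaplacian H f v‖ ^ 2 + 4 * d ^ 2 * ∑ v ∈ T, ‖f v‖ ^ 2 ∧
        ∑ v, ‖graphLaplacian H f v‖ ^ 2 ≤
          ∑ v, ‖graphLaplacian G f v‖ ^ 2 + 4 * d ^ 2 * ∑ v ∈ T, ‖f v‖ ^ 2 := by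
  classical
  have hdH : ∀ v, (nbrs H v).card ≤ d := fun v =>
    (Finset.card_le_card (nbrs_subset_nbrs hHG v)).trans (hd v)
  set B : Finset V := Finset.univ.filter fun v => nbrs G v ≠ nbrs H v with hB
  have hBmem : ∀ v, v ∉ B → nbrs G v = nbrs H v := fun v hv => by
    simpa [hB] using hv
  have hBcard : (B.card : ℝ) ≤ 2 * ((G.edgeSet.ncard : ℝ) - H.edgeSet.ncard) := by
    have h1 := sum_card_nbrs G
    have h2 := sum_card_nbrs H
    have h3 : (B.card : ℝ) ≤ ∑ v, (((nbrs G v).card : ℝ) - (nbrs H v).card) := by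
      rw [Finset.card_filter]
      push_cast
      refine Finset.sum_le_sum fun v _ => ?_
      split_ifs with h
      · have h4 : (nbrs H v).card + 1 ≤ (nbrs G v).card :=
          Finset.card_lt_card ((nbrs_subset_nbrs hHG v).ssubset_of_ne (Ne.symm h))
        have h5 : ((nbrs H v).card : ℝ) + 1 ≤ (nbrs G v).card := by exact_mod_cast h4
        linarith
      · rw [sub_nonneg]
        exact_mod_cast Finset.card_le_card (nbrs_subset_nbrs hHG v)
    rw [Finset.sum_sub_distrib] at h3
    linarith
  have hsum0 : ∀ (f : V → ℂ) (S : Finset V), 0 ≤ ∑ v ∈ S, ‖f v‖ ^ 2 :=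
    fun f S => Finset.sum_nonneg fun _ _ => by positivity
  have hlap : ∀ K : SimpleGraph V, K ≤ G → ∀ f : V → ℂ, ∑ v ∈ B, ‖graphLaplacian K f v‖ ^ 2 ≤
      4 * d ^ 2 * ∑ v ∈ B ∪ B.biUnion (nbrs G), ‖f v‖ ^ 2 := by
    intro K hK f
    refine (sum_sq_graphLaplacian_le K (fun v =>
      (Finset.card_le_card (nbrs_subset_nbrs hK v)).trans (hd v)) f B).trans ?_
    have h1 : ∑ v ∈ B, ‖f v‖ ^ 2 ≤ ∑ v ∈ B ∪ B.biUnion (nbrs G), ‖f v‖ ^ 2 :=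
      Finset.sum_le_sum_of_subset_of_nonneg Finset.subset_union_left fun _ _ _ => by positivity
    have h2 : ∑ v ∈ B.biUnion (nbrs K), ‖f v‖ ^ 2 ≤ ∑ v ∈ B ∪ B.biUnion (nbrs G), ‖f v‖ ^ 2 := by
      refine Finset.sum_le_sum_of_subset_of_nonneg ?_ fun _ _ _ => by positivity
      exact (Finset.biUnion_mono fun v _ => nbrs_subset_nbrs hK v).trans Finset.subset_union_right
    nlinarith [sq_nonneg (d : ℝ)]
  have hdiff : ∀ K L : SimpleGraph V, K ≤ G → (∀ v, v ∉ B → nbrs K v = nbrs L v) → ∀ f : V → ℂ,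
      ∑ v, ‖graphLaplacian K f v‖ ^ 2 ≤ ∑ v, ‖graphLaplacian L f v‖ ^ 2 +
        4 * d ^ 2 * ∑ v ∈ B ∪ B.biUnion (nbrs G), ‖f v‖ ^ 2 := by
    intro K L hK hKL f
    rw [← Finset.sum_add_sum_compl B, ← Finset.sum_add_sum_compl B
      (fun v => ‖graphLaplacian L f v‖ ^ 2)]
    have h1 : ∑ v ∈ Bᶜ, ‖graphLaplacian K f v‖ ^ 2 = ∑ v ∈ Bᶜ, ‖graphLaplacian L f v‖ ^ 2 :=
      Finset.sum_congr rfl fun v hv => by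
        rw [graphLaplacian_congr (hKL v (Finset.mem_compl.1 hv))]
    have h2 : 0 ≤ ∑ v ∈ B, ‖graphLaplacian L f v‖ ^ 2 :=
      Finset.sum_nonneg fun _ _ => by positivity
    have := hlap K hK f
    linarith
  refine ⟨B ∪ B.biUnion (nbrs G), ?_, fun f => ⟨?_, ?_, ?_, ?_⟩⟩
  · have h1 : (B ∪ B.biUnion (nbrs G)).card ≤ B.card + B.card * d :=
      (Finset.card_union_le _ _).trans
        (Nat.add_le_add_left (Finset.card_biUnion_le_card_mul _ _ _ fun v _ => hd v) _)
    have h2 : ((B ∪ B.biUnion (nbrs G)).card : ℝ) ≤ B.card + B.card * d := by exact_mod_cast h1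
    calc _ ≤ ((d : ℝ) + 1) * B.card := by linarith
      _ ≤ _ := by gcongr
  · exact Finset.sum_le_sum fun v _ => Finset.sum_le_sum_of_subset_of_nonneg
      (nbrs_subset_nbrs hHG v) fun _ _ _ => by positivity
  · set T := B ∪ B.biUnion (nbrs G) with hT
    have h1 : ∀ v, ∑ w ∈ nbrs G v, ‖f v - f w‖ ^ 2 ≤ ∑ w ∈ nbrs H v, ‖f v - f w‖ ^ 2 +
        ∑ w ∈ nbrs G v, ((if v ∈ T then 2 * ‖f v‖ ^ 2 else 0) +
          if w ∈ T then 2 * ‖f w‖ ^ 2 else 0) := by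
      intro v
      have hnn : ∀ w, 0 ≤ (if v ∈ T then 2 * ‖f v‖ ^ 2 else 0) +
          (if w ∈ T then 2 * ‖f w‖ ^ 2 else 0) := fun w => by
        split_ifs <;> positivity
      by_cases hv : v ∈ B
      · have h2 : ∑ w ∈ nbrs G v, ‖f v - f w‖ ^ 2 ≤ ∑ w ∈ nbrs G v,
            ((if v ∈ T then 2 * ‖f v‖ ^ 2 else 0) + if w ∈ T then 2 * ‖f w‖ ^ 2 else 0) := by
          refine Finset.sum_le_sum fun w hw => ?_
          rw [if_pos (Finset.mem_union_left _ hv),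
            if_pos (Finset.mem_union_right _ (Finset.mem_biUnion.2 ⟨v, hv, hw⟩))]
          have := norm_sub_le (f v) (f w)
          nlinarith [sq_nonneg (‖f v‖ - ‖f w‖), norm_nonneg (f v - f w)]
        refine h2.trans (le_add_of_nonneg_left (Finset.sum_nonneg fun _ _ => by positivity))
      · rw [hBmem v hv]
        exact le_add_of_nonneg_right (Finset.sum_nonneg fun w _ => hnn w)
    have hsingle : ∑ v, ∑ w ∈ nbrs G v, (if v ∈ T then 2 * ‖f v‖ ^ 2 else 0) ≤
        2 * d * ∑ v ∈ T, ‖f v‖ ^ 2 := by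
      rw [Finset.mul_sum, ← Finset.sum_filter_add_sum_filter_not Finset.univ (· ∈ T)]
      rw [Finset.sum_eq_zero (s := Finset.univ.filter (¬ · ∈ T)) fun v hv => by
        simp [(Finset.mem_filter.1 hv).2], add_zero,
        show Finset.univ.filter (· ∈ T) = T by ext; simp]
      refine Finset.sum_le_sum fun v hv => ?_
      rw [if_pos hv, Finset.sum_const, nsmul_eq_mul]
      have : ((nbrs G v).card : ℝ) ≤ d := by exact_mod_cast hd v
      nlinarith [sq_nonneg ‖f v‖]
    have h3 : dirichletEnergy G f ≤ dirichletEnergy H f + 4 * d * ∑ v ∈ T, ‖f v‖ ^ 2 := by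
      refine (Finset.sum_le_sum fun v _ => h1 v).trans ?_
      rw [Finset.sum_add_distrib]
      simp only [Finset.sum_add_distrib (s := nbrs G _)]
      rw [Finset.sum_add_distrib, sum_nbrs_comm G fun _ w => if w ∈ T then 2 * ‖f w‖ ^ 2 else 0]
      have : dirichletEnergy H f = ∑ v, ∑ w ∈ nbrs H v, ‖f v - f w‖ ^ 2 := rfl
      linarith
    -- True because d is a natural number; it permits the same coefficient 4d² in all the estimates.
    have h4 : (d : ℝ) ≤ d ^ 2 := by exact_mod_cast Nat.le_self_pow two_ne_zero d
    nlinarith [hsum0 f T]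
  · exact hdiff G H le_rfl hBmem f
  · exact hdiff H G hHG (fun v hv => (hBmem v hv).symm) f

end Comparison

section Map

variable {W V : Type} [Fintype W] [Fintype V] (J : SimpleGraph W) (φ : W ↪ V)

theorem nbrs_map (a : W) : nbrs (J.map φ) (φ a) = (nbrs J a).map φ := by
  ext w
  simp only [mem_nbrs, SimpleGraph.map_adj, Finset.mem_map]
  constructor
  · rintro ⟨x, y, h, hx, rfl⟩
    rw [φ.injective hx] at h
    exact ⟨y, h, rfl⟩
  · rintro ⟨y, h, rfl⟩
    exact ⟨a, y, h, rfl, rfl⟩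

omit [Fintype W] in
theorem nbrs_map_of_notMem {v : V} (hv : v ∉ Set.range φ) : nbrs (J.map φ) v = ∅ := by
  refine Finset.eq_empty_of_forall_notMem fun w hw => ?_
  obtain ⟨x, y, h, rfl, rfl⟩ := (SimpleGraph.map_adj φ J _ _).1 (mem_nbrs.1 hw)
  exact hv ⟨x, rfl⟩

theorem dirichletEnergy_map (f : V → ℂ) :
    dirichletEnergy (J.map φ) f = dirichletEnergy J (f ∘ φ) := by
  refine (Fintype.sum_of_injective φ φ.injective _ _ (fun v hv => ?_) fun a => ?_).symm
  · rw [nbrs_map_of_notMem J φ hv, Finset.sum_empty]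
  · rw [nbrs_map, Finset.sum_map]
    rfl

theorem sum_sq_graphLaplacian_map (f : V → ℂ) :
    ∑ v, ‖graphLaplacian (J.map φ) f v‖ ^ 2 = ∑ a, ‖graphLaplacian J (f ∘ φ) a‖ ^ 2 := by
  refine (Fintype.sum_of_injective φ φ.injective _ _ (fun v hv => ?_) fun a => ?_).symm
  · have : graphLaplacian (J.map φ) f v = ∑ w ∈ nbrs (J.map φ) v, (f v - f w) := rfl
    rw [this, nbrs_map_of_notMem J φ hv]
    simp
  · have : graphLaplacian (J.map φ) f (φ a) = ∑ w ∈ nbrs (J.map φ) (φ a), (f (φ a) - f w) := rfl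
    rw [this, nbrs_map, Finset.sum_map]
    rfl

end Map

/-- The graphs G and G' share the subgraph J. Transport f to V' through J, extended by zero, apply
the gap of G' there, and compare G and G' each with its copy of J. The error set in V' is pulled
back to V, so only values of f itself occur. -/
theorem HasGraphGap.exists_gap_le_of_map {W V V' : Type} [Fintype W] [Fintype V] [Fintype V']
    {G : SimpleGraph V} {G' : SimpleGraph V'} {J : SimpleGraph W} {φ : W ↪ V} {φ' : W ↪ V'}
    (hG : J.map φ ≤ G) (hG' : J.map φ' ≤ G') {d : ℕ} (hd : ∀ v, (nbrs G v).card ≤ d)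
    (hd' : ∀ v, (nbrs G' v).card ≤ d) {c : ℝ} (hc : 0 < c) (hgap : HasGraphGap G' c)
    (f : V → ℂ) : ∃ T T' : Finset V,
      (T.card : ℝ) ≤ (d + 1) * (2 * ((G.edgeSet.ncard : ℝ) - (J.map φ).edgeSet.ncard)) ∧
      (T'.card : ℝ) ≤ (d + 1) * (2 * ((G'.edgeSet.ncard : ℝ) - (J.map φ').edgeSet.ncard)) ∧
      c * (dirichletEnergy G f / 2) ≤ ∑ v, ‖graphLaplacian G f v‖ ^ 2 +
        (4 * d ^ 2 * (c + 1)) * (∑ v ∈ T, ‖f v‖ ^ 2 + ∑ v ∈ T', ‖f v‖ ^ 2) := by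
  classical
  obtain ⟨T, hT, h⟩ := exists_comparison_set hG hd
  obtain ⟨S, hS, h'⟩ := exists_comparison_set hG' hd'
  set g : V' → ℂ := Function.extend φ' (f ∘ φ) 0 with hg
  have hgφ : g ∘ φ' = f ∘ φ := Function.extend_comp φ'.injective _ _
  set A : Finset W := Finset.univ.filter fun a => φ' a ∈ S with hA
  have hsum : ∑ v ∈ S, ‖g v‖ ^ 2 = ∑ v ∈ A.map φ, ‖f v‖ ^ 2 := by
    rw [Finset.sum_map, hA, Finset.sum_filter, ← Finset.univ_inter S, ← Finset.sum_ite_mem]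
    refine (Fintype.sum_of_injective φ' φ'.injective _ _ (fun v hv => ?_) fun a => ?_).symm
    · have : g v = 0 := Function.extend_apply' _ _ _ hv
      simp [this]
    · have : g (φ' a) = f (φ a) := congrFun hgφ a
      simp [this]
  refine ⟨T, A.map φ, hT, le_trans ?_ hS, ?_⟩
  · rw [Finset.card_map, ← Finset.card_map φ']
    refine Nat.cast_le.2 (Finset.card_le_card fun v hv => ?_)
    obtain ⟨a, ha, rfl⟩ := Finset.mem_map.1 hv
    exact (Finset.mem_filter.1 ha).2
  · obtain ⟨-, h1, -, h2⟩ := h f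
    obtain ⟨h3, -, h4, -⟩ := h' g
    rw [dirichletEnergy_map] at h1 h3
    rw [sum_sq_graphLaplacian_map] at h2 h4
    rw [hgφ] at h3 h4
    rw [hsum] at h4
    have h5 := hgap g
    have h6 : 0 ≤ ∑ v ∈ T, ‖f v‖ ^ 2 := Finset.sum_nonneg fun _ _ => by positivity
    have h7 : 0 ≤ ∑ v ∈ A.map φ, ‖f v‖ ^ 2 := Finset.sum_nonneg fun _ _ => by positivity
    have h8 : c * (dirichletEnergy G f / 2) ≤
        c * (dirichletEnergy G' g / 2) + c * (4 * d ^ 2 * ∑ v ∈ T, ‖f v‖ ^ 2) := by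
      have h9 : dirichletEnergy G f ≤ dirichletEnergy G' g + 4 * d ^ 2 * ∑ v ∈ T, ‖f v‖ ^ 2 := by
        linarith
      have h10 : 0 ≤ 4 * (d : ℝ) ^ 2 * ∑ v ∈ T, ‖f v‖ ^ 2 := by positivity
      nlinarith
    have h11 : 0 ≤ c * (4 * (d : ℝ) ^ 2 * ∑ v ∈ A.map φ, ‖f v‖ ^ 2) := by positivity
    calc c * (dirichletEnergy G f / 2)
        ≤ ∑ v, ‖graphLaplacian G f v‖ ^ 2 + 4 * d ^ 2 * ∑ v ∈ T, ‖f v‖ ^ 2 +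
          4 * d ^ 2 * ∑ v ∈ A.map φ, ‖f v‖ ^ 2 + c * (4 * d ^ 2 * ∑ v ∈ T, ‖f v‖ ^ 2) := by
          linarith
      _ ≤ _ := by linarith

namespace BoxSpace

theorem ncard_edgeSet_le (X : BoxSpace) {d : ℕ} (hd : ∀ i v, (nbrs (X.graph i) v).card ≤ d)
    (i : ℕ) : ((X.graph i).edgeSet.ncard : ℝ) ≤ d * Nat.card (X.V i) := by
  have h1 := sum_card_nbrs (X.graph i)
  have h2 : ∑ v, ((nbrs (X.graph i) v).card : ℝ) ≤ ∑ _v : X.V i, (d : ℝ) :=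
    Finset.sum_le_sum fun v _ => by exact_mod_cast hd i v
  rw [Finset.sum_const, nsmul_eq_mul, Finset.card_univ, ← Nat.card_eq_fintype_card] at h2
  have h3 : (0 : ℝ) ≤ (X.graph i).edgeSet.ncard := Nat.cast_nonneg _
  linarith

theorem eventually_ncard_edgeSet_sub_le (X : BoxSpace) (E : ℕ → ℕ)
    (hE : Tendsto (fun i => (E i : ℝ) / (X.graph i).edgeSet.ncard) atTop (𝓝 1)) {δ : ℝ}
    (hδ : 0 < δ) : ∀ᶠ i in atTop,
      ((X.graph i).edgeSet.ncard : ℝ) - E i ≤ δ * Nat.card (X.V i) := by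
  set d := X.degBound
  have h1 : (1 : ℝ) - δ / (d + 1) < 1 := by
    have : 0 < δ / ((d : ℝ) + 1) := by positivity
    linarith
  filter_upwards [hE.eventually (lt_mem_nhds h1), hE.eventually (lt_mem_nhds one_pos)] with i hi h0
  have hpos : (0 : ℝ) < (X.graph i).edgeSet.ncard := by
    -- With no edges the quotient would be 0 by convention, so a quotient near 1 forces edges to
    -- exist.
    refine lt_of_le_of_ne (Nat.cast_nonneg _) fun h => ?_
    rw [← h, div_zero] at h0
    exact lt_irrefl _ h0
  rw [lt_div_iff₀ hpos] at hi
  have h2 := X.ncard_edgeSet_le X.card_nbrs_le i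
  have h3 : δ / ((d : ℝ) + 1) * (X.graph i).edgeSet.ncard ≤
      δ / ((d : ℝ) + 1) * ((d + 1) * Nat.card (X.V i)) := by
    gcongr
    have : (0 : ℝ) ≤ Nat.card (X.V i) := Nat.cast_nonneg _
    linarith
  have h4 : δ / ((d : ℝ) + 1) * ((d + 1) * Nat.card (X.V i)) = δ * Nat.card (X.V i) := by
    field_simp
  linarith

/-- The gap constant is preserved exactly: the error sets have o(|X_i|) vertices, so uniform
integrability kills their contribution along every non-principal ultrafilter. -/
theorem IsExpander.hasUltraproductSpectralGap_of_approximatelyIsomorphic {X X' : BoxSpace}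
    (hX' : X'.IsExpander) (h : X.ApproximatelyIsomorphic X') : X.HasUltraproductSpectralGap := by
  obtain ⟨c, hc, hgap⟩ := X'.isExpander_iff.1 hX'
  obtain ⟨Y, Y', he, hv, hv', hE, hE'⟩ := h
  have hgraph : ∀ i, ((Y i).coe.map (Function.Embedding.subtype _)) = (Y i).spanningCoe := by
    intro i
    ext v w
    simp only [SimpleGraph.map_adj, SimpleGraph.Subgraph.coe_adj,
      SimpleGraph.Subgraph.spanningCoe_adj]
    constructor
    · rintro ⟨x, y, h, rfl, rfl⟩
      exact h
    · exact fun h => ⟨⟨v, h.fst_mem⟩, ⟨w, h.snd_mem⟩, h, rfl, rfl⟩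
  have hgraph' : ∀ i, ((Y i).coe.map
      ((he i).some.toEquiv.toEmbedding.trans (Function.Embedding.subtype _))) =
        (Y' i).spanningCoe := by
    intro i
    ext v w
    simp only [SimpleGraph.map_adj, SimpleGraph.Subgraph.spanningCoe_adj]
    constructor
    · rintro ⟨x, y, h, rfl, rfl⟩
      exact (he i).some.map_adj_iff.2 h
    · refine fun h => ⟨(he i).some.symm ⟨v, h.fst_mem⟩, (he i).some.symm ⟨w, h.snd_mem⟩,
        (he i).some.symm.map_adj_iff.2 h, ?_, ?_⟩
      · exact congrArg Subtype.val ((he i).some.apply_symm_apply ⟨v, h.fst_mem⟩)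
      · exact congrArg Subtype.val ((he i).some.apply_symm_apply ⟨w, h.snd_mem⟩)
  -- Errors measured against |X'_i| must be measured against |X_i|, where the functions live.
  have hcard : ∀ᶠ i in atTop, (Nat.card (X'.V i) : ℝ) ≤ 2 * Nat.card (X.V i) := by
    filter_upwards [hv'.eventually (lt_mem_nhds (show (1 / 2 : ℝ) < 1 by norm_num)),
      X'.tendsto_natCast_card.eventually_gt_atTop 0] with i hi hpos
    rw [lt_div_iff₀ hpos] at hi
    have h1 : (Y' i).verts.ncard = (Y i).verts.ncard :=
      (Nat.card_congr (he i).some.toEquiv).symm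
    have h2 : ((Y i).verts.ncard : ℝ) ≤ Nat.card (X.V i) := by
      exact_mod_cast Set.ncard_le_card (Y i).verts
    rw [h1] at hi
    linarith
  refine ⟨c, hc, fun u hu => (X.hasSpectralGapAlong_iff u hc).2 fun f => ?_⟩
  set d := max X.degBound X'.degBound with hd
  have hdX : ∀ i v, (nbrs (X.graph i) v).card ≤ d :=
    fun i v => (X.card_nbrs_le i v).trans (le_max_left _ _)
  have hdX' : ∀ i v, (nbrs (X'.graph i) v).card ≤ d :=
    fun i v => (X'.card_nbrs_le i v).trans (le_max_right _ _)
  have key := fun i => by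
    haveI : Fintype (Y i).verts := Fintype.ofFinite _
    exact HasGraphGap.exists_gap_le_of_map (hgraph i ▸ (Y i).spanningCoe_le)
      (hgraph' i ▸ (Y' i).spanningCoe_le) (hdX i) (hdX' i) hc (hgap i) (f.1 i)
  choose T T' hT hT' hTT using key
  refine le_of_forall_pos_le_add fun ε hε => ?_
  set K : ℝ := 4 * d ^ 2 * (c + 1) with hK
  have hK0 : 0 ≤ K := by positivity
  obtain ⟨δ, hδ, hfδ⟩ := f.2.2 (ε / (2 * K + 1)) (by positivity)
  have hη : 0 < δ / (4 * (d + 1)) := by positivity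
  refine le_of_tendsto_of_tendsto ((X.tendsto_inner_preUltraLaplacian u f).const_mul c)
    ((X.tendsto_norm_sq_preUltraLaplacian u f).add_const ε) ?_
  refine (le_atTop_of_ne_pure hu) ?_
  filter_upwards [hcard, X.eventually_ncard_edgeSet_sub_le _ hE hη,
    X'.eventually_ncard_edgeSet_sub_le _ hE' hη, X.tendsto_natCast_card.eventually_gt_atTop 0]
    with i hi h1 h2 hpos
  have hT1 := hT i
  have hT2 := hT' i
  rw [hgraph, SimpleGraph.Subgraph.edgeSet_spanningCoe] at hT1
  rw [hgraph', SimpleGraph.Subgraph.edgeSet_spanningCoe] at hT2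
  have e1 : ((T i).card : ℝ) ≤ δ * Nat.card (X.V i) := by
    calc ((T i).card : ℝ) ≤ (d + 1) * (2 * (δ / (4 * (d + 1)) * Nat.card (X.V i))) :=
          hT1.trans (by gcongr)
      _ = δ / 2 * Nat.card (X.V i) := by
          field_simp
          ring
      _ ≤ _ := by
          gcongr
          linarith
  have e2 : ((T' i).card : ℝ) ≤ δ * Nat.card (X.V i) := by
    calc ((T' i).card : ℝ) ≤ (d + 1) * (2 * (δ / (4 * (d + 1)) * (2 * Nat.card (X.V i)))) :=
          hT2.trans (by gcongr; exact h2.trans (by gcongr))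
      _ = _ := by
          field_simp
          ring
  have h3 := hfδ i _ e1
  have h4 := hfδ i _ e2
  have h5 := hTT i
  have h6 : K * (ε / (2 * K + 1) * Nat.card (X.V i) + ε / (2 * K + 1) * Nat.card (X.V i)) ≤
      ε * Nat.card (X.V i) := by
    have : K * (ε / (2 * K + 1) * Nat.card (X.V i) + ε / (2 * K + 1) * Nat.card (X.V i)) =
        (2 * K / (2 * K + 1)) * (ε * Nat.card (X.V i)) := by ring
    rw [this]
    refine mul_le_of_le_one_left (by positivity) ?_
    rw [div_le_one (by positivity)]
    linarith
  rw [← mul_div_assoc, div_add' _ _ _ hpos.ne', div_le_div_iff_of_pos_right hpos]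
  refine h5.trans ?_
  have h7 := mul_le_mul_of_nonneg_left (add_le_add h3 h4) hK0
  linarith

end BoxSpace

/-! ### The Roe algebra acting on the ultraproduct -/

noncomputable section

namespace BoxSpace

variable (X : BoxSpace)

variable {X} in
theorem dist_eq_top {x y : X.Pt} (h : x.1 ≠ y.1) : X.dist x y = ⊤ := by
  by_contra hne
  obtain ⟨p, -⟩ := SimpleGraph.exists_walk_of_edist_ne_top hne
  have key : ∀ {a b : X.Pt}, X.disjointUnion.Walk a b → a.1 = b.1 := by
    intro a b p
    induction p with
    | nil => rfl
    | cons h _ ih =>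
      obtain ⟨i, v, w, -, rfl, rfl⟩ := h
      exact ih
  exact h (key p)

variable {X} in
theorem entry_eq_zero_of_fst_ne (T : X.roe) {x y : X.Pt} (h : x.1 ≠ y.1) :
    entry T.1 x y = 0 := by
  obtain ⟨R, hR⟩ := T.2
  exact hR x y (by rw [dist_eq_top h]; exact le_top)

/-- The action of an operator on `ℓ²(X)` on the functions on one of the graphs. -/
def block (T : X.L2 →L[ℂ] X.L2) (i : ℕ) : (X.V i → ℂ) →ₗ[ℂ] (X.V i → ℂ) where
  toFun f v := ∑ w, entry T ⟨i, w⟩ ⟨i, v⟩ * f w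
  map_add' f g := by
    funext v
    simp only [Pi.add_apply, mul_add, Finset.sum_add_distrib]
  map_smul' c f := by
    funext v
    simp only [Pi.smul_apply, smul_eq_mul, RingHom.id_apply, Finset.mul_sum]
    exact Finset.sum_congr rfl fun _ _ => by ring

theorem block_apply (T : X.L2 →L[ℂ] X.L2) (i : ℕ) (f : X.V i → ℂ) (v : X.V i) :
    X.block T i f v = ∑ w, entry T ⟨i, w⟩ ⟨i, v⟩ * f w := rfl

/-- Finite propagation forbids entries between different graphs, so T is block diagonal; algebraic
identities for the blocks follow from those on ℓ²(X). -/
theorem block_restrict (T : X.roe) (F : X.L2) (i : ℕ) (v : X.V i) :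
    X.block T.1 i (fun w => F ⟨i, w⟩) v = T.1 F ⟨i, v⟩ := by
  have h := hasSum_sum_of_ne_finset_zero (L := SummationFilter.unconditional _) (f := fun z : X.Pt => entry T.1 z ⟨i, v⟩ * F z)
    (s := Finset.univ.map (Function.Embedding.sigmaMk i)) (fun z hz => by
      rw [entry_eq_zero_of_fst_ne, zero_mul]
      rintro h
      obtain ⟨j, w⟩ := z
      obtain rfl : j = i := h
      exact hz (Finset.mem_map.2 ⟨w, Finset.mem_univ _, rfl⟩))
  rw [Finset.sum_map] at h
  exact h.unique (hasSum_apply T.1 F ⟨i, v⟩)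

theorem block_mul (S T : X.roe) (i : ℕ) (f : X.V i → ℂ) :
    X.block (S * T).1 i f = X.block S.1 i (X.block T.1 i f) := by
  obtain ⟨F, hF, -⟩ := X.exists_extend f
  obtain rfl : (fun v => F ⟨i, v⟩) = f := funext hF
  funext v
  have h : X.block T.1 i (fun w => F ⟨i, w⟩) = fun w => T.1 F ⟨i, w⟩ :=
    funext (X.block_restrict T F i)
  rw [h, block_restrict, block_restrict]
  rfl

theorem block_add (S T : X.L2 →L[ℂ] X.L2) (i : ℕ) (f : X.V i → ℂ) :
    X.block (S + T) i f = X.block S i f + X.block T i f := by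
  funext v
  simp only [Pi.add_apply, block_apply, entry_add, add_mul, Finset.sum_add_distrib]

theorem block_algebraMap (c : ℂ) (i : ℕ) (f : X.V i → ℂ) :
    X.block (algebraMap ℂ _ c) i f = c • f := by
  funext v
  rw [block_apply, Finset.sum_eq_single v, entry_algebraMap_self]
  · rfl
  · intro w _ hw
    rw [entry_algebraMap_ne, zero_mul]
    simpa using hw
  · simp

theorem sum_block_star (T : X.L2 →L[ℂ] X.L2) (i : ℕ) (f g : X.V i → ℂ) :
    ∑ v, starRingEnd ℂ (X.block (star T) i f v) * g v =
      ∑ v, starRingEnd ℂ (f v) * X.block T i g v := by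
  simp only [block_apply, map_sum, map_mul, entry_star, Complex.conj_conj, Finset.sum_mul,
    Finset.mul_sum]
  rw [Finset.sum_comm]
  exact Finset.sum_congr rfl fun v _ => Finset.sum_congr rfl fun w _ => by ring

theorem block_laplacian (i : ℕ) (f : X.V i → ℂ) :
    X.block X.laplacian i f = graphLaplacian (X.graph i) f := by
  obtain ⟨F, hF, -⟩ := X.exists_extend f
  obtain rfl : (fun v => F ⟨i, v⟩) = f := funext hF
  exact funext fun v => X.block_restrict X.roeLaplacian F i v

theorem sum_sq_block_le (T : X.roe) (i : ℕ) (f : X.V i → ℂ) :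
    ∑ v, ‖X.block T.1 i f v‖ ^ 2 ≤ ‖T.1‖ ^ 2 * ∑ v, ‖f v‖ ^ 2 := by
  obtain ⟨F, hF, hF0⟩ := X.exists_extend f
  have hnorm : ‖F‖ ^ 2 = ∑ v, ‖f v‖ ^ 2 := by
    rw [(X.hasSum_norm_sq_L2 F).unique (hasSum_single i fun j hj =>
      Finset.sum_eq_zero fun v _ => by rw [hF0 j v hj]; simp)]
    simp only [hF]
  obtain rfl : (fun v => F ⟨i, v⟩) = f := funext hF
  rw [← hnorm, ← mul_pow]
  calc ∑ v, ‖X.block T.1 i (fun w => F ⟨i, w⟩) v‖ ^ 2 = ∑ v : X.V i, ‖T.1 F ⟨i, v⟩‖ ^ 2 := by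
        simp only [block_restrict]
    _ ≤ ‖T.1 F‖ ^ 2 :=
        le_hasSum (X.hasSum_norm_sq_L2 (T.1 F)) i fun _ _ =>
          Finset.sum_nonneg fun _ _ => by positivity
    _ ≤ _ := by
        gcongr
        exact T.1.le_opNorm F

theorem exists_entry_support (T : X.roe) : ∃ (N : ℕ) (s : ∀ i, X.V i → Finset (X.V i)),
    (∀ i v, (s i v).card ≤ N) ∧
    (∀ i v w, entry T.1 ⟨i, w⟩ ⟨i, v⟩ ≠ 0 → w ∈ s i v) ∧ ∀ i v w, w ∈ s i v ↔ v ∈ s i w := by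
  classical
  obtain ⟨R, hR⟩ := T.2
  obtain ⟨N, hN⟩ := X.exists_ball R
  choose s hs hmem using hN
  refine ⟨N, fun i v => Finset.univ.filter fun w => X.dist ⟨i, v⟩ ⟨i, w⟩ ≤ R, fun i v => ?_,
    fun i v w h => ?_, fun i v w => ?_⟩
  · rw [← Finset.card_map (Function.Embedding.sigmaMk i)]
    refine (Finset.card_le_card fun z hz => ?_).trans (hs ⟨i, v⟩)
    obtain ⟨w, hw, rfl⟩ := Finset.mem_map.1 hz
    exact hmem _ _ (Finset.mem_filter.1 hw).2
  · refine Finset.mem_filter.2 ⟨Finset.mem_univ _, ?_⟩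
    by_contra hlt
    refine h (hR _ _ ?_)
    rw [dist_comm]
    exact (not_le.1 hlt).le
  · simp [dist_comm]

variable {X} in
-- By bounded propagation and degree, Tf on a set A depends only on f on a set of size at most N|A|,
-- so small sets are controlled by small sets.
theorem block_mem_uniformlyIntegrable (T : X.roe) {f : ∀ i, X.V i → ℂ}
    (hf : f ∈ X.uniformlyIntegrable) : (fun i => X.block T.1 i (f i)) ∈ X.uniformlyIntegrable := by
  classical
  obtain ⟨⟨B, hB⟩, hf⟩ := hf
  obtain ⟨N, s, hs, hmem, -⟩ := X.exists_entry_support T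
  refine ⟨⟨‖T.1‖ ^ 2 * B, fun i => (X.sum_sq_block_le T i (f i)).trans ?_⟩, fun ε hε => ?_⟩
  · rw [mul_assoc]
    gcongr
    exact hB i
  · obtain ⟨δ, hδ, h⟩ := hf (ε / (‖T.1‖ ^ 2 + 1)) (by positivity)
    refine ⟨δ / (N + 1), by positivity, fun i A hA => ?_⟩
    set A' := A.biUnion (s i) with hA'
    set g : X.V i → ℂ := fun w => if w ∈ A' then f i w else 0 with hg
    have hgf : ∀ v ∈ A, X.block T.1 i (f i) v = X.block T.1 i g v := by
      intro v hv
      rw [block_apply, block_apply]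
      refine Finset.sum_congr rfl fun w _ => ?_
      by_cases h0 : entry T.1 ⟨i, w⟩ ⟨i, v⟩ = 0
      · rw [h0, zero_mul, zero_mul]
      · rw [hg]
        simp only
        rw [if_pos (Finset.mem_biUnion.2 ⟨v, hv, hmem i v w h0⟩)]
    have hcard : (A'.card : ℝ) ≤ δ * Nat.card (X.V i) := by
      have h1 : (A'.card : ℝ) ≤ A.card * N := by
        exact_mod_cast Finset.card_biUnion_le_card_mul _ _ _ fun v _ => hs i v
      rw [div_mul_eq_mul_div, le_div_iff₀ (by positivity)] at hA
      have h2 : (0 : ℝ) ≤ A.card := Nat.cast_nonneg _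
      linarith
    have hsum : ∑ v, ‖g v‖ ^ 2 = ∑ v ∈ A', ‖f i v‖ ^ 2 := by
      rw [← Finset.univ_inter A', ← Finset.sum_ite_mem]
      refine Finset.sum_congr rfl fun v _ => ?_
      by_cases hv : v ∈ A' <;> simp [hg, hv]
    calc ∑ v ∈ A, ‖X.block T.1 i (f i) v‖ ^ 2 = ∑ v ∈ A, ‖X.block T.1 i g v‖ ^ 2 :=
          Finset.sum_congr rfl fun v hv => by rw [hgf v hv]
      _ ≤ ∑ v, ‖X.block T.1 i g v‖ ^ 2 :=
          Finset.sum_le_sum_of_subset_of_nonneg (Finset.subset_univ _) fun _ _ _ => by positivity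
      _ ≤ ‖T.1‖ ^ 2 * (ε / (‖T.1‖ ^ 2 + 1) * Nat.card (X.V i)) := by
          refine (X.sum_sq_block_le T i g).trans ?_
          rw [hsum]
          gcongr
          exact h i A' hcard
      _ = ‖T.1‖ ^ 2 / (‖T.1‖ ^ 2 + 1) * (ε * Nat.card (X.V i)) := by ring
      _ ≤ _ := by
          refine mul_le_of_le_one_left (by positivity) ?_
          rw [div_le_one (by positivity)]
          linarith

variable (u : Ultrafilter ℕ)

/-- The termwise action of an element of the Roe algebra on uniformly integrable sequences. -/
def preUltraAction (T : X.roe) : X.PreUltraproduct u →L[ℂ] X.PreUltraproduct u :=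
  LinearMap.mkContinuous
    (show X.uniformlyIntegrable →ₗ[ℂ] X.uniformlyIntegrable from
      LinearMap.restrict (LinearMap.pi fun i => X.block T.1 i ∘ₗ LinearMap.proj i)
        fun _ hf => block_mem_uniformlyIntegrable T hf)
    ‖T.1‖ fun f => by
      refine le_of_sq_le_sq ?_ (by positivity)
      rw [mul_pow]
      refine le_of_tendsto_of_tendsto' (X.tendsto_norm_sq u _)
        ((X.tendsto_norm_sq u f).const_mul _) fun i => ?_
      rw [← mul_div_assoc]
      gcongr
      exact X.sum_sq_block_le T i (f.1 i)

theorem completion_preUltraAction_coe (T : X.roe) (f : X.PreUltraproduct u) :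
    (X.preUltraAction u T).completion (f : X.Ultraproduct u) =
      (X.preUltraAction u T f : X.Ultraproduct u) :=
  UniformSpace.Completion.map_coe (X.preUltraAction u T).uniformContinuous f

variable {X u} in
theorem ultraproduct_hom_ext {A B : X.Ultraproduct u →L[ℂ] X.Ultraproduct u}
    (h : ∀ f : X.PreUltraproduct u, A (f : X.Ultraproduct u) = B (f : X.Ultraproduct u)) :
    A = B := by
  ext f
  refine UniformSpace.Completion.induction_on f (isClosed_eq A.continuous B.continuous) h

variable {X u} in
theorem preUltraproduct_ext {f g : X.PreUltraproduct u} (h : ∀ i, f.1 i = g.1 i) : f = g :=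
  Subtype.ext (funext h)

/-- The representation of the Roe algebra on the ultraproduct. -/
def ultraRep : X.roe →⋆ₐ[ℂ] (X.Ultraproduct u →L[ℂ] X.Ultraproduct u) where
  toFun T := (X.preUltraAction u T).completion
  map_one' := ultraproduct_hom_ext fun f => by
    rw [completion_preUltraAction_coe]
    refine congrArg _ (preUltraproduct_ext fun i => ?_)
    have := X.block_algebraMap 1 i (f.1 i)
    rw [map_one, one_smul] at this
    exact this
  map_mul' S T := ultraproduct_hom_ext fun f => by
    rw [mul_apply_eq_comp, completion_preUltraAction_coe, completion_preUltraAction_coe,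
      completion_preUltraAction_coe]
    exact congrArg _ (preUltraproduct_ext fun i => X.block_mul S T i (f.1 i))
  map_zero' := ultraproduct_hom_ext fun f => by
    rw [completion_preUltraAction_coe]
    have h : X.preUltraAction u 0 f = 0 := preUltraproduct_ext fun i => by
      have := X.block_algebraMap 0 i (f.1 i)
      rw [map_zero, zero_smul] at this
      exact this
    rw [h]
    rfl
  map_add' S T := ultraproduct_hom_ext fun f => by
    rw [add_apply, completion_preUltraAction_coe, completion_preUltraAction_coe,
      completion_preUltraAction_coe, ← UniformSpace.Completion.coe_add]
    exact congrArg _ (preUltraproduct_ext fun i => X.block_add S.1 T.1 i (f.1 i))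
  commutes' c := ultraproduct_hom_ext fun f => by
    rw [completion_preUltraAction_coe,
      Algebra.algebraMap_eq_smul_one (A := X.Ultraproduct u →L[ℂ] X.Ultraproduct u), smul_apply,
      one_apply_eq_self, ← UniformSpace.Completion.coe_smul]
    exact congrArg _ (preUltraproduct_ext fun i => X.block_algebraMap c i (f.1 i))
  map_star' T := by
    rw [ContinuousLinearMap.star_eq_adjoint, ContinuousLinearMap.eq_adjoint_iff]
    intro f g
    refine UniformSpace.Completion.induction_on₂ f g ?_ fun f g => ?_
    · exact isClosed_eq (by fun_prop) (by fun_prop)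
    · rw [completion_preUltraAction_coe, completion_preUltraAction_coe,
        UniformSpace.Completion.inner_coe, UniformSpace.Completion.inner_coe]
      refine tendsto_nhds_unique (X.tendsto_inner_preUltra u _ _)
        ((X.tendsto_inner_preUltra u _ _).congr fun i => ?_)
      exact congrArg (· / (Nat.card (X.V i) : ℂ)) (X.sum_block_star T.1 i (f.1 i) (g.1 i)).symm

theorem ultraRep_coe (T : X.roe) (f : X.PreUltraproduct u) :
    X.ultraRep u T (f : X.Ultraproduct u) = (X.preUltraAction u T f : X.Ultraproduct u) :=
  X.completion_preUltraAction_coe u T f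

theorem ultraRep_roeLaplacian : X.ultraRep u X.roeLaplacian = X.ultraLaplacian u :=
  ultraproduct_hom_ext fun f => by
    rw [ultraRep_coe, ultraLaplacian_coe]
    exact congrArg _ (preUltraproduct_ext fun i => X.block_laplacian i (f.1 i))

/-- The spectrum can only shrink under a representation that factors through the reduction to `Z`. -/
theorem spectrum_map_subset_maxLaplacian {Z : Set (Ultrafilter X.Pt)} {H : Type}
    [NormedAddCommGroup H] [InnerProductSpace ℂ H] [CompleteSpace H]
    (π : X.roe →⋆ₐ[ℂ] (H →L[ℂ] H)) (hπ : ∀ S, VanishesOn S Z → π S = 0) :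
    spectrum ℂ (π X.roeLaplacian) ⊆ spectrum ℂ (X.maxLaplacian Z) := by
  let ρ : X.ReductionAlgebra Z →+* (H →L[ℂ] H) := (π : X.roe →+* (H →L[ℂ] H))
  -- The maximal norm dominates the norm in each admissible representation, so `ρ` extends to the
  -- completion; a unital ring homomorphism then carries invertible elements to invertible ones.
  have hρ : Continuous ρ := by
    refine AddMonoidHomClass.continuous_of_bound ρ 1 fun T => ?_
    rw [one_mul]
    exact norm_map_le_maxNorm Z T π hπ
  let Ψ : X.MaxCStar Z →+* (H →L[ℂ] H) := UniformSpace.Completion.extensionHom ρ hρ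
  have hΨ : ∀ T : X.ReductionAlgebra Z, Ψ (T : X.MaxCStar Z) = ρ T :=
    UniformSpace.Completion.extensionHom_coe ρ hρ
  intro z hz hunit
  refine hz ?_
  have h1 : Ψ (algebraMap ℂ _ z - X.maxLaplacian Z) = algebraMap ℂ _ z - π X.roeLaplacian := by
    rw [map_sub, UniformSpace.Completion.algebraMap_def, hΨ]
    refine congrArg₂ _ ?_ (hΨ _)
    exact AlgHomClass.commutes π z
  have := hunit.map Ψ
  rwa [h1] at this

end BoxSpace

end

/-! ### Functions vanishing over the core act trivially -/

noncomputable section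

namespace BoxSpace

variable {X : BoxSpace}

theorem exists_controlled_of_mem_coarseGroupoid {a b : Ultrafilter X.Pt}
    (h : (a, b) ∈ X.coarseGroupoid) :
    ∃ R : ℕ, ∀ A ∈ a, ∀ B ∈ b, ∃ x ∈ A, ∃ y ∈ B, X.dist x y ≤ R := by
  obtain ⟨R, hR⟩ := Set.mem_iUnion.1 h
  refine ⟨R, fun A hA B hB => ?_⟩
  obtain ⟨-, ⟨hx, hy⟩, ⟨p, hp, rfl⟩⟩ := mem_closure_iff.1 hR _
    ((ultrafilter_isOpen_basic A).prod (ultrafilter_isOpen_basic B)) ⟨hA, hB⟩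
  exact ⟨p.1, hx, p.2, hy, hp⟩

theorem mem_of_mem_boundaryOf {A : Set X.Pt} {a : Ultrafilter X.Pt} (h : a ∈ X.boundaryOf A) :
    A ∈ a := by
  refine closure_minimal ?_ (ultrafilter_isClosed_basic A) h.1
  rintro _ ⟨x, hx, rfl⟩
  exact hx

/-- A groupoid arrow from the boundary of the complement of Y lies in the closure of some E_R, so it
would produce points of the sequence within R of that complement, arbitrarily far out. -/
theorem map_mem_core {Y : Set X.Pt} {x : ℕ → X.Pt} (hx : Tendsto (fun m => (x m).1) atTop atTop)
    (hY : ∀ R : ℕ, ∀ᶠ m in atTop, ∀ z, X.dist (x m) z ≤ R → z ∈ Y) {w : Ultrafilter ℕ}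
    (hw : (w : Filter ℕ) ≤ atTop) : w.map x ∈ X.core Y := by
  refine ⟨?_, ?_⟩
  · rintro ⟨p, hp⟩
    have h1 : ∀ᶠ m in w, x m = p := by
      have : {p} ∈ w.map x := by
        rw [← hp]
        exact Set.mem_singleton p
      exact this
    have h2 : ∀ᶠ m in w, p.1 < (x m).1 := hw (hx.eventually_gt_atTop _)
    obtain ⟨m, h3, h4⟩ := (h1.and h2).exists
    rw [h3] at h4
    exact lt_irrefl _ h4
  · rintro ⟨a, ha, hg⟩
    obtain ⟨R, hR⟩ := exists_controlled_of_mem_coarseGroupoid hg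
    obtain ⟨z, hz, y, hy, hzy⟩ := hR Yᶜ (mem_of_mem_boundaryOf ha)
      {y | ∀ z, X.dist y z ≤ R → z ∈ Y} (hw (hY R))
    exact hz (hy z (by rwa [dist_comm]))

/-- By compactness: if large entries occurred at points escaping to infinity and ever farther from
the complement of Y, a limit along an ultrafilter would be an arrow between two points of the core
at which S does not vanish. A single m bounds both the exceptional indices and the distance. -/
theorem exists_dist_le_of_vanishesOn {Y : Set X.Pt} {S : X.roe} (hS : VanishesOn S (X.core Y))
    {ε : ℝ} (hε : 0 < ε) : ∃ m : ℕ, ∀ x : X.Pt, m ≤ x.1 → (∃ y, ε ≤ ‖entry S.1 x y‖) →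
      ∃ z, z ∉ Y ∧ X.dist x z ≤ m := by
  by_contra! hcon
  choose x hx hex hfar using hcon
  choose y hy using hex
  obtain ⟨R, hR⟩ := S.2
  have hxy : ∀ m, X.dist (x m) (y m) ≤ R := by
    intro m
    by_contra hlt
    have := hy m
    rw [hR _ _ (not_le.1 hlt).le, norm_zero] at this
    exact not_lt.2 this hε
  have hfst : ∀ m, (x m).1 = (y m).1 := by
    intro m
    by_contra hne
    have := hy m
    rw [entry_eq_zero_of_fst_ne S hne, norm_zero] at this
    exact not_lt.2 this hε
  have hxt : Tendsto (fun m => (x m).1) atTop atTop := tendsto_atTop_mono hx tendsto_id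
  have hyt : Tendsto (fun m => (y m).1) atTop atTop := by simpa only [hfst] using hxt
  have hxY : ∀ R' : ℕ, ∀ᶠ m in atTop, ∀ z, X.dist (x m) z ≤ R' → z ∈ Y := by
    intro R'
    filter_upwards [eventually_ge_atTop R'] with m hm z hz
    by_contra hzY
    exact absurd (hz.trans (by exact_mod_cast hm)) (not_le.2 (hfar m z hzY))
  have hyY : ∀ R' : ℕ, ∀ᶠ m in atTop, ∀ z, X.dist (y m) z ≤ R' → z ∈ Y := by
    intro R'
    filter_upwards [hxY (R + R')] with m hm z hz
    refine hm z ?_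
    push_cast
    exact (SimpleGraph.edist_triangle (v := y m)).trans (add_le_add (hxy m) hz)
  set w : Ultrafilter ℕ := hyperfilter ℕ
  have hw : (w : Filter ℕ) ≤ atTop := Nat.hyperfilter_le_atTop
  set g : Ultrafilter X.Pt × Ultrafilter X.Pt := (w.map x, w.map y)
  have hlim : Tendsto (fun m => X.pairEmbedding (x m, y m)) w (𝓝 g) :=
    ((Ultrafilter.tendsto_pure_self (w.map x)).comp tendsto_map).prodMk_nhds
      ((Ultrafilter.tendsto_pure_self (w.map y)).comp tendsto_map)
  have hg : g ∈ X.coarseGroupoid :=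
    Set.mem_iUnion.2 ⟨R, mem_closure_of_tendsto hlim
      (Eventually.of_forall fun m => ⟨(x m, y m), hxy m, rfl⟩)⟩
  have h0 := hS g hg (map_mem_core hxt hxY hw) (map_mem_core hyt hyY hw) R
  have h1 : Tendsto (fun m => (x m, y m)) w
      (comap X.pairEmbedding (𝓝 g) ⊓ 𝓟 (X.controlled R)) :=
    tendsto_inf.2 ⟨tendsto_comap_iff.2 hlim, tendsto_principal.2 (Eventually.of_forall hxy)⟩
  have h2 := (h0.comp h1).norm
  rw [norm_zero] at h2
  obtain ⟨m, hm⟩ := (h2.eventually (gt_mem_nhds hε)).exists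
  exact not_lt.2 (hy m) hm

/-- Such vertices lie in a bounded neighbourhood of the complement of Y_i, whose size is at most a
constant times |X_i \ Y_i|. -/
theorem eventually_card_le_of_vanishesOn {Y : ∀ i, Set (X.V i)}
    (hY : Tendsto (fun i => ((Y i).ncard : ℝ) / Nat.card (X.V i)) atTop (𝓝 1)) {S : X.roe}
    (hS : VanishesOn S (X.core {x | x.2 ∈ Y x.1})) {ε δ : ℝ} (hε : 0 < ε) (hδ : 0 < δ) :
    ∀ᶠ i in atTop, ∀ A : Finset (X.V i), (∀ w ∈ A, ∃ v, ε ≤ ‖entry S.1 ⟨i, w⟩ ⟨i, v⟩‖) →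
      (A.card : ℝ) ≤ δ * Nat.card (X.V i) := by
  classical
  obtain ⟨m, hm⟩ := exists_dist_le_of_vanishesOn hS hε
  obtain ⟨N, hN⟩ := X.exists_ball m
  choose s hs hmem using hN
  have h1 : (1 : ℝ) - δ / (N + 1) < 1 := by
    have : 0 < δ / ((N : ℝ) + 1) := by positivity
    linarith
  filter_upwards [eventually_ge_atTop m, hY.eventually (lt_mem_nhds h1),
    X.tendsto_natCast_card.eventually_gt_atTop 0] with i hi hYi hpos A hA
  rw [lt_div_iff₀ hpos] at hYi
  set B : Finset (X.V i) := Finset.univ.filter (· ∉ Y i) with hB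
  have hsub : A.map (Function.Embedding.sigmaMk i) ⊆ B.biUnion fun b => s ⟨i, b⟩ := by
    intro x hx
    obtain ⟨w, hw, rfl⟩ := Finset.mem_map.1 hx
    obtain ⟨v, hv⟩ := hA w hw
    obtain ⟨⟨j, z⟩, hz, hd⟩ := hm ⟨i, w⟩ hi ⟨_, hv⟩
    obtain rfl : i = j := by
      by_contra hne
      rw [dist_eq_top (by exact hne)] at hd
      exact absurd hd (by simp)
    refine Finset.mem_biUnion.2 ⟨z, Finset.mem_filter.2 ⟨Finset.mem_univ _, hz⟩, hmem _ _ ?_⟩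
    rw [dist_comm]
    exact hd
  have hcard : (A.card : ℝ) ≤ B.card * N := by
    rw [← Finset.card_map (Function.Embedding.sigmaMk i)]
    exact_mod_cast (Finset.card_le_card hsub).trans
      (Finset.card_biUnion_le_card_mul _ _ _ fun b _ => hs _)
  have hBc : (B.card : ℝ) + (Y i).ncard = Nat.card (X.V i) := by
    have h2 : (B : Set (X.V i)) = (Y i)ᶜ := by
      ext v
      simp [hB]
    have h3 := Set.ncard_add_ncard_compl (Y i)
    rw [← h2, Set.ncard_coe_finset] at h3
    rw [← h3]
    push_cast
    ring
  have h4 : (B.card : ℝ) ≤ δ / (N + 1) * Nat.card (X.V i) := by linarith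
  calc (A.card : ℝ) ≤ δ / (N + 1) * Nat.card (X.V i) * N := hcard.trans (by gcongr)
    _ = N / (N + 1) * (δ * Nat.card (X.V i)) := by ring
    _ ≤ _ := by
        refine mul_le_of_le_one_left (by positivity) ?_
        rw [div_le_one (by positivity)]
        linarith

/-- Split f into its parts on A and off A: the operator norm handles the first, and for the second a
Schur estimate with at most N entries of size ε in each row and column suffices. N depends on S
only, so ε may be chosen afterwards. -/
theorem exists_sum_sq_block_le (S : X.roe) : ∃ N : ℕ, ∀ (ε : ℝ) (i : ℕ) (A : Finset (X.V i)),
    (∀ w ∉ A, ∀ v, ‖entry S.1 ⟨i, w⟩ ⟨i, v⟩‖ ≤ ε) → ∀ f : X.V i → ℂ,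
      ∑ v, ‖X.block S.1 i f v‖ ^ 2 ≤
        2 * ‖S.1‖ ^ 2 * ∑ w ∈ A, ‖f w‖ ^ 2 + 2 * N ^ 2 * ε ^ 2 * ∑ w, ‖f w‖ ^ 2 := by
  classical
  obtain ⟨N, s, hs, hmem, hsymm⟩ := X.exists_entry_support S
  refine ⟨N, fun ε i A hA f => ?_⟩
  set g : X.V i → ℂ := fun w => if w ∈ A then f w else 0 with hg
  set h : X.V i → ℂ := fun w => if w ∈ A then 0 else f w with hh
  have hfgh : f = g + h := by
    funext w
    by_cases hw : w ∈ A <;> simp [hg, hh, hw]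
  have hgsum : ∑ w, ‖g w‖ ^ 2 = ∑ w ∈ A, ‖f w‖ ^ 2 := by
    rw [← Finset.univ_inter A, ← Finset.sum_ite_mem]
    refine Finset.sum_congr rfl fun v _ => ?_
    by_cases hv : v ∈ A <;> simp [hg, hv]
  have hrow : ∀ v, ‖X.block S.1 i h v‖ ^ 2 ≤ N * ∑ w ∈ s i v, ε ^ 2 * ‖f w‖ ^ 2 := by
    intro v
    have h1 : X.block S.1 i h v = ∑ w ∈ s i v, entry S.1 ⟨i, w⟩ ⟨i, v⟩ * h w := by
      rw [block_apply]
      refine (Finset.sum_subset (Finset.subset_univ _) fun w _ hw => ?_).symm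
      rw [not_imp_comm.1 (hmem i v w) hw, zero_mul]
    calc ‖X.block S.1 i h v‖ ^ 2
        ≤ (∑ w ∈ s i v, ‖entry S.1 ⟨i, w⟩ ⟨i, v⟩ * h w‖) ^ 2 := by
          rw [h1]
          gcongr
          exact norm_sum_le _ _
      _ ≤ (s i v).card * ∑ w ∈ s i v, ‖entry S.1 ⟨i, w⟩ ⟨i, v⟩ * h w‖ ^ 2 :=
          sq_sum_le_card_mul_sum_sq
      _ ≤ N * ∑ w ∈ s i v, ε ^ 2 * ‖f w‖ ^ 2 := by
          gcongr with w _
          · exact hs i v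
          · by_cases hw : w ∈ A
            · simp only [hh, if_pos hw, mul_zero, norm_zero, zero_pow two_ne_zero]
              positivity
            · rw [norm_mul, mul_pow]
              simp only [hh, if_neg hw]
              gcongr
              exact hA w hw v
  have hhsum : ∑ v, ‖X.block S.1 i h v‖ ^ 2 ≤ N ^ 2 * ε ^ 2 * ∑ w, ‖f w‖ ^ 2 := by
    refine (Finset.sum_le_sum fun v _ => hrow v).trans ?_
    rw [← Finset.mul_sum, Finset.sum_comm' (t' := Finset.univ) (s' := fun w => s i w)
      (fun v w => by simp [hsymm i v w])]
    have : ∀ w, ∑ v ∈ s i w, ε ^ 2 * ‖f w‖ ^ 2 ≤ N * (ε ^ 2 * ‖f w‖ ^ 2) := by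
      intro w
      rw [Finset.sum_const, nsmul_eq_mul]
      have : ((s i w).card : ℝ) ≤ N := by exact_mod_cast hs i w
      gcongr
    calc (N : ℝ) * ∑ w, ∑ v ∈ s i w, ε ^ 2 * ‖f w‖ ^ 2
        ≤ N * ∑ w, N * (ε ^ 2 * ‖f w‖ ^ 2) := by gcongr with w _; exact this w
      _ = _ := by
          rw [← Finset.mul_sum, ← Finset.mul_sum]
          ring
  have hsplit : ∀ v, ‖X.block S.1 i f v‖ ^ 2 ≤
      2 * ‖X.block S.1 i g v‖ ^ 2 + 2 * ‖X.block S.1 i h v‖ ^ 2 := by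
    intro v
    rw [hfgh, map_add, Pi.add_apply]
    have := norm_add_le (X.block S.1 i g v) (X.block S.1 i h v)
    nlinarith [sq_nonneg (‖X.block S.1 i g v‖ - ‖X.block S.1 i h v‖),
      norm_nonneg (X.block S.1 i g v + X.block S.1 i h v)]
  have hgb := X.sum_sq_block_le S i g
  rw [hgsum] at hgb
  calc ∑ v, ‖X.block S.1 i f v‖ ^ 2
      ≤ ∑ v, (2 * ‖X.block S.1 i g v‖ ^ 2 + 2 * ‖X.block S.1 i h v‖ ^ 2) :=
        Finset.sum_le_sum fun v _ => hsplit v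
    _ = 2 * ∑ v, ‖X.block S.1 i g v‖ ^ 2 + 2 * ∑ v, ‖X.block S.1 i h v‖ ^ 2 := by
        rw [Finset.sum_add_distrib, Finset.mul_sum, Finset.mul_sum]
    _ ≤ _ := by linarith

/-- On the few vertices with a large entry, uniform integrability makes f negligible; elsewhere the
entries themselves are small. -/
theorem ultraRep_eq_zero {u : Ultrafilter ℕ} (hu : ∀ n, u ≠ pure n) {Y : ∀ i, Set (X.V i)}
    (hY : Tendsto (fun i => ((Y i).ncard : ℝ) / Nat.card (X.V i)) atTop (𝓝 1)) {S : X.roe}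
    (hS : VanishesOn S (X.core {x | x.2 ∈ Y x.1})) : X.ultraRep u S = 0 := by
  classical
  refine ultraproduct_hom_ext fun f => ?_
  rw [ultraRep_coe, zero_apply, ← norm_eq_zero, UniformSpace.Completion.norm_coe,
    ← sq_eq_zero_iff]
  refine le_antisymm ?_ (sq_nonneg _)
  obtain ⟨N, hN⟩ := exists_sum_sq_block_le S
  obtain ⟨⟨B, hB⟩, hf⟩ := f.2
  refine le_of_forall_pos_le_add fun η hη => ?_
  rw [zero_add]
  -- Chosen so that the small entries contribute at most η/2; `δ` below does the same for the
  -- exceptional vertices.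
  set ε : ℝ := √(η / (2 * (2 * N ^ 2 * |B| + 1))) with hεdef
  have hε : 0 < ε := Real.sqrt_pos.2 (by positivity)
  have hε2 : ε ^ 2 = η / (2 * (2 * N ^ 2 * |B| + 1)) := Real.sq_sqrt (by positivity)
  obtain ⟨δ, hδ, hfδ⟩ := hf (η / (2 * (2 * ‖S.1‖ ^ 2 + 1))) (by positivity)
  refine le_of_tendsto (X.tendsto_norm_sq u (X.preUltraAction u S f)) ?_
  refine (le_atTop_of_ne_pure hu) ?_
  filter_upwards [eventually_card_le_of_vanishesOn hY hS hε hδ,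
    X.tendsto_natCast_card.eventually_gt_atTop 0] with i hi hpos
  rw [div_le_iff₀ hpos]
  set A : Finset (X.V i) := Finset.univ.filter fun w => ∃ v, ε ≤ ‖entry S.1 ⟨i, w⟩ ⟨i, v⟩‖ with hA
  have h1 := hN ε i A (fun w hw v => by
    by_contra hlt
    exact hw (Finset.mem_filter.2 ⟨Finset.mem_univ _, v, (not_le.1 hlt).le⟩)) (f.1 i)
  have h2 := hfδ i A (hi A fun w hw => (Finset.mem_filter.1 hw).2)
  have h3 : ∑ w, ‖f.1 i w‖ ^ 2 ≤ |B| * Nat.card (X.V i) :=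
    (hB i).trans (by gcongr; exact le_abs_self B)
  refine h1.trans ?_
  calc 2 * ‖S.1‖ ^ 2 * ∑ w ∈ A, ‖f.1 i w‖ ^ 2 + 2 * N ^ 2 * ε ^ 2 * ∑ w, ‖f.1 i w‖ ^ 2
      ≤ 2 * ‖S.1‖ ^ 2 * (η / (2 * (2 * ‖S.1‖ ^ 2 + 1)) * Nat.card (X.V i)) +
        2 * N ^ 2 * ε ^ 2 * (|B| * Nat.card (X.V i)) := by gcongr
    _ = (2 * ‖S.1‖ ^ 2 / (2 * ‖S.1‖ ^ 2 + 1)) * (η / 2 * Nat.card (X.V i)) +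
        (2 * N ^ 2 * |B| / (2 * N ^ 2 * |B| + 1)) * (η / 2 * Nat.card (X.V i)) := by
        rw [hε2]
        field_simp
    _ ≤ 1 * (η / 2 * Nat.card (X.V i)) + 1 * (η / 2 * Nat.card (X.V i)) := by
        gcongr <;> · rw [div_le_one (by positivity)]; linarith
    _ = _ := by ring

theorem HasAlmostBoundaryT.hasUltraproductSpectralGap (h : X.HasAlmostBoundaryT) :
    X.HasUltraproductSpectralGap := by
  obtain ⟨Y, hY, c, hc, hgap⟩ := h
  refine ⟨c, hc, fun u hu => ?_⟩
  rw [HasSpectralGapAlong, ← ultraRep_roeLaplacian]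
  exact (X.spectrum_map_subset_maxLaplacian (X.ultraRep u)
    fun S hS => ultraRep_eq_zero hu hY hS).trans hgap

end BoxSpace

end

theorem corollary5p3 (X : BoxSpace) :
    ((∃ X' : BoxSpace, X'.IsExpander ∧ X.ApproximatelyIsomorphic X') →
      X.HasUltraproductSpectralGap) ∧
    (X.HasPositiveEdgeDensity →
      (X.HasUltraproductSpectralGap ↔
        ∃ X' : BoxSpace, X'.IsExpander ∧ X.ApproximatelyIsomorphic X') ∧
      (X.HasAlmostBoundaryT →
        ∃ X' : BoxSpace, X'.IsExpander ∧ X.ApproximatelyIsomorphic X')) := by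
  have hexp : (∃ X' : BoxSpace, X'.IsExpander ∧ X.ApproximatelyIsomorphic X') →
      X.HasUltraproductSpectralGap := by
    rintro ⟨X', hX', h⟩
    exact hX'.hasUltraproductSpectralGap_of_approximatelyIsomorphic h
  exact ⟨hexp, fun hE => ⟨⟨fun h => h.exists_approximatelyIsomorphic hE, hexp⟩,
    fun h => h.hasUltraproductSpectralGap.exists_approximatelyIsomorphic hE⟩⟩
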